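/- **Setting.** Let $m,T,E\ge 1$ and $n\ge Tm$ be integers, let $\zeta,\sigma>0$, and let $\eta_1,\dots,\eta_T$ be learning rates. Let $S=(x_1,\dots,x_n)$ consist of $n$ independent (not necessarily identically distributed) samples in a measurable space $\mathcal X$, and let $\ell:\mathcal X\times\mathbb R^d\to\mathbb R$ be a loss whose gradient $\nabla\ell(x,\theta)$ in $\theta$ is jointly measurable (the gradient is read as $0$ where $\ell(x,\cdot)$ is not differentiable). For $v\in\mathbb R^d$ write $\mathrm{clip}(v,\zeta)=\min(1,\zeta/\|v\|)\,v$, with $\mathrm{clip}(0,\zeta)=0$. Streaming DP-SGD starts from initial parameters $\theta_0\in\mathbb R^d$ and runs $E$ epochs. For each epoch $T$ pairwise disjoint index sets $I_1,\dots,I_T\subseteq\{1,\dots,n\}$ of size $m$ are given; in step $t=1,\dots,T$ of the epoch the algorithm forms $$u_t=\sum_{i\in I_t}\mathrm{clip}\bigl(\nabla\ell(x_i,\theta_{t-1}),\zeta\bigr)+\sigma z_t,\qquad z_t\sim\mathcal N(0,\mathrm I_d),$$ and computes new parameters $\theta_t$ by an arbitrary measurable deterministic rule from the learning rate $\eta_t$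 and all parameters and update vectors obtained so far; it outputs $\theta_t$. The next epoch starts from the last parameters of the previous one. The initialization and the batches may be random with any joint law, but are independent of $S$; the noise vectors are independent of each other and of everything else. Thus the streaming algorithm outputs all $ET$ parameter vectors computed; batch DP-SGD outputs only the last one. For probability measures $P,Q$ and $\beta\in(0,1)$ let $$D^\beta_\infty(P\|Q)=\sup_{O:\,P(O)>\beta}\log\frac{P(O)-\beta}{Q(O)},$$ where $O$ ranges over measurable events, and let the $\beta$-approximate max-information $I^\beta_\infty(\mathcal A(S),S)$ be $D^\beta_\infty$ of the joint law of $(\mathcal A(S),S)$ relative to the product of its two marginals. **Theorem.** Let $\mathcal A$ be streaming or batch DP-SGD as above, and put $$\nu=m\frac{\zeta^2}{\sigma^2},\qquad r_\nu=\sqrt{\tfrac1\nu+\tfrac14}-\tfrac12,\qquad F(x)=\frac{16\nu^2x^2+\nu x}{1-2\nu x},\qquad q=\sqrt{\tfrac2T\log\tfrac E\beta}.$$ Then, for every $\beta\in(0,1)$, $$I^\beta_\infty(\mathcal A(S),S)\le \tfrac12 ET\nu+E\inf_{\lambda\in(0,r_\nu)}\frac1\lambda\Bigl[T\,F\Bigl(\frac{\lambda+\lambda^2}{2}\Bigr)+\log\frac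 E\beta\Bigr],$$ and the right-hand side is at most $$ETm\frac{\zeta^2}{\sigma^2}\Bigl(1+3q+\tfrac12q^2\Bigr)+ET\sqrt m\,\frac\zeta\sigma\Bigl(\tfrac12+3q+\tfrac12q^2\Bigr).$$ -/

import Mathlib

open MeasureTheory ProbabilityTheory
open scoped ENNReal

noncomputable section

/-- `β`-approximate max-divergence `D^β_∞(P ‖ Q)` (natural logarithm): the supremum, over the
measurable events `O` with `P O > β`, of `log ((P O - β) / Q O)`, with values in `[-∞, ∞]`.
An event with `P O > β` and `Q O = 0` contributes `+∞`. -/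
def approxMaxDivergence {α : Type*} [MeasurableSpace α] (β : ℝ) (P Q : Measure α) : EReal :=
  ⨆ (O : Set α) (_ : MeasurableSet O) (_ : ENNReal.ofReal β < P O),
    ENNReal.log ((P O - ENNReal.ofReal β) / Q O)

/-- `β`-approximate max-information `I^β_∞(Y, S)` of a pair with joint law `J`: the approximate
max-divergence of the joint law from the product of its two marginals. -/
def approxMaxInformation {α γ : Type*} [MeasurableSpace α] [MeasurableSpace γ] (β : ℝ)
    (J : Measure (α × γ)) : EReal :=
  approxMaxDivergence β J (J.fst.prod J.snd)

/-- The parameter space `ℝ^d` with its Euclidean norm. -/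
abbrev Param (d : ℕ) : Type := EuclideanSpace ℝ (Fin d)

/-- Clipping of a vector to Euclidean length at most `ζ`. -/
def clip {d : ℕ} (v : Param d) (ζ : ℝ) : Param d := min 1 (ζ / ‖v‖) • v

/-- The possible index sets of one epoch: `T` pairwise disjoint batches of exactly `m` of the `n`
sample indices. -/
abbrev EpochBatches (n m T : ℕ) : Type :=
  {I : Fin T → Finset (Fin n) // (∀ t, (I t).card = m) ∧ ∀ s t, s ≠ t → Disjoint (I s) (I t)}

/-- A `GradientUpdate` routine. In the update number `k + 1` (counted through all epochs) with
learning rate `η`, it maps the parameters `θ_0, …, θ_k` and the update vectors `u_1, …, u_{k+1}`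
seen so far to the new parameters `θ_{k+1}`. The data enter only through these arguments. -/
abbrev UpdateRule (d : ℕ) : Type :=
  ℝ → (k : ℕ) → (Fin (k + 1) → Param d) → (Fin (k + 1) → Param d) → Param d

/-- One execution of DP-SGD, up to and including the update number `k`, with all sources of
randomness given as arguments: dataset `x`, initial parameters `θ₀`, batches `B` of each epoch and
noise vectors `z`. The value is `(θ_0, …, θ_k)` together with `(u_1, …, u_k)`. The update with
zero-based number `j` is step `j % T` of epoch `j / T`. An epoch starts from the last parameters
of the previous one. -/
def dpsgdRun {𝓧 : Type*} {d n m T E : ℕ} (loss : 𝓧 → Param d → ℝ) (upd : UpdateRule d)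
    (η : Fin T → ℝ) (ζ σ : ℝ) (x : Fin n → 𝓧) (θ₀ : Param d) (B : Fin E → EpochBatches n m T)
    (z : Fin (E * T) → Param d) :
    (k : ℕ) → k ≤ E * T → (Fin (k + 1) → Param d) × (Fin k → Param d)
  | 0, _ => (fun _ => θ₀, Fin.elim0)
  | k + 1, hk =>
    let past := dpsgdRun loss upd η ζ σ x θ₀ B z k (Nat.le_of_succ_le hk)
    let j : Fin (E * T) := ⟨k, hk⟩
    let θ : Param d := past.1 (Fin.last k)
    let u : Param d :=
      (∑ i ∈ (B j.divNat).1 j.modNat, clip (gradient (loss (x i)) θ) ζ) + σ • z j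
    let us : Fin (k + 1) → Param d := Fin.snoc past.2 u
    (Fin.snoc past.1 (upd (η j.modNat) k past.1 us), us)

/-- Output of streaming DP-SGD: the parameters after each of the `E * T` updates. -/
def dpsgdStream {𝓧 : Type*} {d n m T E : ℕ} (loss : 𝓧 → Param d → ℝ) (upd : UpdateRule d)
    (η : Fin T → ℝ) (ζ σ : ℝ) (x : Fin n → 𝓧) (θ₀ : Param d) (B : Fin E → EpochBatches n m T)
    (z : Fin (E * T) → Param d) : Fin (E * T) → Param d :=
  Fin.tail (dpsgdRun loss upd η ζ σ x θ₀ B z (E * T) le_rfl).1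

/-- Output of batch DP-SGD: the parameters after the last update. -/
def dpsgdBatch {𝓧 : Type*} {d n m T E : ℕ} (loss : 𝓧 → Param d → ℝ) (upd : UpdateRule d)
    (η : Fin T → ℝ) (ζ σ : ℝ) (x : Fin n → 𝓧) (θ₀ : Param d) (B : Fin E → EpochBatches n m T)
    (z : Fin (E * T) → Param d) : Param d :=
  (dpsgdRun loss upd η ζ σ x θ₀ B z (E * T) le_rfl).1 (Fin.last (E * T))

/-- Joint law of all random inputs of DP-SGD: independent samples `x_i ∼ P i`; independently of
them, the data-independent randomness `(θ₀, B) ∼ init` (initialization and batches of all epochs);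
and, independently of both, `E * T` independent standard Gaussian vectors. -/
def dpsgdInputLaw {𝓧 : Type*} [MeasurableSpace 𝓧] {d n m T E : ℕ} (P : Fin n → Measure 𝓧)
    (init : Measure (Param d × (Fin E → EpochBatches n m T))) :
    Measure ((Fin n → 𝓧) × (Param d × (Fin E → EpochBatches n m T)) × (Fin (E * T) → Param d)) :=
  (Measure.pi P).prod (init.prod (Measure.pi fun _ => stdGaussian (Param d)))

/-- Joint law of `(A(S), S)` for `A` streaming DP-SGD. -/
def streamJointLaw {𝓧 : Type*} [MeasurableSpace 𝓧] {d n m T E : ℕ} (loss : 𝓧 → Param d → ℝ)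
    (upd : UpdateRule d) (η : Fin T → ℝ) (ζ σ : ℝ) (P : Fin n → Measure 𝓧)
    (init : Measure (Param d × (Fin E → EpochBatches n m T))) :
    Measure ((Fin (E * T) → Param d) × (Fin n → 𝓧)) :=
  (dpsgdInputLaw P init).map fun w =>
    (dpsgdStream loss upd η ζ σ w.1 w.2.1.1 w.2.1.2 w.2.2, w.1)

/-- Joint law of `(A(S), S)` for `A` batch DP-SGD. -/
def batchJointLaw {𝓧 : Type*} [MeasurableSpace 𝓧] {d n m T E : ℕ} (loss : 𝓧 → Param d → ℝ)
    (upd : UpdateRule d) (η : Fin T → ℝ) (ζ σ : ℝ) (P : Fin n → Measure 𝓧)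
    (init : Measure (Param d × (Fin E → EpochBatches n m T))) :
    Measure (Param d × (Fin n → 𝓧)) :=
  (dpsgdInputLaw P init).map fun w =>
    (dpsgdBatch loss upd η ζ σ w.1 w.2.1.1 w.2.1.2 w.2.2, w.1)

/-- `F(x) = (16 ν² x² + ν x) / (1 - 2 ν x)`. -/
def expoF (ν x : ℝ) : ℝ := (16 * ν ^ 2 * x ^ 2 + ν * x) / (1 - 2 * ν * x)

/-- `r_ν = √(1/ν + 1/4) - 1/2`. -/
def radius (ν : ℝ) : ℝ := Real.sqrt (1 / ν + 1 / 4) - 1 / 2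

/-- `½ E T ν + E inf_{0 < l < r_ν} (1/l) (T F((l + l²)/2) + log (E/β))`. -/
def tightBound (E T : ℕ) (ν β : ℝ) : ℝ :=
  1 / 2 * E * T * ν +
    E * ⨅ l : Set.Ioo (0 : ℝ) (radius ν),
      1 / (l : ℝ) * (T * expoF ν (((l : ℝ) + (l : ℝ) ^ 2) / 2) + Real.log (E / β))

/-- `E T m (ζ²/σ²) (1 + 3 q + q²/2) + E T √m (ζ/σ) (½ + 3 q + q²/2)`. -/
def explicitBound (E T m : ℕ) (ζ σ q : ℝ) : ℝ :=
  E * T * m * (ζ ^ 2 / σ ^ 2) * (1 + 3 * q + 1 / 2 * q ^ 2) +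
    E * T * Real.sqrt m * (ζ / σ) * (1 / 2 + 3 * q + 1 / 2 * q ^ 2)

end

/-! Fix the initialization and the batches. In units of the noise level, DP-SGD is a chain of
adaptive queries u_j = g_j(u_{<j}, x) + z_j, where g_j is a sum over a batch of m vectors of norm at
most r = ζ/σ, and all parameters are functions of the path u. By Cameron-Martin the path has, given
x, density e^{X(u,x)} relative to the pure noise γ (`lintegral_answers`). Relative to γ ⊗ P the
joint law thus has density e^X, and the product of the marginals has density e^L with L(u) = log ∫
e^{X(u,x)} dP(x). Where X ≤ K + L the joint law is at most e^K times the product; the rest has mass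
at most e^{-αK} ∫∫ e^{(1+α)X - αL} by Chernoff (`lintegral_answers_le`). Everything therefore rests
on bounding this moment, for α = l/E, by exp(T(νl/2 + F((l+l²)/2))) (`lintegral_moment_le`).

One epoch: by Jensen L may be replaced by the mean of X over x. Each step then uses fresh samples,
and integrating out its answer leaves the exponential of a multiple of ‖g_j - E g_j‖². McDiarmid's
inequality makes this norm sub-Gaussian, and F bounds the exponential moment of its square
(`lintegral_step_le_of_eq_one`).

Several epochs: samples are reused, so the steps do not decouple. Instead u is fixed and X(u,·) is
treated as a function of independent samples. Entropy tensorizes, giving a modified logarithmic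
Sobolev inequality for e^{tX} with some energy D, and a Herbst argument
(`integral_exp_le_of_entropy_le`) bounds the moment by ∫∫ e^{X + kD} with 2k = α + 2α². This is an
exponential moment of kD under the true joint law, where the noise u_j - g_j is a standard Gaussian
independent of the past (`lintegral_step`), so it can be computed step by step. Write δ_i for the
share of sample i in X.

Two energies are used. With D = 2∑(δ_i - log avg_i e^{δ_i}), Cauchy-Schwarz separates a Gaussian
linear term from reciprocals of marginal likelihoods, whose mean is one up to a small correlation
effect (`lintegral_inv_marginal_le`); this needs (α + 2α²)m to be small. With D = ∑(⅔δ_i² + ⅓ avg_i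
δ_i²), δ_i is close to a Gaussian correlation and one propagates Gaussian quadratic exponentials
whose coefficient deteriorates once per epoch (`lintegral_eexp_X_add_corrSq_le`); this is good when
(α + 2α²)m is not small. Elementary inequalities show that in each regime the result is below the
same F. -/

set_option linter.unusedSectionVars false

/-! ### Averages over single coordinates of a product measure. -/

section Averaging

/-- Resampling one coordinate preserves a product of probability measures. -/
theorem measurePreserving_update {ι : Type*} [Fintype ι] [DecidableEq ι] {X : ι → Type*}
    [∀ i, MeasurableSpace (X i)] (μ : ∀ i, Measure (X i)) [∀ i, IsProbabilityMeasure (μ i)]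
    (i : ι) :
    MeasurePreserving (fun p : (∀ j, X j) × X i => Function.update p.1 i p.2)
      ((Measure.pi μ).prod (μ i)) (Measure.pi μ) := by
  refine ⟨measurable_update', ?_⟩
  refine (Measure.pi_eq fun s hs => ?_).symm
  rw [Measure.map_apply measurable_update' (MeasurableSet.univ_pi hs)]
  have : (fun p : (∀ j, X j) × X i => Function.update p.1 i p.2) ⁻¹' (Set.univ.pi s)
      = (Set.univ.pi (Function.update s i Set.univ)) ×ˢ (s i) := by
    ext p
    simp only [Set.mem_preimage, Set.mem_pi, Set.mem_univ, true_implies, Set.mem_prod]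
    constructor
    · intro h
      refine ⟨fun j => ?_, by simpa using h i⟩
      by_cases hj : j = i
      · subst hj; simp
      · simpa [hj] using h j
    · rintro ⟨h1, h2⟩ j
      by_cases hj : j = i
      · subst hj; simpa using h2
      · simpa [hj] using h1 j
  rw [this, Measure.prod_prod, Measure.pi_pi]
  rw [← Finset.mul_prod_erase _ _ (Finset.mem_univ i),
    ← Finset.mul_prod_erase _ (fun j => μ j (s j)) (Finset.mem_univ i)]
  simp only [Function.update_self, measure_univ, one_mul]
  rw [mul_comm]
  congr 1
  refine Finset.prod_congr rfl fun j hj => ?_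
  rw [Function.update_of_ne (Finset.ne_of_mem_erase hj)]

theorem lintegral_update {ι : Type*} [Fintype ι] [DecidableEq ι] {X : ι → Type*}
    [∀ i, MeasurableSpace (X i)] (μ : ∀ i, Measure (X i)) [∀ i, IsProbabilityMeasure (μ i)]
    (i : ι) {F : (∀ j, X j) → ℝ≥0∞} (hF : Measurable F) :
    ∫⁻ x, ∫⁻ y, F (Function.update x i y) ∂μ i ∂Measure.pi μ = ∫⁻ x, F x ∂Measure.pi μ := by
  rw [← (measurePreserving_update μ i).lintegral_comp hF]
  exact (lintegral_prod (fun p : (∀ j, X j) × X i => F (Function.update p.1 i p.2))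
    (hF.comp measurable_update').aemeasurable).symm

/-- A bounded measurable real function. -/
structure BddMeas {Ω : Type*} [MeasurableSpace Ω] (F : Ω → ℝ) : Prop where
  meas : Measurable F
  bdd : ∃ C : ℝ, ∀ x, |F x| ≤ C

namespace BddMeas

variable {Ω : Type*} [MeasurableSpace Ω] {F G : Ω → ℝ}

theorem integrable (hF : BddMeas F) (μ : Measure Ω) [IsFiniteMeasure μ] : Integrable F μ := by
  obtain ⟨C, hC⟩ := hF.bdd
  exact Integrable.of_bound hF.meas.aestronglyMeasurable C (ae_of_all _ hC)

theorem const (c : ℝ) : BddMeas fun _ : Ω => c := ⟨measurable_const, |c|, fun _ => le_rfl⟩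

theorem add (hF : BddMeas F) (hG : BddMeas G) : BddMeas fun x => F x + G x := by
  obtain ⟨C, hC⟩ := hF.bdd
  obtain ⟨D, hD⟩ := hG.bdd
  exact ⟨hF.meas.add hG.meas, C + D, fun x => (abs_add_le _ _).trans (add_le_add (hC x) (hD x))⟩

theorem neg (hF : BddMeas F) : BddMeas fun x => -F x := by
  obtain ⟨C, hC⟩ := hF.bdd
  exact ⟨hF.meas.neg, C, fun x => by simpa using hC x⟩

theorem sub (hF : BddMeas F) (hG : BddMeas G) : BddMeas fun x => F x - G x := by
  simpa only [sub_eq_add_neg] using hF.add hG.neg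

theorem mul (hF : BddMeas F) (hG : BddMeas G) : BddMeas fun x => F x * G x := by
  obtain ⟨C, hC⟩ := hF.bdd
  obtain ⟨D, hD⟩ := hG.bdd
  refine ⟨hF.meas.mul hG.meas, C * D, fun x => ?_⟩
  rw [abs_mul]
  exact mul_le_mul (hC x) (hD x) (abs_nonneg _) ((abs_nonneg _).trans (hC x))

theorem const_mul (c : ℝ) (hF : BddMeas F) : BddMeas fun x => c * F x := (const c).mul hF

theorem pow (hF : BddMeas F) (k : ℕ) : BddMeas fun x => F x ^ k := by
  induction k with
  | zero => simpa using const (Ω := Ω) 1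
  | succ k ih => simpa only [pow_succ] using ih.mul hF

theorem sum {ι : Type*} (s : Finset ι) {f : ι → Ω → ℝ} (h : ∀ i ∈ s, BddMeas (f i)) :
    BddMeas fun x => ∑ i ∈ s, f i x := by
  classical
  induction s using Finset.induction_on with
  | empty => simpa using const (Ω := Ω) 0
  | insert a s ha ih =>
    simp only [Finset.sum_insert ha]
    exact (h a (by simp)).add (ih fun i hi => h i (by simp [hi]))

theorem exp (hF : BddMeas F) : BddMeas fun x => Real.exp (F x) := by
  obtain ⟨C, hC⟩ := hF.bdd
  refine ⟨hF.meas.exp, Real.exp C, fun x => ?_⟩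
  rw [Real.abs_exp]
  exact Real.exp_le_exp.2 ((le_abs_self _).trans (hC x))

theorem comp {Ω' : Type*} [MeasurableSpace Ω'] (hF : BddMeas F) {g : Ω' → Ω}
    (hg : Measurable g) : BddMeas fun x => F (g x) := by
  obtain ⟨C, hC⟩ := hF.bdd
  exact ⟨hF.meas.comp hg, C, fun x => hC _⟩

theorem integral_right {Ω' : Type*} [MeasurableSpace Ω'] {H : Ω × Ω' → ℝ} (hH : BddMeas H)
    (μ : Measure Ω') [IsProbabilityMeasure μ] : BddMeas fun x => ∫ y, H (x, y) ∂μ := by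
  obtain ⟨C, hC⟩ := hH.bdd
  refine ⟨(hH.meas.stronglyMeasurable.integral_prod_right' (ν := μ)).measurable, C, fun x => ?_⟩
  have := norm_integral_le_of_norm_le_const (μ := μ) (f := fun y => H (x, y)) (C := C)
    (ae_of_all _ fun y => hC _)
  simpa using this

end BddMeas

/-- A measurable function taking values in a compact subinterval of `(0, ∞)`. -/
structure PosBddMeas {Ω : Type*} [MeasurableSpace Ω] (F : Ω → ℝ) : Prop where
  meas : Measurable F
  bdd : ∃ c C : ℝ, 0 < c ∧ ∀ x, c ≤ F x ∧ F x ≤ C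

namespace PosBddMeas

variable {Ω : Type*} [MeasurableSpace Ω] {F G : Ω → ℝ}

theorem pos (hF : PosBddMeas F) (x : Ω) : 0 < F x := by
  obtain ⟨c, C, hc, h⟩ := hF.bdd
  exact hc.trans_le (h x).1

theorem bddMeas (hF : PosBddMeas F) : BddMeas F := by
  obtain ⟨c, C, hc, h⟩ := hF.bdd
  exact ⟨hF.meas, C, fun x => by rw [abs_of_pos (hF.pos x)]; exact (h x).2⟩

theorem log (hF : PosBddMeas F) : BddMeas fun x => Real.log (F x) := by
  obtain ⟨c, C, hc, h⟩ := hF.bdd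
  refine ⟨hF.meas.log, max |Real.log c| |Real.log C|, fun x => ?_⟩
  exact abs_le_max_abs_abs (Real.log_le_log hc (h x).1)
    (Real.log_le_log (hF.pos x) (h x).2)

theorem inv (hF : PosBddMeas F) : PosBddMeas fun x => (F x)⁻¹ := by
  obtain ⟨c, C, hc, h⟩ := hF.bdd
  by_cases hne : Nonempty Ω
  · obtain ⟨x₀⟩ := hne
    have hC : 0 < C := hc.trans_le ((h x₀).1.trans (h x₀).2)
    exact ⟨hF.meas.inv, C⁻¹, c⁻¹, inv_pos.2 hC, fun x =>
      ⟨inv_anti₀ (hF.pos x) (h x).2, inv_anti₀ hc (h x).1⟩⟩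
  · exact ⟨hF.meas.inv, 1, 1, one_pos, fun x => (hne ⟨x⟩).elim⟩

theorem _root_.BddMeas.posBddMeas_exp (hF : BddMeas F) :
    PosBddMeas fun x => Real.exp (F x) := by
  obtain ⟨C, hC⟩ := hF.bdd
  exact ⟨hF.meas.exp, Real.exp (-C), Real.exp C, Real.exp_pos _, fun x =>
    ⟨Real.exp_le_exp.2 (abs_le.1 (hC x)).1, Real.exp_le_exp.2 (abs_le.1 (hC x)).2⟩⟩

theorem comp {Ω' : Type*} [MeasurableSpace Ω'] (hF : PosBddMeas F) {g : Ω' → Ω}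
    (hg : Measurable g) : PosBddMeas fun x => F (g x) := by
  obtain ⟨c, C, hc, h⟩ := hF.bdd
  exact ⟨hF.meas.comp hg, c, C, hc, fun x => h _⟩

theorem integral_right {Ω' : Type*} [MeasurableSpace Ω'] {H : Ω × Ω' → ℝ} (hH : PosBddMeas H)
    (μ : Measure Ω') [IsProbabilityMeasure μ] : PosBddMeas fun x => ∫ y, H (x, y) ∂μ := by
  obtain ⟨c, C, hc, h⟩ := hH.bdd
  have hint : ∀ x, Integrable (fun y => H (x, y)) μ := fun x =>
    (hH.bddMeas.comp measurable_prodMk_left).integrable μ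
  refine ⟨(hH.bddMeas.integral_right μ).meas, c, C, hc, fun x => ⟨?_, ?_⟩⟩
  · have := integral_mono (μ := μ) (integrable_const c) (hint x) fun y => (h (x, y)).1
    simpa using this
  · have := integral_mono (μ := μ) (hint x) (integrable_const C) fun y => (h (x, y)).2
    simpa using this

theorem integral_pos (hF : PosBddMeas F) (μ : Measure Ω) [IsProbabilityMeasure μ] :
    0 < ∫ x, F x ∂μ := by
  obtain ⟨c, C, hc, h⟩ := hF.bdd
  have := integral_mono (μ := μ) (integrable_const c) (hF.bddMeas.integrable μ) fun y => (h y).1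
  simp at this
  linarith

end PosBddMeas

variable {ι : Type*} [Fintype ι] [DecidableEq ι] {𝓧 : Type*} [MeasurableSpace 𝓧]

/-- Average of `F` over coordinate `i`. -/
noncomputable def avg (P : ι → Measure 𝓧) (i : ι) (F : (ι → 𝓧) → ℝ) (x : ι → 𝓧) : ℝ :=
  ∫ y, F (Function.update x i y) ∂P i

variable (P : ι → Measure 𝓧) [∀ i, IsProbabilityMeasure (P i)]

theorem avg_update (i : ι) (F : (ι → 𝓧) → ℝ) (x : ι → 𝓧) (y : 𝓧) :
    avg P i F (Function.update x i y) = avg P i F x := by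
  simp [avg]

theorem BddMeas.avg {F : (ι → 𝓧) → ℝ} (hF : BddMeas F) (i : ι) : BddMeas (avg P i F) :=
  BddMeas.integral_right (H := fun p : (ι → 𝓧) × 𝓧 => F (Function.update p.1 i p.2))
    (hF.comp measurable_update') (P i)

theorem PosBddMeas.avg {F : (ι → 𝓧) → ℝ} (hF : PosBddMeas F) (i : ι) :
    PosBddMeas (avg P i F) :=
  PosBddMeas.integral_right (H := fun p : (ι → 𝓧) × 𝓧 => F (Function.update p.1 i p.2))
    (hF.comp measurable_update') (P i)

theorem BddMeas.integrable_update {F : (ι → 𝓧) → ℝ} (hF : BddMeas F) (i : ι) (x : ι → 𝓧) :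
    Integrable (fun y => F (Function.update x i y)) (P i) :=
  (hF.comp (measurable_update x)).integrable (P i)

theorem integral_avg {F : (ι → 𝓧) → ℝ} (hF : BddMeas F) (i : ι) :
    ∫ x, avg P i F x ∂Measure.pi P = ∫ x, F x ∂Measure.pi P := by
  have h := measurePreserving_update P i
  have hm : AEStronglyMeasurable F (Measure.map
      (fun p : (ι → 𝓧) × 𝓧 => Function.update p.1 i p.2) ((Measure.pi P).prod (P i))) :=
    hF.meas.aestronglyMeasurable
  have h1 := integral_map h.measurable.aemeasurable hm
  rw [h.map_eq] at h1
  rw [h1]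
  exact (integral_prod (fun p : (ι → 𝓧) × 𝓧 => F (Function.update p.1 i p.2))
    ((hF.comp measurable_update').integrable _)).symm

theorem avg_mul_of_update {F c : (ι → 𝓧) → ℝ} (i : ι)
    (hc : ∀ x y, c (Function.update x i y) = c x) (x : ι → 𝓧) :
    avg P i (fun x => F x * c x) x = avg P i F x * c x := by
  simp only [avg, hc, integral_mul_const]

/-- `avg P i` is the conditional expectation given the other coordinates, so factors that ignore
coordinate `i` pass through it. -/
theorem integral_avg_mul {F c : (ι → 𝓧) → ℝ} (hF : BddMeas F) (hcm : BddMeas c) (i : ι)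
    (hc : ∀ x y, c (Function.update x i y) = c x) :
    ∫ x, avg P i F x * c x ∂Measure.pi P = ∫ x, F x * c x ∂Measure.pi P := by
  rw [← integral_avg P (hF.mul hcm) i]
  simp_rw [avg_mul_of_update P i hc]

/-- Averages over the coordinates in a list, the head being averaged first. -/
noncomputable def avgList (F : (ι → 𝓧) → ℝ) : List ι → (ι → 𝓧) → ℝ
  | [] => F
  | i :: l => avg P i (avgList F l)

theorem avgList_congr (F : (ι → 𝓧) → ℝ) (l : List ι) :
    ∀ x x' : ι → 𝓧, (∀ j, j ∉ l → x j = x' j) → avgList P F l x = avgList P F l x' := by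
  induction l with
  | nil =>
    intro x x' h
    have : x = x' := funext fun j => h j (by simp)
    rw [this]
  | cons i l ih =>
    intro x x' h
    simp only [avgList, avg]
    congr 1
    ext y
    refine ih _ _ fun j hj => ?_
    by_cases hji : j = i
    · subst hji; simp
    · simp only [Function.update_of_ne hji]
      exact h j (by simp [hji, hj])

theorem PosBddMeas.avgList {F : (ι → 𝓧) → ℝ} (hF : PosBddMeas F) (l : List ι) :
    PosBddMeas (avgList P F l) := by
  induction l with
  | nil => exact hF
  | cons i l ih => exact ih.avg P i

theorem BddMeas.avgList {F : (ι → 𝓧) → ℝ} (hF : BddMeas F) (l : List ι) :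
    BddMeas (avgList P F l) := by
  induction l with
  | nil => exact hF
  | cons i l ih => exact ih.avg P i

theorem integral_avgList {F : (ι → 𝓧) → ℝ} (hF : BddMeas F) (l : List ι) :
    ∫ x, avgList P F l x ∂Measure.pi P = ∫ x, F x ∂Measure.pi P := by
  induction l with
  | nil => rfl
  | cons i l ih => rw [← ih]; exact integral_avg P (hF.avgList P l) i

theorem avgList_univ {F : (ι → 𝓧) → ℝ} (hF : BddMeas F) (l : List ι) (hl : ∀ i, i ∈ l)
    (x : ι → 𝓧) : avgList P F l x = ∫ x, F x ∂Measure.pi P := by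
  rw [← integral_avgList P hF l]
  have : ∀ x', avgList P F l x' = avgList P F l x := fun x' =>
    avgList_congr P F l _ _ fun j hj => (hj (hl j)).elim
  simp_rw [this]
  simp

end Averaging

/-! ### Tensorization of entropy. -/

section Entropy

variable {ι : Type*} [Fintype ι] [DecidableEq ι] {𝓧 : Type*} [MeasurableSpace 𝓧]
variable (P : ι → Measure 𝓧) [∀ i, IsProbabilityMeasure (P i)]

/-- Variational lower bound for the entropy in one coordinate. -/
theorem integral_mul_log_div_avg_le {f h : (ι → 𝓧) → ℝ} (hf : PosBddMeas f) (hh : PosBddMeas h)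
    (i : ι) :
    ∫ x, f x * (Real.log (h x) - Real.log (avg P i h x)) ∂Measure.pi P ≤
      ∫ x, f x * (Real.log (f x) - Real.log (avg P i f x)) ∂Measure.pi P := by
  have hA := hh.avg P i
  have hB := hf.avg P i
  have key : ∀ x, f x * (Real.log (h x) - Real.log (avg P i h x)) -
      f x * (Real.log (f x) - Real.log (avg P i f x)) ≤
      h x * (avg P i f x * (avg P i h x)⁻¹) - f x := by
    intro x
    have h1 := hA.pos x
    have h2 := hB.pos x
    have h3 := hf.pos x
    have h4 := hh.pos x
    -- The argument is the ratio of the conditional densities h / avg h and f / avg f. After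
    -- multiplication by f the bound y - 1 integrates to zero, since avg h · (avg f / avg h) = avg
    -- f.
    have := Real.log_le_sub_one_of_pos
      (x := h x * avg P i f x / (avg P i h x * f x)) (by positivity)
    rw [Real.log_div (by positivity) (by positivity), Real.log_mul h4.ne' h2.ne',
      Real.log_mul h1.ne' h3.ne'] at this
    have h5 := mul_le_mul_of_nonneg_left this h3.le
    have h6 : f x * (h x * avg P i f x / (avg P i h x * f x) - 1) =
      h x * (avg P i f x * (avg P i h x)⁻¹) - f x := by
      field_simp
    rw [h6] at h5
    linarith
  have hc : BddMeas fun x => avg P i f x * (avg P i h x)⁻¹ := hB.bddMeas.mul hA.inv.bddMeas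
  have hi1 := (hf.bddMeas.mul (hh.log.sub hA.log)).integrable (Measure.pi P)
  have hi2 := (hf.bddMeas.mul (hf.log.sub hB.log)).integrable (Measure.pi P)
  have hi3 := (hh.bddMeas.mul hc).integrable (Measure.pi P)
  have := integral_mono (hi1.sub hi2) (hi3.sub (hf.bddMeas.integrable _)) key
  simp only [Pi.sub_apply] at this
  rw [integral_sub hi1 hi2, integral_sub hi3 (hf.bddMeas.integrable _),
    ← integral_avg_mul P hh.bddMeas hc i (fun x y => by simp only [avg_update])] at this
  have h7 : ∀ x, avg P i h x * (avg P i f x * (avg P i h x)⁻¹) = avg P i f x := fun x => by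
    have := (hA.pos x).ne'
    field_simp
  simp_rw [h7] at this
  rw [integral_avg P hf.bddMeas i] at this
  linarith

/-- Tensorization of the entropy of a positive function under a product measure. -/
theorem entropy_le_sum {f : (ι → 𝓧) → ℝ} (hf : PosBddMeas f) :
    ∫ x, f x * (Real.log (f x) - Real.log (∫ x, f x ∂Measure.pi P)) ∂Measure.pi P ≤
      ∑ i, ∫ x, f x * (Real.log (f x) - Real.log (avg P i f x)) ∂Measure.pi P := by
  have key : ∀ l : List ι, l.Nodup →
      ∫ x, f x * (Real.log (f x) - Real.log (avgList P f l x)) ∂Measure.pi P ≤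
      ∑ i ∈ l.toFinset, ∫ x, f x * (Real.log (f x) - Real.log (avg P i f x)) ∂Measure.pi P := by
    intro l hl
    induction l with
    | nil => simp [avgList]
    | cons i l ih =>
      rw [List.nodup_cons] at hl
      rw [List.toFinset_cons, Finset.sum_insert (by simpa using hl.1)]
      -- Chain rule: averaging one more coordinate adds the increment log(avgList f) - log(avg_i
      -- avgList f), and the variational bound with h = avgList f replaces the partial average by f
      -- itself.
      have h1 := integral_mul_log_div_avg_le P hf (hf.avgList P l) i
      have h2 := ih hl.2
      have hl' := (hf.avgList P l).log
      have hl'' := ((hf.avgList P l).avg P i).log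
      rw [← sub_nonneg]
      have h3 : ∫ x, f x * (Real.log (f x) - Real.log (avgList P f (i :: l) x)) ∂Measure.pi P =
        ∫ x, f x * (Real.log (avgList P f l x) - Real.log (avg P i (avgList P f l) x))
          ∂Measure.pi P +
        ∫ x, f x * (Real.log (f x) - Real.log (avgList P f l x)) ∂Measure.pi P := by
        rw [← integral_add ((hf.bddMeas.mul (hl'.sub hl'')).integrable _)
          ((hf.bddMeas.mul (hf.log.sub hl')).integrable _)]
        congr 1
        ext x
        simp only [avgList]
        ring
      rw [h3]
      linarith
  have := key (Finset.univ : Finset ι).toList (Finset.nodup_toList _)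
  simpa [avgList_univ P hf.bddMeas _ (fun i => by simp : ∀ i, i ∈ (Finset.univ : Finset ι).toList)]
    using this

end Entropy

/-! ### Modified logarithmic Sobolev inequalities and the Herbst argument. -/

section Herbst

/-- `(1 - x + x²/3) e^{x + x²/6} ≥ 1`. -/
theorem one_le_mul_exp_add_sq (x : ℝ) : 1 ≤ (1 - x + x ^ 2 / 3) * Real.exp (x + x ^ 2 / 6) := by
  -- With these coefficients all lower powers cancel in the derivative, which has the sign of y³.
  -- The minimum is therefore at 0, with value 1.
  have hd : ∀ y : ℝ, HasDerivAt (fun y => (1 - y + y ^ 2 / 3) * Real.exp (y + y ^ 2 / 6))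
      (y ^ 3 / 9 * Real.exp (y + y ^ 2 / 6)) y := by
    intro y
    have h1 : HasDerivAt (fun y : ℝ => 1 - y + y ^ 2 / 3) (-1 + 2 * y / 3) y := by
      refine (((hasDerivAt_id y).const_sub 1).add ((hasDerivAt_pow 2 y).div_const 3)).congr_deriv ?_
      norm_num
    have h2 : HasDerivAt (fun y : ℝ => y + y ^ 2 / 6) (1 + y / 3) y := by
      refine ((hasDerivAt_id y).add ((hasDerivAt_pow 2 y).div_const 6)).congr_deriv ?_
      norm_num; ring
    refine (h1.mul h2.exp).congr_deriv ?_
    ring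
  rcases le_total 0 x with hx | hx
  · have hm : MonotoneOn (fun y => (1 - y + y ^ 2 / 3) * Real.exp (y + y ^ 2 / 6)) (Set.Ici 0) := by
      refine monotoneOn_of_deriv_nonneg (convex_Ici 0)
        (fun y _ => (hd y).continuousAt.continuousWithinAt)
        (fun y _ => (hd y).differentiableAt.differentiableWithinAt) fun y hy => ?_
      rw [(hd y).deriv]
      have : 0 < y := by simpa using hy
      positivity
    have := hm (Set.mem_Ici.2 le_rfl) (Set.mem_Ici.2 hx) hx
    simpa using this
  · have hm : AntitoneOn (fun y => (1 - y + y ^ 2 / 3) * Real.exp (y + y ^ 2 / 6)) (Set.Iic 0) := by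
      refine antitoneOn_of_deriv_nonpos (convex_Iic 0)
        (fun y _ => (hd y).continuousAt.continuousWithinAt)
        (fun y _ => (hd y).differentiableAt.differentiableWithinAt) fun y hy => ?_
      rw [(hd y).deriv]
      have : y < 0 := by simpa using hy
      have h3 : y ^ 3 < 0 := by
        have : y ^ 3 = y * y ^ 2 := by ring
        rw [this]; exact mul_neg_of_neg_of_pos ‹_› (by nlinarith)
      have := Real.exp_pos (y + y ^ 2 / 6)
      nlinarith
    have := hm (Set.mem_Iic.2 hx) (Set.mem_Iic.2 le_rfl) hx
    simpa using this

/-- The pointwise inequality behind the entropy bound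
`Ent(e^h) ≤ ½ (⅔ E[e^h h²] + ⅓ E[e^h] E[h²])`. -/
theorem exp_mul_sub_one_le (x v : ℝ) (hv : 0 < v) :
    Real.exp x * (x - 1) + v - v * Real.log v ≤
      1 / 2 * (2 / 3 * (Real.exp x * x ^ 2) + 1 / 3 * (v * x ^ 2)) := by
  have h1 := one_le_mul_exp_add_sq x
  set A := (1 - x + x ^ 2 / 3) * Real.exp x with hA
  have h2 : 1 ≤ A * Real.exp (x ^ 2 / 6) := by
    rw [hA, mul_assoc, ← Real.exp_add]; exact h1
  have hApos : 0 < A := by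
    by_contra h
    push Not at h
    nlinarith [Real.exp_pos (x ^ 2 / 6), mul_nonneg (neg_nonneg.2 h) (Real.exp_pos (x ^ 2 / 6)).le]
  have h3 : -(x ^ 2 / 6) ≤ Real.log A := by
    rw [Real.le_log_iff_exp_le hApos, Real.exp_neg]
    rw [inv_le_iff_one_le_mul₀ (Real.exp_pos _)]
    exact h2
  -- Tangent line of the concave function v ↦ v - v log v at v = A, giving v - v log v ≤ A - v log
  -- A. The first inequality of the proof bounds log A from below by -x²/6.
  have h4 := Real.add_one_le_exp (Real.log A - Real.log v)
  rw [Real.exp_sub, Real.exp_log hApos, Real.exp_log hv] at h4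
  have h5 : v * (Real.log A - Real.log v + 1) ≤ A := by
    have := mul_le_mul_of_nonneg_left h4 hv.le
    rwa [mul_div_cancel₀ _ hv.ne'] at this
  have h6 := mul_le_mul_of_nonneg_left h3 hv.le
  have h7 : A = Real.exp x * x ^ 2 / 3 - Real.exp x * (x - 1) := by rw [hA]; ring
  nlinarith

variable {Ω : Type*} [MeasurableSpace Ω]

theorem BddMeas.hasDerivAt_cgf {X : Ω → ℝ} (hX : BddMeas X) (μ : Measure Ω)
    [IsProbabilityMeasure μ] (t : ℝ) :
    HasDerivAt (fun t => Real.log (∫ x, Real.exp (t * X x) ∂μ))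
      ((∫ x, Real.exp (t * X x) * X x ∂μ) / ∫ x, Real.exp (t * X x) ∂μ) t := by
  have h : t ∈ interior (integrableExpSet X μ) := by
    have : integrableExpSet X μ = Set.univ := by
      ext s
      simp only [integrableExpSet, Set.mem_ofPred_eq, Set.mem_univ, iff_true]
      exact (hX.const_mul s).exp.integrable μ
    rw [this]; simp
  have h1 := hasDerivAt_mgf h
  have hpos : 0 < mgf X μ t := (hX.const_mul t).posBddMeas_exp.integral_pos μ
  refine (h1.log hpos.ne').congr_deriv ?_
  simp only [mgf, mul_comm]

/-- Gibbs' variational inequality. -/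
theorem integral_exp_mul_le {Y Z : Ω → ℝ} (hY : BddMeas Y) (hZ : BddMeas Z) (μ : Measure Ω)
    [IsProbabilityMeasure μ] :
    (∫ x, Real.exp (Y x) * (Z x - Y x) ∂μ) ≤
      (∫ x, Real.exp (Y x) ∂μ) *
        (Real.log (∫ x, Real.exp (Z x) ∂μ) - Real.log (∫ x, Real.exp (Y x) ∂μ)) := by
  set a := ∫ x, Real.exp (Y x) ∂μ
  set b := ∫ x, Real.exp (Z x) ∂μ
  have ha : 0 < a := hY.posBddMeas_exp.integral_pos μ
  have hb : 0 < b := hZ.posBddMeas_exp.integral_pos μ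
  have key : ∀ x, Real.exp (Y x) * (Z x - Y x) ≤
      (Real.log b - Real.log a - 1) * Real.exp (Y x) + a / b * Real.exp (Z x) := by
    intro x
    have h1 := Real.add_one_le_exp (Z x - Y x - (Real.log b - Real.log a))
    rw [Real.exp_sub, Real.exp_sub, Real.exp_sub, Real.exp_log ha, Real.exp_log hb] at h1
    have h2 := mul_le_mul_of_nonneg_left h1 (Real.exp_pos (Y x)).le
    have h3 : Real.exp (Y x) * (Real.exp (Z x) / Real.exp (Y x) / (b / a)) =
        a / b * Real.exp (Z x) := by
      have := (Real.exp_pos (Y x)).ne'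
      field_simp
    rw [h3] at h2
    linarith
  have hi1 := (hY.exp.mul (hZ.sub hY)).integrable μ
  have hi2 := (hY.exp.const_mul (Real.log b - Real.log a - 1)).integrable μ
  have hi3 := (hZ.exp.const_mul (a / b)).integrable μ
  have := integral_mono hi1 (hi2.add hi3) key
  simp only [Pi.add_apply] at this
  rw [integral_add hi2 hi3, integral_const_mul, integral_const_mul] at this
  change _ ≤ (Real.log b - Real.log a - 1) * a + a / b * b at this
  rw [div_mul_cancel₀ _ hb.ne'] at this
  linarith

/-- Gibbs' inequality against the constant function 0. -/
theorem entropy_exp_nonneg {X : Ω → ℝ} (hX : BddMeas X) (μ : Measure Ω)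
    [IsProbabilityMeasure μ] :
    0 ≤ ∫ x, Real.exp (X x) * (X x - Real.log (∫ x, Real.exp (X x) ∂μ)) ∂μ := by
  have h := integral_exp_mul_le hX (BddMeas.const 0) μ
  have hi1 := (hX.exp.mul hX).integrable μ
  have hi2 := (hX.exp.mul (BddMeas.const (Real.log (∫ x, Real.exp (X x) ∂μ)))).integrable μ
  simp only [zero_sub, mul_neg, integral_neg, Real.exp_zero, integral_const, probReal_univ,
    smul_eq_mul, mul_one, Real.log_one] at h
  simp_rw [mul_sub]
  rw [integral_sub hi1 hi2, integral_mul_const]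
  linarith

/-- A Herbst argument: a modified logarithmic Sobolev inequality for `e^{rX}`, `1 ≤ r ≤ 1 + α`,
bounds the moment of order `1 + α` of `e^X` by an exponential moment under the tilted measure. -/
theorem integral_exp_le_of_entropy_le {X D : Ω → ℝ} (hX : BddMeas X) (hD : BddMeas D)
    (μ : Measure Ω) [IsProbabilityMeasure μ] {α k : ℝ} (hα : 0 < α) (hk : 2 * k = α + 2 * α ^ 2)
    (hent : ∀ r : ℝ, 1 ≤ r → r ≤ 1 + α →
      ∫ x, Real.exp (r * X x) * (r * X x - Real.log (∫ x, Real.exp (r * X x) ∂μ)) ∂μ ≤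
        r ^ 2 / 2 * ∫ x, Real.exp (r * X x) * D x ∂μ) :
    (1 + α) * Real.log (∫ x, Real.exp (X x) ∂μ) +
        Real.log (∫ x, Real.exp (X x + k * D x) ∂μ) - Real.log (∫ x, Real.exp (X x) ∂μ) ≥
      Real.log (∫ x, Real.exp ((1 + α) * X x) ∂μ) := by
  have hkpos : 0 < k := by nlinarith [sq_nonneg α]
  set ψ : ℝ → ℝ := fun t => Real.log (∫ x, Real.exp (t * X x) ∂μ) with hψ
  set ψ' : ℝ → ℝ := fun t =>
    (∫ x, Real.exp (t * X x) * X x ∂μ) / ∫ x, Real.exp (t * X x) ∂μ with hψ'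
  have hder : ∀ t, HasDerivAt ψ (ψ' t) t := hX.hasDerivAt_cgf μ
  have hψ1 : ψ 1 = Real.log (∫ x, Real.exp (X x) ∂μ) := by simp [hψ]
  set b := Real.log (∫ x, Real.exp (X x + k * D x) ∂μ) with hb
  set ℓ := b - ψ 1 with hℓ
  have hpos : ∀ t, 0 < ∫ x, Real.exp (t * X x) ∂μ := fun t =>
    (hX.const_mul t).posBddMeas_exp.integral_pos μ
  have hXI : ∀ t, Integrable (fun x => Real.exp (t * X x) * X x) μ := fun t =>
    ((hX.const_mul t).exp.mul hX).integrable μ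
  have hEI : ∀ t, Integrable (fun x => Real.exp (t * X x)) μ := fun t =>
    (hX.const_mul t).exp.integrable μ
  have hDI : ∀ t, Integrable (fun x => Real.exp (t * X x) * D x) μ := fun t =>
    ((hX.const_mul t).exp.mul hD).integrable μ
  have hE : ∀ t, ∫ x, Real.exp (t * X x) * (t * X x - ψ t) ∂μ =
      (∫ x, Real.exp (t * X x) ∂μ) * (t * ψ' t - ψ t) := by
    intro t
    have : ∀ x, Real.exp (t * X x) * (t * X x - ψ t) =
        t * (Real.exp (t * X x) * X x) - ψ t * Real.exp (t * X x) := fun x => by ring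
    simp_rw [this]
    rw [integral_sub ((hXI t).const_mul _) ((hEI t).const_mul _), integral_const_mul,
      integral_const_mul]
    simp only [hψ']
    have := (hpos t).ne'
    field_simp
  -- Gibbs' inequality moves the mean of D from the tilt e^{tX} to the single exponential moment b,
  -- taken at tilt 1. Together with `hent` this closes into a differential inequality for ψ.
  have hG : ∀ t, k * ∫ x, Real.exp (t * X x) * D x ∂μ ≤
      (∫ x, Real.exp (t * X x) ∂μ) * ((t - 1) * ψ' t - ψ t + b) := by
    intro t
    have h1 := integral_exp_mul_le (hX.const_mul t) (hX.add (hD.const_mul k)) μ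
    have : ∀ x, Real.exp (t * X x) * (X x + k * D x - t * X x) =
        k * (Real.exp (t * X x) * D x) - (t - 1) * (Real.exp (t * X x) * X x) := fun x => by ring
    simp_rw [this] at h1
    rw [integral_sub ((hDI t).const_mul _) ((hXI t).const_mul _), integral_const_mul,
      integral_const_mul] at h1
    have h2 : ∫ x, Real.exp (t * X x) * X x ∂μ = (∫ x, Real.exp (t * X x) ∂μ) * ψ' t := by
      simp only [hψ']
      have := (hpos t).ne'
      field_simp
    rw [h2] at h1
    change _ ≤ _ * (b - ψ t) at h1
    nlinarith
  have hmain : ∀ r, 1 ≤ r → r ≤ 1 + α →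
      2 * k * (r * ψ' r - ψ r) ≤ r ^ 2 * ((r - 1) * ψ' r - ψ r + b) := by
    intro r h1 h2
    have h3 := hent r h1 h2
    change ∫ x, Real.exp (r * X x) * (r * X x - ψ r) ∂μ ≤ _ at h3
    rw [hE] at h3
    have h4 := hG r
    have h5 : (∫ x, Real.exp (r * X x) ∂μ) * (2 * k * (r * ψ' r - ψ r)) ≤
        (∫ x, Real.exp (r * X x) ∂μ) * (r ^ 2 * ((r - 1) * ψ' r - ψ r + b)) := by
      have h6 := mul_le_mul_of_nonneg_left h3 (by positivity : 0 ≤ 2 * k)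
      have h7 := mul_le_mul_of_nonneg_left h4 (by positivity : 0 ≤ r ^ 2)
      nlinarith
    exact le_of_mul_le_mul_left h5 (hpos r)
  have hent0 : 0 ≤ ψ' 1 - ψ 1 := by
    have h := entropy_exp_nonneg (hX.const_mul 1) μ
    change 0 ≤ ∫ x, Real.exp (1 * X x) * (1 * X x - ψ 1) ∂μ at h
    rw [hE] at h
    have h' := nonneg_of_mul_nonneg_right h (hpos 1)
    linarith
  have hℓ0 : 0 ≤ ℓ := by
    have := hmain 1 le_rfl (by linarith)
    have h' : 2 * k * (ψ' 1 - ψ 1) ≤ b - ψ 1 := by linarith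
    exact le_trans (by positivity) h'
  have hfin : ∀ ℓ' > ℓ, ψ (1 + α) - (1 + α) * ψ 1 ≤ ℓ' := by
    intro ℓ' hℓ'
    -- Barrier c a(1 + a) for a ↦ ψ(1+a) - (1+a)ψ(1): both vanish at a = 0, and the barrier equals
    -- ℓ' at a = α. Taking ℓ' > ℓ makes the comparison strict.
    set c := ℓ' / (α * (1 + α)) with hc
    have hcm : c * (α * (1 + α)) = ℓ' := by rw [hc]; field_simp
    have hcpos : 0 < c := by rw [hc]; exact div_pos (by linarith) (by positivity)
    have hΛ : ∀ a, HasDerivAt (fun a => ψ (1 + a) - (1 + a) * ψ 1) (ψ' (1 + a) - ψ 1) a := by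
      intro a
      have h1 : HasDerivAt (fun a : ℝ => 1 + a) 1 a := (hasDerivAt_id a).const_add 1
      have h2 := (hder (1 + a)).comp a h1
      have h3 := h2.sub (h1.mul_const (ψ 1))
      refine h3.congr_deriv ?_
      ring
    have hB : ∀ a, HasDerivAt (fun a : ℝ => c * (a * (1 + a))) (c * (1 + 2 * a)) a := by
      intro a
      have h1 := ((hasDerivAt_id a).mul ((hasDerivAt_id a).const_add 1)).const_mul c
      refine h1.congr_deriv ?_
      simp only [id]; ring
    have := image_le_of_deriv_right_lt_deriv_boundary
      (f := fun a => ψ (1 + a) - (1 + a) * ψ 1) (f' := fun a => ψ' (1 + a) - ψ 1) (a := 0)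
      (b := α) (B := fun a => c * (a * (1 + a))) (B' := fun a => c * (1 + 2 * a))
      (fun a _ => (hΛ a).continuousAt.continuousWithinAt)
      (fun a _ => (hΛ a).hasDerivWithinAt) (by simp) hB ?_ (x := α) ⟨hα.le, le_rfl⟩
    · simpa [hcm] using this
    · intro a ⟨ha0, ha1⟩ htouch
      by_contra hlt
      push Not at hlt
      have hm := hmain (1 + a) (by linarith) (by linarith)
      set p := ψ (1 + a)
      set p' := ψ' (1 + a)
      have hp : p = c * (a * (1 + a)) + (1 + a) * ψ 1 := by linarith
      -- If the curve touched the barrier with at least its slope, the differential inequality would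
      -- give c(2k - a²) ≤ ℓ. But 2k = α + 2α² makes 2k - a² ≥ α(1+α), so c(2k - a²) ≥ ℓ' > ℓ.
      have hbl : b = ℓ + ψ 1 := by rw [hℓ]; ring
      have e1 : (1 + a) * a ≤ 2 * k := by nlinarith
      -- the coefficient of the derivative is nonnegative
      have e2 : (1 + a) * ((2 * k) - (1 + a) * a) * (c * (1 + 2 * a)) ≤
          (1 + a) * ((2 * k) - (1 + a) * a) * (p' - ψ 1) :=
        mul_le_mul_of_nonneg_left hlt (mul_nonneg (by linarith) (by linarith))
      have e3 : (1 + a) ^ 2 * (c * (2 * k - a ^ 2)) ≤ (1 + a) ^ 2 * ℓ := by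
        rw [hp, hbl] at hm
        nlinarith
      have e4 : c * (2 * k - a ^ 2) ≤ ℓ := le_of_mul_le_mul_left e3 (by positivity)
      have e5 : α * (1 + α) ≤ 2 * k - a ^ 2 := by nlinarith
      have e6 := mul_le_mul_of_nonneg_left e5 hcpos.le
      linarith
  have := le_of_forall_gt_imp_ge_of_dense (fun ℓ' h => hfin ℓ' h)
  rw [← hψ1]
  change ψ (1 + α) ≤ _
  linarith

/-- Monotonicity of the power means of `e^X`. -/
theorem mul_log_integral_exp_le {X : Ω → ℝ} (hX : BddMeas X) (μ : Measure Ω)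
    [IsProbabilityMeasure μ] {r : ℝ} (hr : 1 ≤ r) :
    r * Real.log (∫ x, Real.exp (X x) ∂μ) ≤ Real.log (∫ x, Real.exp (r * X x) ∂μ) := by
  have h1 := integral_exp_mul_le hX (hX.const_mul r) μ
  have h2 := entropy_exp_nonneg hX μ
  set a := ∫ x, Real.exp (X x) ∂μ
  set b := ∫ x, Real.exp (r * X x) ∂μ
  have ha : 0 < a := hX.posBddMeas_exp.integral_pos μ
  have hi1 := (hX.exp.mul hX).integrable μ
  have hi2 := (hX.exp.mul (BddMeas.const (Real.log a))).integrable μ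
  simp_rw [mul_sub] at h2
  rw [integral_sub hi1 hi2, integral_mul_const] at h2
  change 0 ≤ _ - a * Real.log a at h2
  have h3 : ∀ x, Real.exp (X x) * (r * X x - X x) = (r - 1) * (Real.exp (X x) * X x) :=
    fun x => by ring
  simp_rw [h3] at h1
  rw [integral_const_mul] at h1
  have h4 := mul_le_mul_of_nonneg_left h2 (by linarith : 0 ≤ r - 1)
  have h5 : a * (r * Real.log a) ≤ a * Real.log b := by nlinarith
  exact le_of_mul_le_mul_left h5 ha

variable {ι : Type*} [Fintype ι] [DecidableEq ι] {𝓧 : Type*} [MeasurableSpace 𝓧]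
variable (P : ι → Measure 𝓧) [∀ i, IsProbabilityMeasure (P i)]

/-- The factor e^{X-δ} does not see coordinate `i`, so the conditional entropy of e^X in this
coordinate depends only on its share `δ`. -/
theorem avg_exp_eq {X δ : (ι → 𝓧) → ℝ} (i : ι)
    (hδX : ∀ x y, X (Function.update x i y) - δ (Function.update x i y) = X x - δ x)
    (x : ι → 𝓧) :
    avg P i (fun x => Real.exp (X x)) x =
      Real.exp (X x - δ x) * avg P i (fun x => Real.exp (δ x)) x := by
  simp only [avg]
  rw [← integral_const_mul]
  congr 1
  ext y
  rw [← Real.exp_add, ← hδX x y]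
  congr 1
  ring

/-- Second order bound for the entropy in one coordinate. -/
theorem integral_exp_mul_sub_log_avg_le {X δ : (ι → 𝓧) → ℝ} (hX : BddMeas X) (hδ : BddMeas δ)
    (i : ι) (hδX : ∀ x y, X (Function.update x i y) - δ (Function.update x i y) = X x - δ x) :
    ∫ x, Real.exp (X x) * (X x - Real.log (avg P i (fun x => Real.exp (X x)) x)) ∂Measure.pi P ≤
      1 / 2 * ∫ x, Real.exp (X x) * (2 / 3 * δ x ^ 2 + 1 / 3 * avg P i (fun x => δ x ^ 2) x)
        ∂Measure.pi P := by
  set v := avg P i (fun x => Real.exp (δ x)) with hv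
  have hvP : PosBddMeas v := hδ.posBddMeas_exp.avg P i
  have hvu : ∀ x y, v (Function.update x i y) = v x := fun x y => avg_update P i _ x y
  set w := fun x => Real.exp (X x - δ x) with hw
  have hwB : BddMeas w := (hX.sub hδ).exp
  have hwu : ∀ x y, w (Function.update x i y) = w x := fun x y => by simp only [hw, hδX]
  have hA : ∀ x, avg P i (fun x => Real.exp (X x)) x = w x * v x := fun x =>
    avg_exp_eq P i hδX x
  have hXw : ∀ x, Real.exp (X x) = Real.exp (δ x) * w x := fun x => by
    rw [hw, ← Real.exp_add]; congr 1; ring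
  have hlog : ∀ x, X x - Real.log (avg P i (fun x => Real.exp (X x)) x) =
      δ x - Real.log (v x) := fun x => by
    have : Real.log (w x) = X x - δ x := Real.log_exp _
    rw [hA, Real.log_mul (Real.exp_pos _).ne' (hvP.pos x).ne', this]; ring
  simp_rw [hlog, hXw]
  have key : ∀ x, w x * (Real.exp (δ x) * (δ x - 1) + v x - v x * Real.log (v x)) ≤
      w x * (1 / 2 * (2 / 3 * (Real.exp (δ x) * δ x ^ 2) + 1 / 3 * (v x * δ x ^ 2))) :=
    fun x => mul_le_mul_of_nonneg_left (exp_mul_sub_one_le _ _ (hvP.pos x)) (Real.exp_pos _).le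
  have hE := hδ.exp
  have hD2 := hδ.pow 2
  have hL := hvP.log
  have hAD := hD2.avg P i
  -- These four identities only move the average over coordinate `i` from one factor to another.
  -- They turn the terms of `key` containing v into terms weighted by e^X, at the price of averaging
  -- δ².
  have e1 : ∫ x, v x * w x ∂Measure.pi P = ∫ x, Real.exp (δ x) * w x ∂Measure.pi P :=
    integral_avg_mul P hE hwB i hwu
  have e2 : ∫ x, v x * (w x * Real.log (v x)) ∂Measure.pi P =
      ∫ x, Real.exp (δ x) * (w x * Real.log (v x)) ∂Measure.pi P :=
    integral_avg_mul P hE (hwB.mul hL) i fun x y => by rw [hwu, hvu]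
  have e3 : ∫ x, avg P i (fun x => δ x ^ 2) x * (w x * v x) ∂Measure.pi P =
      ∫ x, δ x ^ 2 * (w x * v x) ∂Measure.pi P :=
    integral_avg_mul P hD2 (hwB.mul hvP.bddMeas) i fun x y => by rw [hwu, hvu]
  have e4 : ∫ x, v x * (w x * avg P i (fun x => δ x ^ 2) x) ∂Measure.pi P =
      ∫ x, Real.exp (δ x) * (w x * avg P i (fun x => δ x ^ 2) x) ∂Measure.pi P :=
    integral_avg_mul P hE (hwB.mul hAD) i fun x y => by rw [hwu, avg_update]
  have j1 := (hE.mul hwB).mul (hδ.sub hL)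
  have j2 := hE.mul hwB
  have j3 := hvP.bddMeas.mul hwB
  have j4 := hE.mul (hwB.mul hL)
  have j5 := hvP.bddMeas.mul (hwB.mul hL)
  have j6 := (hE.mul hwB).mul hD2
  have j7 := hD2.mul (hwB.mul hvP.bddMeas)
  have j8 := hE.mul (hwB.mul hAD)
  have i1 := j1.integrable (Measure.pi P)
  have i2 := j2.integrable (Measure.pi P)
  have i3 := j3.integrable (Measure.pi P)
  have i4 := j4.integrable (Measure.pi P)
  have i5 := j5.integrable (Measure.pi P)
  have i6 := j6.integrable (Measure.pi P)
  have i7 := j7.integrable (Measure.pi P)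
  have i8 := j8.integrable (Measure.pi P)
  have l1 : ∫ x, w x * (Real.exp (δ x) * (δ x - 1) + v x - v x * Real.log (v x)) ∂Measure.pi P =
      ∫ x, Real.exp (δ x) * w x * (δ x - Real.log (v x)) ∂Measure.pi P := by
    have : ∀ x, w x * (Real.exp (δ x) * (δ x - 1) + v x - v x * Real.log (v x)) =
        (Real.exp (δ x) * w x * (δ x - Real.log (v x)) + Real.exp (δ x) * (w x * Real.log (v x))
          + v x * w x) - (Real.exp (δ x) * w x + v x * (w x * Real.log (v x))) := fun x => by ring
    simp_rw [this]
    rw [integral_sub (((j1.add j4).add j3).integrable _) ((j2.add j5).integrable _),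
      integral_add ((j1.add j4).integrable _) i3,
      integral_add i1 i4, integral_add i2 i5, e1, e2]
    ring
  have l2 : ∫ x, w x * (1 / 2 * (2 / 3 * (Real.exp (δ x) * δ x ^ 2) + 1 / 3 * (v x * δ x ^ 2)))
        ∂Measure.pi P = 1 / 2 * ∫ x, Real.exp (δ x) * w x *
        (2 / 3 * δ x ^ 2 + 1 / 3 * avg P i (fun x => δ x ^ 2) x) ∂Measure.pi P := by
    have h1 : ∀ x, w x * (1 / 2 * (2 / 3 * (Real.exp (δ x) * δ x ^ 2) +
        1 / 3 * (v x * δ x ^ 2))) =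
        1 / 3 * (Real.exp (δ x) * w x * δ x ^ 2) + 1 / 6 * (δ x ^ 2 * (w x * v x)) :=
      fun x => by ring
    have h2 : ∀ x, Real.exp (δ x) * w x *
        (2 / 3 * δ x ^ 2 + 1 / 3 * avg P i (fun x => δ x ^ 2) x) =
        2 / 3 * (Real.exp (δ x) * w x * δ x ^ 2) +
          1 / 3 * (Real.exp (δ x) * (w x * avg P i (fun x => δ x ^ 2) x)) := fun x => by ring
    have h3 : ∀ x, avg P i (fun x => δ x ^ 2) x * (w x * v x) =
      v x * (w x * avg P i (fun x => δ x ^ 2) x) := fun x => by ring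
    simp_rw [h1, h2]
    rw [integral_add (i6.const_mul _) (i7.const_mul _), integral_add (i6.const_mul _)
      (i8.const_mul _), integral_const_mul, integral_const_mul, integral_const_mul,
      integral_const_mul, ← e3, ← e4]
    simp_rw [h3]
    ring
  rw [← l1, ← l2]
  refine integral_mono ?_ ?_ key
  · exact (hwB.mul (((hE.mul (hδ.sub (BddMeas.const 1))).add hvP.bddMeas).sub
      (hvP.bddMeas.mul hL))).integrable _
  · exact (hwB.mul ((((hE.mul hD2).const_mul _).add
      ((hvP.bddMeas.mul hD2).const_mul _)).const_mul _)).integrable _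

/-- Tensorization, followed by the second order bound for rX and its shares rδ_i. The factor r²
comes out of the squares, which is the form required by the Herbst argument. -/
theorem entropy_exp_le_sq {X : (ι → 𝓧) → ℝ} {δ : ι → (ι → 𝓧) → ℝ} (hX : BddMeas X)
    (hδ : ∀ i, BddMeas (δ i))
    (hδX : ∀ i x y, X (Function.update x i y) - δ i (Function.update x i y) = X x - δ i x)
    (r : ℝ) :
    ∫ x, Real.exp (r * X x) * (r * X x - Real.log (∫ x, Real.exp (r * X x) ∂Measure.pi P))
        ∂Measure.pi P ≤
      r ^ 2 / 2 * ∫ x, Real.exp (r * X x) *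
        ∑ i, (2 / 3 * δ i x ^ 2 + 1 / 3 * avg P i (fun x => δ i x ^ 2) x) ∂Measure.pi P := by
  have h1 := entropy_le_sum P (hX.const_mul r).posBddMeas_exp
  simp only [Real.log_exp] at h1
  refine h1.trans ?_
  have hD : ∀ i, BddMeas fun x => 2 / 3 * δ i x ^ 2 + 1 / 3 * avg P i (fun x => δ i x ^ 2) x :=
    fun i => (((hδ i).pow 2).const_mul _).add ((((hδ i).pow 2).avg P i).const_mul _)
  simp_rw [Finset.mul_sum]
  rw [integral_finsetSum _ fun i _ => ((hX.const_mul r).exp.mul (hD i)).integrable _,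
    Finset.mul_sum]
  refine Finset.sum_le_sum fun i _ => ?_
  have h2 := integral_exp_mul_sub_log_avg_le P (hX.const_mul r) ((hδ i).const_mul r) i
    fun x y => by rw [← mul_sub, hδX, mul_sub]
  refine h2.trans (le_of_eq ?_)
  rw [show r ^ 2 / 2 = 1 / 2 * r ^ 2 by ring, mul_assoc (1 / 2 : ℝ), ← integral_const_mul (r ^ 2)]
  congr 1
  congr 1
  ext x
  have : avg P i (fun x => (r * δ i x) ^ 2) x = r ^ 2 * avg P i (fun x => δ i x ^ 2) x := by
    simp only [avg, mul_pow, integral_const_mul]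
  rw [this]
  ring

/-- Each tensorized term rX - log avg_i e^{rX} is at most r(X - log avg_i e^X) by monotonicity of
power means, so the energy no longer depends on r. -/
theorem entropy_exp_le_log_avg {X : (ι → 𝓧) → ℝ} (hX : BddMeas X) {r : ℝ} (hr : 1 ≤ r) :
    ∫ x, Real.exp (r * X x) * (r * X x - Real.log (∫ x, Real.exp (r * X x) ∂Measure.pi P))
        ∂Measure.pi P ≤
      r ^ 2 / 2 * ∫ x, Real.exp (r * X x) *
        (2 * ∑ i, (X x - Real.log (avg P i (fun x => Real.exp (X x)) x))) ∂Measure.pi P := by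
  have h1 := entropy_le_sum P (hX.const_mul r).posBddMeas_exp
  simp only [Real.log_exp] at h1
  refine h1.trans ?_
  have hD : ∀ i, BddMeas fun x => X x - Real.log (avg P i (fun x => Real.exp (X x)) x) :=
    fun i => hX.sub (hX.posBddMeas_exp.avg P i).log
  have hE := (hX.const_mul r).exp
  simp_rw [mul_left_comm _ (2 : ℝ), integral_const_mul, Finset.mul_sum]
  rw [integral_finsetSum _ fun i _ => (hE.mul (hD i)).integrable _, Finset.mul_sum,
    Finset.mul_sum]
  refine Finset.sum_le_sum fun i _ => ?_
  have hAr := ((hX.const_mul r).posBddMeas_exp.avg P i).log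
  have h2 : ∫ x, Real.exp (r * X x) *
      (r * X x - Real.log (avg P i (fun x => Real.exp (r * X x)) x)) ∂Measure.pi P ≤
      r * ∫ x, Real.exp (r * X x) * (X x - Real.log (avg P i (fun x => Real.exp (X x)) x))
        ∂Measure.pi P := by
    rw [← integral_const_mul]
    refine integral_mono ((hE.mul ((hX.const_mul r).sub hAr)).integrable _)
      (((hE.mul (hD i)).const_mul r).integrable _) fun x => ?_
    have h3 := mul_log_integral_exp_le (hX.comp (measurable_update x (a := i))) (P i) hr
    change r * Real.log (avg P i (fun x => Real.exp (X x)) x) ≤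
      Real.log (avg P i (fun x => Real.exp (r * X x)) x) at h3
    have := mul_le_mul_of_nonneg_left h3 (Real.exp_pos (r * X x)).le
    simp only
    nlinarith
  -- Testing with h = 1 shows that the entropy in one coordinate is nonnegative. Hence J ≥ 0, and
  -- the factor r may be enlarged to r² because r ≥ 1.
  have h4 := integral_mul_log_div_avg_le P (hX.const_mul r).posBddMeas_exp
    (h := fun _ => 1) ⟨measurable_const, 1, 1, one_pos, fun _ => ⟨le_rfl, le_rfl⟩⟩ i
  simp only [avg, Real.log_one, integral_const, probReal_univ, smul_eq_mul, mul_one, sub_self,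
    mul_zero, Real.log_exp] at h4
  change 0 ≤ ∫ x, Real.exp (r * X x) *
      (r * X x - Real.log (avg P i (fun x => Real.exp (r * X x)) x)) ∂Measure.pi P at h4
  set J := ∫ x, Real.exp (r * X x) * (X x - Real.log (avg P i (fun x => Real.exp (X x)) x))
        ∂Measure.pi P
  have hJ : 0 ≤ J := nonneg_of_mul_nonneg_right (h4.trans h2) (by linarith)
  nlinarith

end Herbst

/-! ### Gaussian exponential moments. -/

section Gaussian

/-- The exponential of a real number as an extended nonnegative real. -/
noncomputable def eexp (x : ℝ) : ℝ≥0∞ := ENNReal.ofReal (Real.exp x)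

@[simp] theorem eexp_zero : eexp 0 = 1 := by simp [eexp]

theorem eexp_add (x y : ℝ) : eexp (x + y) = eexp x * eexp y := by
  rw [eexp, Real.exp_add, ENNReal.ofReal_mul (Real.exp_pos _).le]; rfl

theorem eexp_ne_top (x : ℝ) : eexp x ≠ ∞ := ENNReal.ofReal_ne_top

theorem eexp_pos (x : ℝ) : 0 < eexp x := ENNReal.ofReal_pos.2 (Real.exp_pos _)

theorem eexp_mono {x y : ℝ} (h : x ≤ y) : eexp x ≤ eexp y :=
  ENNReal.ofReal_le_ofReal (Real.exp_le_exp.2 h)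

theorem measurable_eexp : Measurable eexp := Real.measurable_exp.ennreal_ofReal

@[fun_prop]
theorem Measurable.eexp {α : Type*} [MeasurableSpace α] {f : α → ℝ} (hf : Measurable f) :
    Measurable fun x => eexp (f x) := measurable_eexp.comp hf

theorem eexp_sum {ι : Type*} (s : Finset ι) (f : ι → ℝ) :
    eexp (∑ i ∈ s, f i) = ∏ i ∈ s, eexp (f i) := by
  rw [eexp, Real.exp_sum, ENNReal.ofReal_prod_of_nonneg fun i _ => (Real.exp_pos _).le]; rfl

theorem eexp_rpow (x p : ℝ) : eexp x ^ p = eexp (p * x) := by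
  rw [eexp, ENNReal.ofReal_rpow_of_pos (Real.exp_pos _), ← Real.exp_mul, mul_comm]; rfl

theorem lintegral_gaussianReal (f : ℝ → ℝ≥0∞) (hf : Measurable f) {v : NNReal} (hv : v ≠ 0)
    (μ : ℝ) : ∫⁻ y, f y ∂gaussianReal μ v = ∫⁻ y, gaussianPDF μ v y * f y := by
  rw [gaussianReal_of_var_ne_zero _ hv,
    lintegral_withDensity_eq_lintegral_mul _ (measurable_gaussianPDF _ _) hf]
  rfl

theorem lintegral_gaussianReal_add {f : ℝ → ℝ≥0∞} (hf : Measurable f) (g : ℝ) :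
    ∫⁻ y, f (y + g) ∂gaussianReal 0 1 =
      ∫⁻ y, eexp (y * g - g ^ 2 / 2) * f y ∂gaussianReal 0 1 := by
  rw [← lintegral_map (g := fun y => y + g) hf (measurable_add_const g),
    gaussianReal_map_add_const,
    lintegral_gaussianReal _ hf one_ne_zero, lintegral_gaussianReal _ (by fun_prop) one_ne_zero]
  congr 1
  ext y
  rw [← mul_assoc]
  congr 1
  rw [gaussianPDF, gaussianPDF, eexp, ← ENNReal.ofReal_mul (gaussianPDFReal_nonneg _ _ _)]
  congr 1
  simp only [gaussianPDFReal, mul_assoc, ← Real.exp_add]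
  congr 2
  simp
  ring

/-- Completing the square turns the integrand into a multiple of a Gaussian density of variance
1/(1-2t) and mean s/(1-2t). -/
theorem lintegral_gaussianReal_eexp_quadratic {t : ℝ} (ht : 2 * t < 1) (s : ℝ) :
    ∫⁻ y, eexp (t * y ^ 2 + s * y) ∂gaussianReal 0 1 =
      ENNReal.ofReal ((1 - 2 * t) ^ (-(1 / 2) : ℝ)) * eexp (s ^ 2 / (2 * (1 - 2 * t))) := by
  have hpos : 0 < 1 - 2 * t := by linarith
  set v : NNReal := ⟨(1 - 2 * t)⁻¹, (inv_pos.2 hpos).le⟩ with hv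
  have hv0 : v ≠ 0 := by
    intro h
    have h' : (1 - 2 * t)⁻¹ = 0 := congrArg NNReal.toReal h
    exact (inv_pos.2 hpos).ne' h'
  rw [lintegral_gaussianReal _ (by fun_prop) one_ne_zero]
  have key : ∀ y, gaussianPDF 0 1 y * eexp (t * y ^ 2 + s * y) =
      ENNReal.ofReal ((1 - 2 * t) ^ (-(1 / 2) : ℝ)) * eexp (s ^ 2 / (2 * (1 - 2 * t))) *
        gaussianPDF (s * v) v y := by
    intro y
    have hr : 0 ≤ (1 - 2 * t) ^ (-(1 / 2) : ℝ) := Real.rpow_nonneg hpos.le _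
    rw [gaussianPDF, gaussianPDF, eexp, eexp, ← ENNReal.ofReal_mul (gaussianPDFReal_nonneg _ _ _),
      ← ENNReal.ofReal_mul hr, ← ENNReal.ofReal_mul (by positivity)]
    congr 1
    simp only [gaussianPDFReal]
    have hvr : (v : ℝ) = (1 - 2 * t)⁻¹ := rfl
    have e1 : (1 - 2 * t) ^ (-(1 / 2) : ℝ) = (Real.sqrt (1 - 2 * t))⁻¹ := by
      rw [Real.rpow_neg hpos.le, Real.sqrt_eq_rpow]
    have e2 : Real.sqrt (2 * Real.pi * v) = Real.sqrt (2 * Real.pi) * (Real.sqrt (1 - 2 * t))⁻¹ := by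
      rw [Real.sqrt_mul (by positivity), hvr, Real.sqrt_inv]
    rw [e1, e2, hvr]
    have e3 : 0 < Real.sqrt (1 - 2 * t) := Real.sqrt_pos.2 hpos
    have e4 : 0 < Real.sqrt (2 * Real.pi) := Real.sqrt_pos.2 (by positivity)
    simp only [NNReal.coe_one, mul_one, sub_zero]
    have e5 : Real.exp (-y ^ 2 / 2) * Real.exp (t * y ^ 2 + s * y) =
        Real.exp (s ^ 2 / (2 * (1 - 2 * t))) *
          Real.exp (-(y - s * (1 - 2 * t)⁻¹) ^ 2 / (2 * (1 - 2 * t)⁻¹)) := by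
      rw [← Real.exp_add, ← Real.exp_add]
      congr 1
      field_simp
      ring
    rw [mul_assoc, e5]
    field_simp
  simp_rw [key]
  rw [lintegral_const_mul _ (measurable_gaussianPDF _ _), lintegral_gaussianPDF_eq_one _ hv0,
    mul_one]

/-- Cameron-Martin, shifting one coordinate at a time by induction on the set of shifted
coordinates. -/
theorem lintegral_pi_gaussianReal_add {ι : Type*} [Fintype ι] [DecidableEq ι] (g : ι → ℝ)
    (s : Finset ι) : ∀ {F : (ι → ℝ) → ℝ≥0∞}, Measurable F →
    ∫⁻ v, F (fun i => v i + if i ∈ s then g i else 0) ∂Measure.pi (fun _ => gaussianReal 0 1) =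
      ∫⁻ v, eexp (∑ i ∈ s, (v i * g i - g i ^ 2 / 2)) * F v
        ∂Measure.pi (fun _ => gaussianReal 0 1) := by
  induction s using Finset.induction_on with
  | empty => intro F hF; simp
  | insert a s ha ih =>
    intro F hF
    have hF' : Measurable fun v : ι → ℝ => F (Function.update v a (v a + g a)) := by
      refine hF.comp (measurable_pi_lambda _ fun i => ?_)
      by_cases h : i = a
      · subst h; simpa using (measurable_pi_apply _).add_const _
      · simpa [h] using measurable_pi_apply _
    have h1 := ih hF'
    have h2 : ∀ v : ι → ℝ, (fun i => v i + if i ∈ insert a s then g i else 0) =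
        Function.update (fun i => v i + if i ∈ s then g i else 0) a
          ((fun i => v i + if i ∈ s then g i else 0) a + g a) := by
      intro v
      ext i
      by_cases h : i = a
      · subst h; simp [ha]
      · simp [h]
    simp_rw [h2]
    rw [h1, ← lintegral_update (fun _ => gaussianReal 0 1) a (by fun_prop),
      ← lintegral_update (fun _ => gaussianReal 0 1) a
        (F := fun v => eexp (∑ i ∈ insert a s, (v i * g i - g i ^ 2 / 2)) * F v) (by fun_prop)]
    congr 1
    ext v
    have h3 : ∀ y, ∑ i ∈ s, (Function.update v a y i * g i - g i ^ 2 / 2) =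
        ∑ i ∈ s, (v i * g i - g i ^ 2 / 2) := fun y =>
      Finset.sum_congr rfl fun i hi => by
        have hia : i ≠ a := fun h => ha (by rwa [← h])
        rw [Function.update_of_ne hia]
    simp only [Function.update_idem, Function.update_self, Finset.sum_insert ha, h3]
    rw [lintegral_const_mul _ (by fun_prop), lintegral_gaussianReal_add
      (f := fun y => F (Function.update v a y)) (by fun_prop), ← lintegral_const_mul _ (by fun_prop)]
    congr 1
    ext y
    rw [eexp_add]
    ring

variable {d : ℕ}

/-- Cameron-Martin formula for the standard Gaussian measure. -/
theorem lintegral_stdGaussian_add {F : Param d → ℝ≥0∞} (hF : Measurable F) (g : Param d) :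
    ∫⁻ v, F (v + g) ∂stdGaussian (Param d) =
      ∫⁻ v, eexp (inner ℝ v g - ‖g‖ ^ 2 / 2) * F v ∂stdGaussian (Param d) := by
  rw [← map_pi_eq_stdGaussian, lintegral_map (by fun_prop) (by fun_prop),
    lintegral_map (by fun_prop) (by fun_prop)]
  have h := lintegral_pi_gaussianReal_add (fun i => g i) Finset.univ
    (F := fun v => F (WithLp.toLp 2 v)) (by fun_prop)
  simp only [Finset.mem_univ, if_true] at h
  have h1 : ∀ v : Fin d → ℝ, WithLp.toLp 2 v + g = WithLp.toLp 2 fun i => v i + g i := fun v => by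
    ext i; simp
  have h2 : ∀ v : Fin d → ℝ, inner ℝ (WithLp.toLp 2 v : Param d) g - ‖g‖ ^ 2 / 2 =
      ∑ i, (v i * g i - g i ^ 2 / 2) := fun v => by
    rw [EuclideanSpace.real_norm_sq_eq, Finset.sum_sub_distrib, Finset.sum_div]
    congr 1
    simp [PiLp.inner_apply, mul_comm]
  simp_rw [h1, h2]
  exact h

theorem lintegral_stdGaussian_eexp_sub (g : Param d) :
    ∫⁻ v, eexp (inner ℝ v g - ‖g‖ ^ 2 / 2) ∂stdGaussian (Param d) = 1 := by
  have := lintegral_stdGaussian_add (F := fun _ => 1) measurable_const g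
  simpa using this.symm

theorem lintegral_stdGaussian_eexp (g : Param d) :
    ∫⁻ v, eexp (inner ℝ v g) ∂stdGaussian (Param d) = eexp (‖g‖ ^ 2 / 2) := by
  have h : ∀ v : Param d, eexp (inner ℝ v g) =
      eexp (‖g‖ ^ 2 / 2) * eexp (inner ℝ v g - ‖g‖ ^ 2 / 2) := fun v => by
    rw [← eexp_add]; congr 1; ring
  simp_rw [h]
  rw [lintegral_const_mul _ (by fun_prop), lintegral_stdGaussian_eexp_sub, mul_one]

/-- Exponential moment of a rank one quadratic form plus a linear form. -/
theorem lintegral_stdGaussian_eexp_sq_le {c : ℝ} (hc : 0 ≤ c) (ψ b : Param d) {δ : ℝ}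
    (hψ : ‖ψ‖ ^ 2 ≤ δ) (hδ : 2 * c * δ < 1) :
    ∫⁻ z, eexp (c * (inner ℝ z ψ) ^ 2 + inner ℝ z b) ∂stdGaussian (Param d) ≤
      ENNReal.ofReal ((1 - 2 * c * δ) ^ (-(1 / 2) : ℝ)) *
        eexp (‖b‖ ^ 2 / (2 * (1 - 2 * c * δ))) := by
  -- Linearization of the square: e^{c t²} is the mean of e^{√(2c) y t} over a standard Gaussian y.
  -- The integral over z then has a linear exponent, leaving a one-dimensional quadratic in y.
  set s := Real.sqrt (2 * c) with hs
  have hs2 : s ^ 2 = 2 * c := Real.sq_sqrt (by linarith)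
  have h1 : ∀ z : Param d, eexp (c * (inner ℝ z ψ) ^ 2 + inner ℝ z b) =
      ∫⁻ y, eexp (inner ℝ z ((s * y) • ψ + b)) ∂gaussianReal 0 1 := by
    intro z
    have h := lintegral_gaussianReal_eexp_quadratic (t := 0) (by norm_num) (s * inner ℝ z ψ)
    have h2 : ∀ y : ℝ, eexp (inner ℝ z ((s * y) • ψ + b)) =
        eexp (inner ℝ z b) * eexp (0 * y ^ 2 + s * inner ℝ z ψ * y) := fun y => by
      rw [← eexp_add, inner_add_right, inner_smul_right]; congr 1; ring
    simp_rw [h2]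
    rw [lintegral_const_mul _ (by fun_prop), h, add_comm, eexp_add]
    congr 1
    simp only [mul_zero, sub_zero, Real.one_rpow, ENNReal.ofReal_one, one_mul, mul_one]
    congr 1
    rw [mul_pow, hs2]; ring
  simp_rw [h1]
  rw [lintegral_lintegral_swap (by fun_prop)]
  simp_rw [lintegral_stdGaussian_eexp]
  have h3 : ∀ y : ℝ, ‖(s * y) • ψ + b‖ ^ 2 / 2 =
      c * ‖ψ‖ ^ 2 * y ^ 2 + s * inner ℝ ψ b * y + ‖b‖ ^ 2 / 2 := fun y => by
    rw [norm_add_sq_real, norm_smul, inner_smul_left, mul_pow, Real.norm_eq_abs, sq_abs, mul_pow,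
      hs2]
    simp
    ring
  have hψδ : 2 * (c * ‖ψ‖ ^ 2) ≤ 2 * c * δ := by
    have := mul_le_mul_of_nonneg_left hψ hc; linarith
  have hlt : 2 * (c * ‖ψ‖ ^ 2) < 1 := by linarith
  simp_rw [h3, eexp_add _ (‖b‖ ^ 2 / 2)]
  rw [lintegral_mul_const _ (by fun_prop), lintegral_gaussianReal_eexp_quadratic hlt, mul_assoc,
    ← eexp_add]
  have hp1 : 0 < 1 - 2 * c * δ := by linarith
  have hp2 : 0 < 1 - 2 * (c * ‖ψ‖ ^ 2) := by linarith
  refine mul_le_mul' (ENNReal.ofReal_le_ofReal ?_) (eexp_mono ?_)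
  · exact Real.rpow_le_rpow_of_nonpos hp1 (by linarith) (by norm_num)
  · have h4 : (inner ℝ ψ b : ℝ) ^ 2 ≤ ‖ψ‖ ^ 2 * ‖b‖ ^ 2 := by
      rw [← mul_pow, ← sq_abs]
      exact pow_le_pow_left₀ (abs_nonneg _) (abs_real_inner_le_norm _ _) 2
    have h5 : (s * inner ℝ ψ b) ^ 2 / (2 * (1 - 2 * (c * ‖ψ‖ ^ 2))) + ‖b‖ ^ 2 / 2 ≤
        ‖b‖ ^ 2 / (2 * (1 - 2 * (c * ‖ψ‖ ^ 2))) := by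
      rw [mul_pow, hs2, div_add_div _ _ (by positivity) (by norm_num),
        div_le_div_iff₀ (by positivity) (by positivity)]
      have := mul_le_mul_of_nonneg_left h4 hc
      nlinarith [mul_le_mul_of_nonneg_right this hp2.le]
    refine h5.trans ?_
    exact div_le_div_of_nonneg_left (by positivity) (by linarith) (by linarith)

/-- Exponential moment of a nonnegative combination of squares of affine forms. -/
theorem lintegral_stdGaussian_eexp_sum_sq_le {K : Type*} (s : Finset K) {p w : K → ℝ}
    {ψ : K → Param d} {κ m ε : ℝ} (hκ : 0 ≤ κ) (hm : 0 < m) (hp : ∀ k ∈ s, 0 ≤ p k)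
    (hpm : ∑ k ∈ s, p k = m) (hψ : ∀ k ∈ s, ‖ψ k‖ ^ 2 ≤ ε) (hlt : 2 * κ * m * ε < 1) :
    ∫⁻ z, eexp (κ * ∑ k ∈ s, p k * (w k + inner ℝ z (ψ k)) ^ 2) ∂stdGaussian (Param d) ≤
      ENNReal.ofReal ((1 - 2 * κ * m * ε) ^ (-(1 / 2) : ℝ)) *
        eexp (κ / (1 - 2 * κ * m * ε) * ∑ k ∈ s, p k * w k ^ 2) := by
  set W := ∑ k ∈ s, p k * w k ^ 2 with hW
  set b : Param d := (2 * κ) • ∑ k ∈ s, (p k * w k) • ψ k with hb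
  have hpos : 0 < 1 - 2 * κ * m * ε := by linarith
  -- The form is a convex combination, with weights p_k/m, of rank one forms sharing the linear part
  -- b and the constant κW. Jensen thus reduces to rank one, and the determinant factor appears
  -- once, whatever the number of squares.
  have h1 : ∀ z : Param d, κ * ∑ k ∈ s, p k * (w k + inner ℝ z (ψ k)) ^ 2 =
      ∑ k ∈ s, p k / m * (κ * m * (inner ℝ z (ψ k)) ^ 2 + inner ℝ z b + κ * W) := by
    intro z
    have hz : inner ℝ z b = 2 * κ * ∑ k ∈ s, p k * w k * inner ℝ z (ψ k) := by
      rw [hb, inner_smul_right, inner_sum]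
      simp_rw [inner_smul_right]
    have h0 : ∑ k ∈ s, p k / m * (inner ℝ z b + κ * W) = inner ℝ z b + κ * W := by
      rw [← Finset.sum_mul, ← Finset.sum_div, hpm, div_self hm.ne', one_mul]
    have h2 : ∀ k ∈ s, p k / m * (κ * m * (inner ℝ z (ψ k)) ^ 2 + inner ℝ z b + κ * W) =
        κ * (p k * (inner ℝ z (ψ k)) ^ 2) + p k / m * (inner ℝ z b + κ * W) := fun k _ => by
      field_simp
      ring
    have h3 : ∀ k ∈ s, κ * (p k * (w k + inner ℝ z (ψ k)) ^ 2) =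
        κ * (p k * (inner ℝ z (ψ k)) ^ 2) + (2 * κ * (p k * w k * inner ℝ z (ψ k)) +
          κ * (p k * w k ^ 2)) := fun k _ => by ring
    rw [Finset.sum_congr rfl h2, Finset.sum_add_distrib, h0, hz, hW, Finset.mul_sum,
      Finset.sum_congr rfl h3, Finset.sum_add_distrib, Finset.sum_add_distrib, Finset.mul_sum,
      Finset.mul_sum]
  have hconv : ∀ z : Param d, eexp (κ * ∑ k ∈ s, p k * (w k + inner ℝ z (ψ k)) ^ 2) ≤
      ∑ k ∈ s, ENNReal.ofReal (p k / m) *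
        eexp (κ * m * (inner ℝ z (ψ k)) ^ 2 + inner ℝ z b + κ * W) := by
    intro z
    rw [h1]
    have hj := convexOn_exp.map_sum_le (t := s) (w := fun k => p k / m)
      (p := fun k => κ * m * (inner ℝ z (ψ k)) ^ 2 + inner ℝ z b + κ * W)
      (fun k hk => div_nonneg (hp k hk) hm.le)
      (by rw [← Finset.sum_div, hpm, div_self hm.ne']) (fun _ _ => Set.mem_univ _)
    simp only [smul_eq_mul] at hj
    refine (ENNReal.ofReal_le_ofReal hj).trans (le_of_eq ?_)
    rw [ENNReal.ofReal_sum_of_nonneg fun k hk =>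
      mul_nonneg (div_nonneg (hp k hk) hm.le) (Real.exp_pos _).le]
    exact Finset.sum_congr rfl fun k hk => ENNReal.ofReal_mul (div_nonneg (hp k hk) hm.le)
  have hbW : ‖b‖ ^ 2 ≤ 4 * κ ^ 2 * (m * ε * W) := by
    have h2 : ‖∑ k ∈ s, (p k * w k) • ψ k‖ ≤ ∑ k ∈ s, p k * (|w k| * ‖ψ k‖) := by
      refine (norm_sum_le _ _).trans (Finset.sum_le_sum fun k hk => ?_)
      rw [norm_smul, Real.norm_eq_abs, abs_mul, abs_of_nonneg (hp k hk), mul_assoc]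
    have h3 : (∑ k ∈ s, p k * (|w k| * ‖ψ k‖)) ^ 2 ≤ m * ε * W := by
      have hcs := Finset.sum_mul_sq_le_sq_mul_sq s (fun k => Real.sqrt (p k))
        (fun k => Real.sqrt (p k) * (|w k| * ‖ψ k‖))
      have e1 : ∑ k ∈ s, Real.sqrt (p k) * (Real.sqrt (p k) * (|w k| * ‖ψ k‖)) =
          ∑ k ∈ s, p k * (|w k| * ‖ψ k‖) := Finset.sum_congr rfl fun k hk => by
        rw [← mul_assoc, Real.mul_self_sqrt (hp k hk)]
      have e2 : ∑ k ∈ s, Real.sqrt (p k) ^ 2 = m := by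
        rw [← hpm]; exact Finset.sum_congr rfl fun k hk => Real.sq_sqrt (hp k hk)
      rw [e1, e2] at hcs
      refine hcs.trans ?_
      rw [mul_assoc]
      refine mul_le_mul_of_nonneg_left ?_ hm.le
      rw [hW, Finset.mul_sum]
      refine Finset.sum_le_sum fun k hk => ?_
      rw [mul_pow, mul_pow, Real.sq_sqrt (hp k hk), sq_abs]
      have := mul_le_mul_of_nonneg_left (hψ k hk) (mul_nonneg (hp k hk) (sq_nonneg (w k)))
      nlinarith
    rw [hb, norm_smul, mul_pow, Real.norm_eq_abs, sq_abs]
    have h4 := (pow_le_pow_left₀ (norm_nonneg _) h2 2).trans h3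
    nlinarith [mul_le_mul_of_nonneg_left h4 (by positivity : 0 ≤ 4 * κ ^ 2)]
  calc ∫⁻ z, eexp (κ * ∑ k ∈ s, p k * (w k + inner ℝ z (ψ k)) ^ 2) ∂stdGaussian (Param d)
      ≤ ∫⁻ z, ∑ k ∈ s, ENNReal.ofReal (p k / m) *
        eexp (κ * m * (inner ℝ z (ψ k)) ^ 2 + inner ℝ z b + κ * W) ∂stdGaussian (Param d) :=
        lintegral_mono hconv
    _ = ∑ k ∈ s, ENNReal.ofReal (p k / m) * (eexp (κ * W) *
        ∫⁻ z, eexp (κ * m * (inner ℝ z (ψ k)) ^ 2 + inner ℝ z b) ∂stdGaussian (Param d)) := by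
        rw [lintegral_finsetSum _ fun k _ => by fun_prop]
        refine Finset.sum_congr rfl fun k _ => ?_
        rw [lintegral_const_mul _ (by fun_prop)]
        simp_rw [eexp_add _ (κ * W)]
        rw [lintegral_mul_const _ (by fun_prop), mul_comm (eexp (κ * W))]
    _ ≤ ∑ k ∈ s, ENNReal.ofReal (p k / m) *
        (ENNReal.ofReal ((1 - 2 * κ * m * ε) ^ (-(1 / 2) : ℝ)) *
        eexp (κ / (1 - 2 * κ * m * ε) * W)) := by
        refine Finset.sum_le_sum fun k hk => mul_le_mul_right ?_ _
        have h5 := lintegral_stdGaussian_eexp_sq_le (c := κ * m) (by positivity) (ψ k) b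
          (hψ k hk) (by linarith)
        refine (mul_le_mul_right h5 _).trans ?_
        rw [mul_left_comm, ← eexp_add, ← mul_assoc 2 κ m]
        refine mul_le_mul_right (eexp_mono ?_) _
        have h6 : ‖b‖ ^ 2 / (2 * (1 - 2 * κ * m * ε)) ≤
            4 * κ ^ 2 * (m * ε * W) / (2 * (1 - 2 * κ * m * ε)) := by gcongr
        -- The linear part contributes exactly what turns the coefficient κ of W into κ/(1 - 2κmε).
        have h7 : κ * W + 4 * κ ^ 2 * (m * ε * W) / (2 * (1 - 2 * κ * m * ε)) =
            κ / (1 - 2 * κ * m * ε) * W := by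
          have := hpos.ne'
          rw [← mul_div_mul_left κ (1 - 2 * κ * m * ε) two_ne_zero, div_mul_eq_mul_div,
            eq_div_iff (by positivity), add_mul, div_mul_cancel₀ _ (by positivity)]
          ring
        linarith
    _ = _ := by
        rw [← Finset.sum_mul, ← ENNReal.ofReal_sum_of_nonneg
          fun k hk => div_nonneg (hp k hk) hm.le, ← Finset.sum_div, hpm, div_self hm.ne']
        simp

/-- Iterated integration of a family of functionals, one coordinate of the path at a time. -/
theorem lintegral_pi_le_prod {V : Type*} [MeasurableSpace V] (γ : Measure V)
    [IsProbabilityMeasure γ] {N : ℕ} (Φ : ℕ → (Fin N → V) → ℝ≥0∞) (C : ℕ → ℝ≥0∞)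
    (hΦ : ∀ j, Measurable (Φ j))
    (hstep : ∀ (j : ℕ) (hj : j < N) (u : Fin N → V),
      ∫⁻ v, Φ (j + 1) (Function.update u ⟨j, hj⟩ v) ∂γ ≤ C j * Φ j u) (k : ℕ) (hk : k ≤ N) :
    ∫⁻ u, Φ k u ∂Measure.pi (fun _ => γ) ≤
      (∏ j ∈ Finset.range k, C j) * ∫⁻ u, Φ 0 u ∂Measure.pi (fun _ => γ) := by
  induction k with
  | zero => simp
  | succ k ih =>
    rw [← lintegral_update (fun _ : Fin N => γ) ⟨k, hk⟩ (hΦ (k + 1))]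
    refine (lintegral_mono (hstep k hk)).trans ?_
    rw [lintegral_const_mul _ (hΦ k), Finset.prod_range_succ, mul_comm (∏ j ∈ _, _), mul_assoc]
    exact mul_le_mul_right (ih (Nat.le_of_succ_le hk)) _

end Gaussian

/-! ### Adaptive queries: log-likelihood and the share of each sample. -/

section Model

/-- Partial sum over the indices below `k`. -/
def psum {N : ℕ} (k : ℕ) (f : Fin N → ℝ) : ℝ := ∑ l : Fin N, if l.1 < k then f l else 0

section psum
variable {N : ℕ}

@[simp] theorem psum_zero (f : Fin N → ℝ) : psum 0 f = 0 := by simp [psum]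

theorem psum_succ {k : ℕ} (hk : k < N) (f : Fin N → ℝ) :
    psum (k + 1) f = psum k f + f ⟨k, hk⟩ := by
  have h : ∀ l : Fin N, (if l.1 < k + 1 then f l else 0) =
      (if l.1 < k then f l else 0) + if l = ⟨k, hk⟩ then f l else 0 := by
    intro l
    rcases lt_trichotomy l.1 k with h | h | h
    · simp [h, Nat.lt_succ_of_lt h, Fin.ext_iff, h.ne]
    · have : l = ⟨k, hk⟩ := Fin.ext h
      simp [this]
    · have h2 : ¬ l.1 < k + 1 := by omega
      simp [h2, h.not_gt, Fin.ext_iff, h.ne']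
  simp only [psum, h, Finset.sum_add_distrib, Finset.sum_ite_eq', Finset.mem_univ, if_true]

theorem psum_congr {k : ℕ} {f g : Fin N → ℝ} (h : ∀ l : Fin N, l.1 < k → f l = g l) :
    psum k f = psum k g := by
  refine Finset.sum_congr rfl fun l _ => ?_
  by_cases hl : l.1 < k
  · simp [hl, h l hl]
  · simp [hl]

theorem psum_mono {k : ℕ} {f g : Fin N → ℝ} (h : ∀ l : Fin N, l.1 < k → f l ≤ g l) :
    psum k f ≤ psum k g := by
  refine Finset.sum_le_sum fun l _ => ?_
  by_cases hl : l.1 < k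
  · simp [hl, h l hl]
  · simp [hl]

theorem psum_add (k : ℕ) (f g : Fin N → ℝ) : psum k (fun l => f l + g l) = psum k f + psum k g := by
  simp only [psum, ← Finset.sum_add_distrib]
  refine Finset.sum_congr rfl fun l _ => ?_
  split_ifs <;> simp

theorem psum_sub (k : ℕ) (f g : Fin N → ℝ) : psum k (fun l => f l - g l) = psum k f - psum k g := by
  simp only [psum, ← Finset.sum_sub_distrib]
  refine Finset.sum_congr rfl fun l _ => ?_
  split_ifs <;> simp

theorem psum_full (f : Fin N → ℝ) : psum N f = ∑ l, f l := by simp [psum]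

theorem abs_psum_le (k : ℕ) (f : Fin N → ℝ) : |psum k f| ≤ psum k fun l => |f l| := by
  refine (Finset.abs_sum_le_sum_abs _ _).trans (Finset.sum_le_sum fun l _ => ?_)
  split_ifs <;> simp

theorem Measurable.psum {α : Type*} [MeasurableSpace α] {f : α → Fin N → ℝ} (k : ℕ)
    (hf : ∀ l, Measurable fun a => f a l) : Measurable fun a => psum k (f a) := by
  unfold _root_.psum
  refine Finset.measurable_sum _ fun l _ => ?_
  split_ifs
  · exact hf l
  · exact measurable_const

theorem BddMeas.psum {α : Type*} [MeasurableSpace α] {f : α → Fin N → ℝ} (k : ℕ)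
    (hf : ∀ l, BddMeas fun a => f a l) : BddMeas fun a => psum k (f a) := by
  unfold _root_.psum
  refine BddMeas.sum _ fun l _ => ?_
  split_ifs
  · exact hf l
  · exact BddMeas.const 0

end psum

/-- Vector-valued adaptive queries with bounded per-sample contributions. Step `j` uses the
samples in `I j`, no sample is used twice within a block (`epoch`) of `T` steps, and the query of
step `j` depends only on the answers before `j`. -/
structure AdaptiveQueries (𝓧 : Type*) [MeasurableSpace 𝓧] (d n m T E : ℕ) (r : ℝ) where
  φ : Fin (E * T) → (Fin (E * T) → Param d) → 𝓧 → Param d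
  I : Fin (E * T) → Finset (Fin n)
  meas : ∀ j, Measurable fun p : (Fin (E * T) → Param d) × 𝓧 => φ j p.1 p.2
  norm_le : ∀ j u y, ‖φ j u y‖ ≤ r
  adapted : ∀ l j u v, l ≤ j → φ l (Function.update u j v) = φ l u
  card : ∀ j, (I j).card = m
  epoch_lt : ∀ l j i, l < j → i ∈ I l → i ∈ I j → l.1 / T < j.1 / T

namespace AdaptiveQueries

variable {𝓧 : Type*} [MeasurableSpace 𝓧] {d n m T E : ℕ} {r : ℝ}
variable (M : AdaptiveQueries 𝓧 d n m T E r)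

/-- Exact answer of query `j`. -/
noncomputable def g (j : Fin (E * T)) (u : Fin (E * T) → Param d) (x : Fin n → 𝓧) : Param d :=
  ∑ i ∈ M.I j, M.φ j u (x i)

/-- Log-likelihood of the first `k` noisy answers `u`. -/
noncomputable def X (k : ℕ) (u : Fin (E * T) → Param d) (x : Fin n → 𝓧) : ℝ :=
  psum k fun l => inner ℝ (u l) (M.g l u x) - ‖M.g l u x‖ ^ 2 / 2

/-- The part of the log-likelihood `X k u x` in which sample `i` takes part. -/
noncomputable def δ (k : ℕ) (i : Fin n) (u : Fin (E * T) → Param d) (x : Fin n → 𝓧) : ℝ :=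
  psum k fun l => if i ∈ M.I l then
    inner ℝ (u l - M.g l u x) (M.φ l u (x i)) + ‖M.φ l u (x i)‖ ^ 2 / 2 else 0

theorem g_eq_add {j : Fin (E * T)} {i : Fin n} (hi : i ∈ M.I j) (u : Fin (E * T) → Param d)
    (x : Fin n → 𝓧) :
    M.g j u x = ∑ k ∈ (M.I j).erase i, M.φ j u (x k) + M.φ j u (x i) := by
  rw [g, Finset.sum_erase_add _ _ hi]

theorem sum_erase_update {j : Fin (E * T)} (i : Fin n) (u : Fin (E * T) → Param d)
    (x : Fin n → 𝓧) (y : 𝓧) :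
    ∑ k ∈ (M.I j).erase i, M.φ j u (Function.update x i y k) =
      ∑ k ∈ (M.I j).erase i, M.φ j u (x k) :=
  Finset.sum_congr rfl fun k hk => by rw [Function.update_of_ne (Finset.ne_of_mem_erase hk)]

theorem g_update {j : Fin (E * T)} {i : Fin n} (hi : i ∈ M.I j) (u : Fin (E * T) → Param d)
    (x : Fin n → 𝓧) (y : 𝓧) :
    M.g j u (Function.update x i y) = M.g j u x - M.φ j u (x i) + M.φ j u y := by
  rw [M.g_eq_add hi u (Function.update x i y), M.g_eq_add hi u x, sum_erase_update]
  simp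

theorem g_update_of_notMem {j : Fin (E * T)} {i : Fin n} (hi : i ∉ M.I j)
    (u : Fin (E * T) → Param d) (x : Fin n → 𝓧) (y : 𝓧) :
    M.g j u (Function.update x i y) = M.g j u x := by
  refine Finset.sum_congr rfl fun k hk => ?_
  rw [Function.update_of_ne (fun h => hi (by rwa [← h]))]

theorem norm_g_le (j : Fin (E * T)) (u : Fin (E * T) → Param d) (x : Fin n → 𝓧) :
    ‖M.g j u x‖ ≤ m * r := by
  refine (norm_sum_le _ _).trans ((Finset.sum_le_sum fun i _ => M.norm_le j u (x i)).trans ?_)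
  rw [Finset.sum_const, M.card, nsmul_eq_mul]

theorem norm_sq_le (j : Fin (E * T)) (u : Fin (E * T) → Param d) (y : 𝓧) :
    ‖M.φ j u y‖ ^ 2 ≤ r ^ 2 := pow_le_pow_left₀ (norm_nonneg _) (M.norm_le j u y) 2

theorem inner_le (j : Fin (E * T)) (u : Fin (E * T) → Param d) (y y' : 𝓧) :
    |inner ℝ (M.φ j u y) (M.φ j u y')| ≤ r ^ 2 := by
  refine (abs_real_inner_le_norm _ _).trans ?_
  rw [pow_two]
  exact mul_le_mul (M.norm_le _ _ _) (M.norm_le _ _ _) (norm_nonneg _)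
    ((norm_nonneg _).trans (M.norm_le j u y))

/-- Subtracting `δ i` removes sample `i` from the log-likelihood. -/
theorem X_sub_δ_update (k : ℕ) (i : Fin n) (u : Fin (E * T) → Param d) (x : Fin n → 𝓧) (y : 𝓧) :
    M.X k u (Function.update x i y) - M.δ k i u (Function.update x i y) =
      M.X k u x - M.δ k i u x := by
  simp only [X, δ, ← psum_sub]
  refine psum_congr fun l _ => ?_
  by_cases hi : i ∈ M.I l
  · have h : ∀ x : Fin n → 𝓧, inner ℝ (u l) (M.g l u x) - ‖M.g l u x‖ ^ 2 / 2 -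
        (inner ℝ (u l - M.g l u x) (M.φ l u (x i)) + ‖M.φ l u (x i)‖ ^ 2 / 2) =
        inner ℝ (u l) (∑ k ∈ (M.I l).erase i, M.φ l u (x k)) -
          ‖∑ k ∈ (M.I l).erase i, M.φ l u (x k)‖ ^ 2 / 2 := by
      intro x
      rw [M.g_eq_add hi]
      set G := ∑ k ∈ (M.I l).erase i, M.φ l u (x k)
      rw [norm_add_sq_real, inner_sub_left, inner_add_right, inner_add_left,
        real_inner_self_eq_norm_sq]
      ring
    simp only [hi, if_true, h, sum_erase_update]
  · simp only [hi, if_false, M.g_update_of_notMem hi]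

section adapted

variable (u : Fin (E * T) → Param d) (x : Fin n → 𝓧) (v : Param d)

theorem g_adapted {l j : Fin (E * T)} (h : l ≤ j) :
    M.g l (Function.update u j v) x = M.g l u x := by
  simp only [g, M.adapted l j u v h]

theorem X_adapted {k : ℕ} {j : Fin (E * T)} (h : k ≤ j.1) :
    M.X k (Function.update u j v) x = M.X k u x := by
  refine psum_congr fun l hl => ?_
  have hlj : l < j := Fin.lt_def.2 (by omega)
  rw [M.g_adapted u x v hlj.le, Function.update_of_ne hlj.ne]

theorem δ_adapted (i : Fin n) {k : ℕ} {j : Fin (E * T)} (h : k ≤ j.1) :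
    M.δ k i (Function.update u j v) x = M.δ k i u x := by
  refine psum_congr fun l hl => ?_
  have hlj : l < j := Fin.lt_def.2 (by omega)
  simp only [M.g_adapted u x v hlj.le, Function.update_of_ne hlj.ne, M.adapted l j u v hlj.le]

/-- Query `j` only sees the answers before `j`, so the new answer `v` enters through a single
Gaussian log-density. -/
theorem X_succ_update {j : ℕ} (hj : j < E * T) :
    M.X (j + 1) (Function.update u ⟨j, hj⟩ v) x =
      M.X j u x + (inner ℝ v (M.g ⟨j, hj⟩ u x) - ‖M.g ⟨j, hj⟩ u x‖ ^ 2 / 2) := by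
  have h := M.X_adapted u x v (k := j) (j := ⟨j, hj⟩) le_rfl
  rw [← h]
  simp only [X]
  rw [psum_succ hj]
  simp [M.g_adapted u x v le_rfl]

theorem δ_succ_update (i : Fin n) {j : ℕ} (hj : j < E * T) :
    M.δ (j + 1) i (Function.update u ⟨j, hj⟩ v) x =
      M.δ j i u x + if i ∈ M.I ⟨j, hj⟩ then inner ℝ (v - M.g ⟨j, hj⟩ u x) (M.φ ⟨j, hj⟩ u (x i))
        + ‖M.φ ⟨j, hj⟩ u (x i)‖ ^ 2 / 2 else 0 := by
  have h := M.δ_adapted u x v i (k := j) (j := ⟨j, hj⟩) le_rfl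
  rw [← h]
  simp only [δ]
  rw [psum_succ hj]
  simp [M.g_adapted u x v le_rfl, M.adapted _ _ u v le_rfl]

end adapted

section measurability

@[fun_prop]
theorem measurable_φ {α : Type*} [MeasurableSpace α] (j : Fin (E * T))
    {f : α → Fin (E * T) → Param d} {h : α → 𝓧} (hf : Measurable f) (hh : Measurable h) :
    Measurable fun a => M.φ j (f a) (h a) :=
  (M.meas j).comp (hf.prodMk hh)

@[fun_prop]
theorem measurable_g {α : Type*} [MeasurableSpace α] (j : Fin (E * T))
    {f : α → Fin (E * T) → Param d} {h : α → Fin n → 𝓧} (hf : Measurable f) (hh : Measurable h) :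
    Measurable fun a => M.g j (f a) (h a) := by
  unfold g
  exact Finset.measurable_sum _ fun i _ => by fun_prop

@[fun_prop]
theorem measurable_X {α : Type*} [MeasurableSpace α] (k : ℕ)
    {f : α → Fin (E * T) → Param d} {h : α → Fin n → 𝓧} (hf : Measurable f) (hh : Measurable h) :
    Measurable fun a => M.X k (f a) (h a) := by
  unfold X
  exact Measurable.psum k fun l => by fun_prop

@[fun_prop]
theorem measurable_δ {α : Type*} [MeasurableSpace α] (k : ℕ) (i : Fin n)
    {f : α → Fin (E * T) → Param d} {h : α → Fin n → 𝓧} (hf : Measurable f) (hh : Measurable h) :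
    Measurable fun a => M.δ k i (f a) (h a) := by
  unfold δ
  refine Measurable.psum k fun l => ?_
  split_ifs
  · fun_prop
  · fun_prop

theorem bddMeas_inner {α : Type*} [MeasurableSpace α] {f h : α → Param d} (hf : Measurable f)
    (hh : Measurable h) {a b : ℝ} (ha : ∀ x, ‖f x‖ ≤ a) (hb : ∀ x, ‖h x‖ ≤ b) :
    BddMeas fun x => (inner ℝ (f x) (h x) : ℝ) := by
  refine ⟨by fun_prop, a * b, fun x => (abs_real_inner_le_norm _ _).trans ?_⟩
  exact mul_le_mul (ha x) (hb x) (norm_nonneg _) ((norm_nonneg _).trans (ha x))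

theorem bddMeas_norm_sq {α : Type*} [MeasurableSpace α] {f : α → Param d} (hf : Measurable f)
    {a : ℝ} (ha : ∀ x, ‖f x‖ ≤ a) : BddMeas fun x => ‖f x‖ ^ 2 := by
  refine ⟨by fun_prop, a ^ 2, fun x => ?_⟩
  rw [abs_of_nonneg (by positivity)]
  exact pow_le_pow_left₀ (norm_nonneg _) (ha x) 2

theorem bddMeas_X (k : ℕ) (u : Fin (E * T) → Param d) : BddMeas (M.X k u) := by
  unfold X
  refine BddMeas.psum k fun l => ?_
  have h1 := bddMeas_norm_sq (f := fun x => M.g l u x) (by fun_prop) (M.norm_g_le l u)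
  have h2 := bddMeas_inner (f := fun _ => u l) (h := fun x => M.g l u x) (by fun_prop)
    (by fun_prop) (fun _ => le_rfl) (M.norm_g_le l u)
  simpa only [div_eq_inv_mul] using h2.sub (h1.const_mul 2⁻¹)

theorem bddMeas_δ (k : ℕ) (i : Fin n) (u : Fin (E * T) → Param d) : BddMeas (M.δ k i u) := by
  unfold δ
  refine BddMeas.psum k fun l => ?_
  split_ifs
  · have h1 := bddMeas_norm_sq (f := fun x : Fin n → 𝓧 => M.φ l u (x i)) (by fun_prop)
      (fun x => M.norm_le l u (x i))
    have h2 := bddMeas_inner (f := fun x => u l - M.g l u x) (h := fun x => M.φ l u (x i))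
      (by fun_prop) (by fun_prop) (a := ‖u l‖ + m * r)
      (fun x => (norm_sub_le _ _).trans (by gcongr; exact M.norm_g_le l u x))
      (fun x => M.norm_le l u (x i))
    simpa only [div_eq_inv_mul] using h2.add (h1.const_mul 2⁻¹)
  · exact BddMeas.const 0

end measurability

end AdaptiveQueries

end Model

/-! ### Linear and quadratic exponential moments under the joint law. -/

namespace AdaptiveQueries

variable {𝓧 : Type*} [MeasurableSpace 𝓧] {d n m T E : ℕ} {r : ℝ}
variable (M : AdaptiveQueries 𝓧 d n m T E r)

/-- Under the likelihood weight, the noise `v - g` of step `j` is a fresh standard Gaussian. -/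
theorem lintegral_step {Ω : Type*} [MeasurableSpace Ω] (ρ : Measure Ω) [SFinite ρ]
    {π : Ω → Fin n → 𝓧} (hπ : Measurable π) {H : Ω → Param d → ℝ≥0∞}
    (hH : Measurable fun p : Ω × Param d => H p.1 p.2) {j : ℕ} (hj : j < E * T)
    (u : Fin (E * T) → Param d) :
    ∫⁻ v, ∫⁻ ω, eexp (M.X (j + 1) (Function.update u ⟨j, hj⟩ v) (π ω)) *
        H ω (v - M.g ⟨j, hj⟩ u (π ω)) ∂ρ ∂stdGaussian (Param d) =
      ∫⁻ ω, eexp (M.X j u (π ω)) * ∫⁻ z, H ω z ∂stdGaussian (Param d) ∂ρ := by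
  simp_rw [M.X_succ_update]
  have hm : Measurable fun p : Param d × Ω => eexp (M.X j u (π p.2) +
      (inner ℝ p.1 (M.g ⟨j, hj⟩ u (π p.2)) - ‖M.g ⟨j, hj⟩ u (π p.2)‖ ^ 2 / 2)) *
        H p.2 (p.1 - M.g ⟨j, hj⟩ u (π p.2)) := by
    refine Measurable.mul (by fun_prop) (hH.comp (Measurable.prodMk (by fun_prop) (by fun_prop)))
  rw [lintegral_lintegral_swap hm.aemeasurable]
  congr 1
  ext ω
  have hHω : Measurable fun v => H ω (v - M.g ⟨j, hj⟩ u (π ω)) :=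
    hH.comp (Measurable.prodMk measurable_const (by fun_prop))
  simp_rw [eexp_add (M.X j u (π ω)), mul_assoc]
  have h2 := lintegral_stdGaussian_add hHω (M.g ⟨j, hj⟩ u (π ω))
  simp only [add_sub_cancel_right] at h2
  rw [h2]
  exact lintegral_const_mul _ (Measurable.mul (by fun_prop) hHω)

variable (P : Fin n → Measure 𝓧) [∀ i, IsProbabilityMeasure (P i)]

/-- In terms of the fresh noise z of step j, ∑ δ_i grows by ⟨z, g⟩ plus half the sum of the squared
contributions. Its Gaussian exponential moment is bounded by ‖g‖ ≤ m r and ‖φ‖ ≤ r. -/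
theorem lintegral_eexp_X_add_δ_le (κ : ℝ) (hκ : 0 ≤ κ) (k : ℕ) (hk : k ≤ E * T) :
    ∫⁻ u, ∫⁻ x, eexp (M.X k u x + κ * ∑ i, M.δ k i u x) ∂Measure.pi P
        ∂Measure.pi (fun _ => stdGaussian (Param d)) ≤
      eexp (k * (κ * (m * r ^ 2) / 2 + κ ^ 2 * (m * (m * r ^ 2)) / 2)) := by
  set c := κ * (m * r ^ 2) / 2 + κ ^ 2 * (m * (m * r ^ 2)) / 2 with hc
  refine (lintegral_pi_le_prod (stdGaussian (Param d))
    (fun k u => ∫⁻ x, eexp (M.X k u x + κ * ∑ i, M.δ k i u x) ∂Measure.pi P)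
    (fun _ => eexp c) (fun k => ?_) ?_ k hk).trans ?_
  · exact Measurable.lintegral_prod_right' (f := fun p : (Fin (E * T) → Param d) × (Fin n → 𝓧) =>
      eexp (M.X k p.1 p.2 + κ * ∑ i, M.δ k i p.1 p.2)) (by fun_prop)
  · intro j hj u
    set jj : Fin (E * T) := ⟨j, hj⟩
    set H : (Fin n → 𝓧) → Param d → ℝ≥0∞ := fun x z =>
      eexp (κ * ∑ i, M.δ j i u x + κ * (inner ℝ z (M.g jj u x) +
        ∑ i ∈ M.I jj, ‖M.φ jj u (x i)‖ ^ 2 / 2)) with hH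
    have h1 : ∀ v x, eexp (M.X (j + 1) (Function.update u jj v) x +
        κ * ∑ i, M.δ (j + 1) i (Function.update u jj v) x) =
        eexp (M.X (j + 1) (Function.update u jj v) x) * H x (v - M.g jj u x) := by
      intro v x
      rw [eexp_add]
      simp_rw [jj, M.δ_succ_update, hH]
      congr 2
      rw [Finset.sum_add_distrib, Finset.sum_ite_mem, Finset.univ_inter, Finset.sum_add_distrib,
        mul_add]
      simp only [g, inner_sum]
      rfl
    simp_rw [h1]
    have hs := M.lintegral_step (Measure.pi P) (π := fun x => x) measurable_id (H := H)
      (by fun_prop) hj u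
    rw [hs, ← lintegral_const_mul _ (by fun_prop)]
    refine lintegral_mono fun x => ?_
    have h2 : ∀ z, H x z = eexp (κ * ∑ i, M.δ j i u x +
        κ * ∑ i ∈ M.I jj, ‖M.φ jj u (x i)‖ ^ 2 / 2) * eexp (inner ℝ z (κ • M.g jj u x)) := by
      intro z
      rw [← eexp_add, inner_smul_right]
      simp only [hH]
      congr 1
      ring
    simp_rw [h2]
    rw [lintegral_const_mul _ (by fun_prop), lintegral_stdGaussian_eexp, ← eexp_add, ← eexp_add,
      ← eexp_add]
    refine eexp_mono ?_
    have h3 : ‖κ • M.g jj u x‖ ^ 2 ≤ κ ^ 2 * (m * (m * r ^ 2)) := by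
      rw [norm_smul, mul_pow, Real.norm_eq_abs, sq_abs]
      have := pow_le_pow_left₀ (norm_nonneg _) (M.norm_g_le jj u x) 2
      have := mul_le_mul_of_nonneg_left this (sq_nonneg κ)
      nlinarith
    have h4 : ∑ i ∈ M.I jj, ‖M.φ jj u (x i)‖ ^ 2 / 2 ≤ m * r ^ 2 / 2 := by
      refine (Finset.sum_le_sum fun i _ =>
        div_le_div_of_nonneg_right (M.norm_sq_le jj u (x i)) zero_le_two).trans (le_of_eq ?_)
      rw [Finset.sum_const, M.card, nsmul_eq_mul]; ring
    have h5 := mul_le_mul_of_nonneg_left h4 hκ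
    linarith
  · simp [X, δ, Finset.prod_const, ← ENNReal.rpow_natCast, eexp_rpow]

/-- Accumulated correlation of the noise with the contributions of sample `i`, evaluated at a
dataset `x'`. -/
noncomputable def corr (k : ℕ) (i : Fin n) (u : Fin (E * T) → Param d) (x x' : Fin n → 𝓧) : ℝ :=
  psum k fun l => if i ∈ M.I l then inner ℝ (u l - M.g l u x) (M.φ l u (x' i)) else 0

/-- Weighted squares of the correlations with the actual and with a fresh dataset. -/
noncomputable def corrSq (k : ℕ) (i : Fin n) (u : Fin (E * T) → Param d) (x x' : Fin n → 𝓧) : ℝ :=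
  2 / 3 * M.corr k i u x x ^ 2 + 1 / 3 * M.corr k i u x x' ^ 2

/-- One plus the last epoch in which sample `i` was used before step `k`, or zero. -/
def lastEpoch (k : ℕ) (i : Fin n) : ℕ :=
  Finset.univ.sup fun l : Fin (E * T) => if l.1 < k ∧ i ∈ M.I l then l.1 / T + 1 else 0

theorem corrSq_nonneg (k : ℕ) (i : Fin n) (u : Fin (E * T) → Param d) (x x' : Fin n → 𝓧) :
    0 ≤ M.corrSq k i u x x' := by
  unfold corrSq; positivity

@[fun_prop]
theorem measurable_corr {α : Type*} [MeasurableSpace α] (k : ℕ) (i : Fin n)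
    {f : α → Fin (E * T) → Param d} {h h' : α → Fin n → 𝓧} (hf : Measurable f) (hh : Measurable h)
    (hh' : Measurable h') : Measurable fun a => M.corr k i (f a) (h a) (h' a) := by
  unfold corr
  refine Measurable.psum k fun l => ?_
  split_ifs
  · fun_prop
  · fun_prop

@[fun_prop]
theorem measurable_corrSq {α : Type*} [MeasurableSpace α] (k : ℕ) (i : Fin n)
    {f : α → Fin (E * T) → Param d} {h h' : α → Fin n → 𝓧} (hf : Measurable f) (hh : Measurable h)
    (hh' : Measurable h') : Measurable fun a => M.corrSq k i (f a) (h a) (h' a) := by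
  unfold corrSq
  fun_prop

theorem corr_succ_update (i : Fin n) {j : ℕ} (hj : j < E * T) (u : Fin (E * T) → Param d)
    (v : Param d) (x x' : Fin n → 𝓧) :
    M.corr (j + 1) i (Function.update u ⟨j, hj⟩ v) x x' =
      M.corr j i u x x' + if i ∈ M.I ⟨j, hj⟩ then
        inner ℝ (v - M.g ⟨j, hj⟩ u x) (M.φ ⟨j, hj⟩ u (x' i)) else 0 := by
  simp only [corr]
  rw [psum_succ hj]
  congr 1
  · refine psum_congr fun l hl => ?_
    have hlj : l < ⟨j, hj⟩ := Fin.lt_def.2 hl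
    simp only [M.g_adapted u x v hlj.le, Function.update_of_ne hlj.ne, M.adapted l _ u v hlj.le]
  · simp [M.g_adapted u x v le_rfl, M.adapted _ _ u v le_rfl]

theorem lastEpoch_le {j : ℕ} (hj : j < E * T) {i : Fin n} (hi : i ∈ M.I ⟨j, hj⟩) :
    M.lastEpoch j i ≤ j / T := by
  refine Finset.sup_le fun l _ => ?_
  split_ifs with h
  · exact M.epoch_lt l ⟨j, hj⟩ i (Fin.lt_def.2 h.1) h.2 hi
  · exact Nat.zero_le _

theorem lastEpoch_le_epochs (k : ℕ) (i : Fin n) : M.lastEpoch k i ≤ E := by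
  refine Finset.sup_le fun l _ => ?_
  split_ifs with h
  · exact Nat.div_lt_of_lt_mul (l.2.trans_eq (mul_comm _ _))
  · exact Nat.zero_le _

theorem lastEpoch_succ_of_mem {j : ℕ} (hj : j < E * T) {i : Fin n} (hi : i ∈ M.I ⟨j, hj⟩) :
    M.lastEpoch (j + 1) i = j / T + 1 := by
  refine le_antisymm (Finset.sup_le fun l _ => ?_) ?_
  · split_ifs with h
    · have : l.1 ≤ j := by omega
      exact Nat.succ_le_succ (Nat.div_le_div_right this)
    · exact Nat.zero_le _
  · have := Finset.le_sup (f := fun l : Fin (E * T) =>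
      if l.1 < j + 1 ∧ i ∈ M.I l then l.1 / T + 1 else 0) (Finset.mem_univ ⟨j, hj⟩)
    rwa [if_pos ⟨Nat.lt_succ_self j, hi⟩] at this

theorem lastEpoch_succ_of_notMem {j : ℕ} (hj : j < E * T) {i : Fin n} (hi : i ∉ M.I ⟨j, hj⟩) :
    M.lastEpoch (j + 1) i = M.lastEpoch j i := by
  refine Finset.sup_congr rfl fun l _ => ?_
  by_cases hl : l.1 = j
  · have : l = ⟨j, hj⟩ := Fin.ext hl
    simp [this, hi]
  · have : l.1 < j + 1 ↔ l.1 < j := by omega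
    simp only [this]

/-- The potential weights sample i by `kap` at its last used epoch. Integrating out a step in epoch
e worsens the coefficients of its batch from kap(e+1) to kap(e+1)/(1 - 2kap(e+1) m r²) ≤ kap e.
Since every sample occurs at most once per epoch, kap e is still at most its weight before the step.
The cost is one determinant factor per step. -/
theorem lintegral_eexp_X_add_corrSq_le (hm : 0 < m) (kap : ℕ → ℝ) (hanti : Antitone kap)
    (h0 : ∀ e, 0 ≤ kap e) (hlt : ∀ e < E, 2 * kap (e + 1) * m * r ^ 2 < 1)
    (hstep : ∀ e < E, kap (e + 1) / (1 - 2 * kap (e + 1) * m * r ^ 2) ≤ kap e) :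
    ∫⁻ u, ∫⁻ p, eexp (M.X (E * T) u p.1 + kap E * ∑ i, M.corrSq (E * T) i u p.1 p.2)
        ∂(Measure.pi P).prod (Measure.pi P) ∂Measure.pi (fun _ => stdGaussian (Param d)) ≤
      ∏ j ∈ Finset.range (E * T),
        ENNReal.ofReal ((1 - 2 * kap (j / T + 1) * m * r ^ 2) ^ (-(1 / 2) : ℝ)) := by
  have hle : ∀ u (p : (Fin n → 𝓧) × (Fin n → 𝓧)),
      eexp (M.X (E * T) u p.1 + kap E * ∑ i, M.corrSq (E * T) i u p.1 p.2) ≤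
      eexp (M.X (E * T) u p.1 +
        ∑ i, kap (M.lastEpoch (E * T) i) * M.corrSq (E * T) i u p.1 p.2) := by
    intro u p
    refine eexp_mono ?_
    rw [Finset.mul_sum]
    gcongr with i _
    · exact M.corrSq_nonneg _ _ _ _ _
    · exact hanti (M.lastEpoch_le_epochs _ _)
  refine (lintegral_mono fun u => lintegral_mono fun p => hle u p).trans ?_
  refine (lintegral_pi_le_prod (stdGaussian (Param d))
    (fun k u => ∫⁻ p, eexp (M.X k u p.1 + ∑ i, kap (M.lastEpoch k i) * M.corrSq k i u p.1 p.2)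
      ∂(Measure.pi P).prod (Measure.pi P))
    (fun j => ENNReal.ofReal ((1 - 2 * kap (j / T + 1) * m * r ^ 2) ^ (-(1 / 2) : ℝ)))
    (fun k => ?_) ?_ (E * T) le_rfl).trans ?_
  · exact Measurable.lintegral_prod_right'
      (f := fun p : (Fin (E * T) → Param d) × ((Fin n → 𝓧) × (Fin n → 𝓧)) =>
      eexp (M.X k p.1 p.2.1 + ∑ i, kap (M.lastEpoch k i) * M.corrSq k i p.1 p.2.1 p.2.2))
      (by fun_prop)
  · intro j hj u
    set jj : Fin (E * T) := ⟨j, hj⟩ with hjj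
    set e := j / T with he
    have heE : e < E := Nat.div_lt_of_lt_mul (hj.trans_eq (mul_comm _ _))
    set A : (Fin n → 𝓧) × (Fin n → 𝓧) → ℝ := fun p =>
      ∑ i ∈ (M.I jj)ᶜ, kap (M.lastEpoch j i) * M.corrSq j i u p.1 p.2 with hA
    -- Each batch sample gives two squares: `true` for the actual dataset with weight 2/3, `false`
    -- for the fresh one with weight 1/3. The total weight is m.
    set S : Finset (Fin n × Bool) := M.I jj ×ˢ Finset.univ with hS
    set q : Fin n × Bool → ℝ := fun k => if k.2 then 2 / 3 else 1 / 3 with hq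
    set w : (Fin n → 𝓧) × (Fin n → 𝓧) → Fin n × Bool → ℝ := fun p k =>
      if k.2 then M.corr j k.1 u p.1 p.1 else M.corr j k.1 u p.1 p.2 with hw
    set ψ : (Fin n → 𝓧) × (Fin n → 𝓧) → Fin n × Bool → Param d := fun p k =>
      if k.2 then M.φ jj u (p.1 k.1) else M.φ jj u (p.2 k.1) with hψ
    set H : (Fin n → 𝓧) × (Fin n → 𝓧) → Param d → ℝ≥0∞ := fun p z =>
      eexp (A p) * eexp (kap (e + 1) * ∑ k ∈ S, q k * (w p k + inner ℝ z (ψ p k)) ^ 2) with hH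
    have hwm : ∀ k, Measurable fun p => w p k := by
      intro k; simp only [hw]; split_ifs <;> fun_prop
    have hψm : ∀ k, Measurable fun p => ψ p k := by
      intro k; simp only [hψ]; split_ifs <;> fun_prop
    have hAm : Measurable A := by simp only [hA]; fun_prop
    have hHm : Measurable fun p : ((Fin n → 𝓧) × (Fin n → 𝓧)) × Param d => H p.1 p.2 := by
      have h1 : ∀ k, Measurable fun p : ((Fin n → 𝓧) × (Fin n → 𝓧)) × Param d => w p.1 k :=
        fun k => (hwm k).comp measurable_fst
      have h2 : ∀ k, Measurable fun p : ((Fin n → 𝓧) × (Fin n → 𝓧)) × Param d => ψ p.1 k :=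
        fun k => (hψm k).comp measurable_fst
      have h3 : Measurable fun p : ((Fin n → 𝓧) × (Fin n → 𝓧)) × Param d => A p.1 :=
        hAm.comp measurable_fst
      simp only [hH]
      fun_prop
    have h1 : ∀ v (p : (Fin n → 𝓧) × (Fin n → 𝓧)),
        eexp (M.X (j + 1) (Function.update u jj v) p.1 + ∑ i, kap (M.lastEpoch (j + 1) i) *
          M.corrSq (j + 1) i (Function.update u jj v) p.1 p.2) =
        eexp (M.X (j + 1) (Function.update u jj v) p.1) * H p (v - M.g jj u p.1) := by
      intro v p
      rw [eexp_add, hH]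
      simp only
      rw [← eexp_add (A p)]
      congr 2
      rw [← Finset.sum_compl_add_sum (M.I jj)]
      congr 1
      · refine Finset.sum_congr rfl fun i hi => ?_
        rw [Finset.mem_compl] at hi
        rw [M.lastEpoch_succ_of_notMem hj hi]
        simp only [corrSq, jj, M.corr_succ_update]
        simp [← hjj, hi]
      · rw [hS, Finset.sum_product, Finset.mul_sum]
        refine Finset.sum_congr rfl fun i hi => ?_
        rw [M.lastEpoch_succ_of_mem hj hi, Fintype.sum_bool]
        simp only [corrSq, jj, M.corr_succ_update]
        simp [← hjj, hi, hq, hw, hψ, he]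
    simp_rw [h1]
    rw [M.lintegral_step _ measurable_fst hHm hj u, ← lintegral_const_mul _ (by fun_prop)]
    refine lintegral_mono fun p => ?_
    have hsum := lintegral_stdGaussian_eexp_sum_sq_le S (p := q) (w := w p) (ψ := ψ p)
      (κ := kap (e + 1)) (m := m) (ε := r ^ 2) (h0 _) (by exact_mod_cast hm)
      (fun k _ => by simp only [hq]; split_ifs <;> norm_num)
      (by
        rw [hS, Finset.sum_product]
        simp only [hq, Fintype.sum_bool, if_true, Bool.false_eq_true, if_false]
        rw [Finset.sum_const, M.card, nsmul_eq_mul]; norm_num)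
      (fun k _ => by simp only [hψ]; split_ifs <;> exact M.norm_sq_le _ _ _) (hlt e heE)
    have hHz : ∫⁻ z, H p z ∂stdGaussian (Param d) = eexp (A p) * ∫⁻ z, eexp (kap (e + 1) *
        ∑ k ∈ S, q k * (w p k + inner ℝ z (ψ p k)) ^ 2) ∂stdGaussian (Param d) := by
      rw [← lintegral_const_mul _ (by fun_prop)]
    rw [hHz, eexp_add]
    have hW : ∑ k ∈ S, q k * w p k ^ 2 = ∑ i ∈ M.I jj, M.corrSq j i u p.1 p.2 := by
      rw [hS, Finset.sum_product]
      refine Finset.sum_congr rfl fun i _ => ?_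
      simp [hq, hw, corrSq]
    have hle2 : eexp (A p) * eexp (kap (e + 1) / (1 - 2 * kap (e + 1) * m * r ^ 2) *
        ∑ k ∈ S, q k * w p k ^ 2) ≤
        eexp (∑ i, kap (M.lastEpoch j i) * M.corrSq j i u p.1 p.2) := by
      rw [← eexp_add, hW, ← Finset.sum_compl_add_sum (M.I jj) fun i =>
        kap (M.lastEpoch j i) * M.corrSq j i u p.1 p.2, Finset.mul_sum]
      refine eexp_mono (add_le_add_right (Finset.sum_le_sum fun i hi => ?_) _)
      refine mul_le_mul_of_nonneg_right ((hstep e heE).trans (hanti (M.lastEpoch_le hj hi)))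
        (M.corrSq_nonneg _ _ _ _ _)
    calc eexp (M.X j u p.1) * (eexp (A p) * ∫⁻ z, eexp (kap (e + 1) *
          ∑ k ∈ S, q k * (w p k + inner ℝ z (ψ p k)) ^ 2) ∂stdGaussian (Param d))
        ≤ eexp (M.X j u p.1) * (eexp (A p) *
          (ENNReal.ofReal ((1 - 2 * kap (e + 1) * m * r ^ 2) ^ (-(1 / 2) : ℝ)) *
          eexp (kap (e + 1) / (1 - 2 * kap (e + 1) * m * r ^ 2) * ∑ k ∈ S, q k * w p k ^ 2))) := by
          gcongr
      _ = ENNReal.ofReal ((1 - 2 * kap (e + 1) * m * r ^ 2) ^ (-(1 / 2) : ℝ)) *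
          (eexp (M.X j u p.1) * (eexp (A p) * eexp (kap (e + 1) /
          (1 - 2 * kap (e + 1) * m * r ^ 2) * ∑ k ∈ S, q k * w p k ^ 2))) := by ring
      _ ≤ _ := by gcongr
  · simp [X, corrSq, corr]

end AdaptiveQueries

/-! ### Reciprocal marginal likelihoods of single samples. -/

theorem lintegral_eexp_eq {Ω : Type*} [MeasurableSpace Ω] {a : Ω → ℝ} (ha : BddMeas a)
    (μ : Measure Ω) [IsProbabilityMeasure μ] :
    ∫⁻ y, eexp (a y) ∂μ = eexp (Real.log (∫ y, Real.exp (a y) ∂μ)) := by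
  rw [eexp, Real.exp_log (ha.posBddMeas_exp.integral_pos μ),
    ofReal_integral_eq_lintegral_ofReal (ha.exp.integrable μ)
      (ae_of_all _ fun _ => (Real.exp_pos _).le)]
  rfl

theorem two_mul_eexp_le (s t : ℝ) : 2 * eexp t ≤ eexp s + eexp (2 * t - s) := by
  rw [eexp, eexp, eexp, ← ENNReal.ofReal_add (Real.exp_pos _).le (Real.exp_pos _).le,
    show (2 : ℝ≥0∞) = ENNReal.ofReal 2 by simp, ← ENNReal.ofReal_mul zero_le_two]
  refine ENNReal.ofReal_le_ofReal ?_
  have h1 : Real.exp t ^ 2 = Real.exp s * Real.exp (2 * t - s) := by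
    rw [← Real.exp_add, ← Real.exp_nat_mul]; congr 1; push_cast; ring
  nlinarith [sq_nonneg (Real.exp s - Real.exp (2 * t - s)), Real.exp_pos s, Real.exp_pos t,
    Real.exp_pos (2 * t - s)]

/-- Chi-square type pairing of two shifted Gaussians; it is at most e^{r²} for shifts of norm at
most r. -/
theorem lintegral_stdGaussian_mul_density {d : ℕ} (a b : Param d) :
    ∫⁻ v, eexp (inner ℝ v a - ‖a‖ ^ 2 / 2) * eexp (inner ℝ v b - ‖b‖ ^ 2 / 2)
      ∂stdGaussian (Param d) = eexp (inner ℝ a b) := by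
  have h : ∀ v : Param d, eexp (inner ℝ v a - ‖a‖ ^ 2 / 2) * eexp (inner ℝ v b - ‖b‖ ^ 2 / 2) =
      eexp (inner ℝ v (a + b)) * eexp (-(‖a‖ ^ 2 / 2) - ‖b‖ ^ 2 / 2) := fun v => by
    rw [← eexp_add, ← eexp_add, inner_add_right]; congr 1; ring
  simp_rw [h]
  rw [lintegral_mul_const _ (by fun_prop), lintegral_stdGaussian_eexp, ← eexp_add,
    norm_add_sq_real]
  congr 1
  ring

/-- Effect of one Gaussian observation of `φ y`, `y ∼ e^a μ`, on the reciprocal of the normalized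
marginal likelihood, weighted with a function `Ψ` of bounded oscillation. -/
theorem lintegral_inv_marginal_le {𝓧 : Type*} [MeasurableSpace 𝓧] {d : ℕ} (μ : Measure 𝓧)
    [IsProbabilityMeasure μ] {a : 𝓧 → ℝ} (ha : BddMeas a) {φ : 𝓧 → Param d} (hφ : Measurable φ)
    {r : ℝ} (hr : ∀ y, ‖φ y‖ ≤ r) {Ψ : 𝓧 → ℝ≥0∞} (hΨ : Measurable Ψ) {o : ℝ} (ho : 0 ≤ o)
    (hosc : ∀ y y', Ψ y ≤ eexp o * Ψ y') {L : Param d → ℝ}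
    (hL : ∀ s, L s = Real.log (∫ y, Real.exp (a y + (inner ℝ s (φ y) - ‖φ y‖ ^ 2 / 2)) ∂μ))
    (hLm : Measurable L) :
    ∫⁻ y, eexp (a y) * Ψ y * ∫⁻ z, eexp (Real.log (∫ y, Real.exp (a y) ∂μ) - L (z + φ y))
        ∂stdGaussian (Param d) ∂μ ≤
      ENNReal.ofReal (1 + r ^ 2 * (Real.exp o - 1)) * ∫⁻ y, eexp (a y) * Ψ y ∂μ := by
  set γ := stdGaussian (Param d)
  set L0 := Real.log (∫ y, Real.exp (a y) ∂μ) with hL0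
  have ham := ha.meas
  set R : 𝓧 → ℝ≥0∞ := fun y => ∫⁻ z, eexp (L0 - L (z + φ y)) ∂γ with hR
  have hRm : Measurable R := Measurable.lintegral_prod_right'
    (f := fun p : 𝓧 × Param d => eexp (L0 - L (p.2 + φ p.1))) (by fun_prop)
  have hR2 : ∀ y, R y =
      ∫⁻ v, eexp (inner ℝ v (φ y) - ‖φ y‖ ^ 2 / 2) * eexp (L0 - L v) ∂γ := fun y =>
    lintegral_stdGaussian_add (F := fun v => eexp (L0 - L v)) (by fun_prop) (φ y)
  have hbdd : ∀ s : Param d, BddMeas fun y => a y + (inner ℝ s (φ y) - ‖φ y‖ ^ 2 / 2) := by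
    intro s
    have h1 := AdaptiveQueries.bddMeas_inner (f := fun _ : 𝓧 => s) (by fun_prop) hφ
      (fun _ => le_rfl) hr
    have h2 := AdaptiveQueries.bddMeas_norm_sq hφ hr
    simpa only [div_eq_inv_mul] using ha.add (h1.sub (h2.const_mul 2⁻¹))
  have hLe : ∀ s, ∫⁻ y, eexp (a y) * eexp (inner ℝ s (φ y) - ‖φ y‖ ^ 2 / 2) ∂μ = eexp (L s) := by
    intro s
    simp_rw [← eexp_add]
    rw [lintegral_eexp_eq (hbdd s), hL]
  have hL0e : ∫⁻ y, eexp (a y) ∂μ = eexp L0 := lintegral_eexp_eq ha μ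
  -- R is the conditional mean, given y, of the reciprocal of the normalized marginal likelihood.
  -- Its mean over y ∼ e^a μ is one after normalization, because the mixture of the shifted
  -- Gaussians is what is being divided by.
  have hmean : ∫⁻ y, eexp (a y) * R y ∂μ = eexp L0 := by
    simp_rw [hR2]
    have h1 : ∀ y, eexp (a y) * ∫⁻ v, eexp (inner ℝ v (φ y) - ‖φ y‖ ^ 2 / 2) *
        eexp (L0 - L v) ∂γ = ∫⁻ v, eexp (a y) * (eexp (inner ℝ v (φ y) - ‖φ y‖ ^ 2 / 2) *
        eexp (L0 - L v)) ∂γ := fun y => (lintegral_const_mul _ (by fun_prop)).symm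
    simp_rw [h1]
    rw [lintegral_lintegral_swap (by fun_prop)]
    simp_rw [← mul_assoc]
    have h2 : ∀ v, ∫⁻ y, eexp (a y) * eexp (inner ℝ v (φ y) - ‖φ y‖ ^ 2 / 2) *
        eexp (L0 - L v) ∂μ = eexp L0 := fun v => by
      rw [lintegral_mul_const _ (by fun_prop), hLe, ← eexp_add]
      congr 1; ring
    simp_rw [h2]
    simp [γ]
  set t := eexp (-r ^ 2) with ht
  -- AM-GM: 2t ≤ ρ⁻¹ + t²ρ for the normalized marginal ρ = e^{L - L0}. The mean of ρ under the shift
  -- φ y is at most e^{r²} = 1/t, so R y ≥ 2t - t.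
  have hlow : ∀ y, t ≤ R y := by
    intro y
    have h1 : ∫⁻ v, eexp (inner ℝ v (φ y) - ‖φ y‖ ^ 2 / 2) * eexp (L v) ∂γ ≤
        eexp (r ^ 2) * eexp L0 := by
      simp_rw [← hLe]
      have h2 : ∀ v, eexp (inner ℝ v (φ y) - ‖φ y‖ ^ 2 / 2) *
          ∫⁻ y', eexp (a y') * eexp (inner ℝ v (φ y') - ‖φ y'‖ ^ 2 / 2) ∂μ =
          ∫⁻ y', eexp (inner ℝ v (φ y) - ‖φ y‖ ^ 2 / 2) *
            (eexp (a y') * eexp (inner ℝ v (φ y') - ‖φ y'‖ ^ 2 / 2)) ∂μ := fun v =>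
        (lintegral_const_mul _ (by fun_prop)).symm
      simp_rw [h2]
      rw [lintegral_lintegral_swap (by fun_prop), ← hL0e, ← lintegral_const_mul _ (by fun_prop)]
      refine lintegral_mono fun y' => ?_
      simp_rw [mul_left_comm _ (eexp (a y'))]
      rw [lintegral_const_mul _ (by fun_prop), lintegral_stdGaussian_mul_density, mul_comm]
      refine mul_le_mul_left (eexp_mono ?_) _
      refine (real_inner_le_norm _ _).trans ?_
      rw [pow_two]
      exact mul_le_mul (hr y) (hr y') (norm_nonneg _) ((norm_nonneg _).trans (hr y))
    have h3 : ∫⁻ v, eexp (inner ℝ v (φ y) - ‖φ y‖ ^ 2 / 2) * (2 * t) ∂γ ≤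
        ∫⁻ v, (eexp (inner ℝ v (φ y) - ‖φ y‖ ^ 2 / 2) * eexp (L0 - L v) +
          eexp (inner ℝ v (φ y) - ‖φ y‖ ^ 2 / 2) * eexp (L v) * eexp (2 * -r ^ 2 - L0)) ∂γ := by
      refine lintegral_mono fun v => ?_
      rw [mul_assoc, ← mul_add, ← eexp_add]
      have := two_mul_eexp_le (L0 - L v) (-r ^ 2)
      refine mul_le_mul_right (this.trans (le_of_eq ?_)) _
      congr 2; ring
    rw [lintegral_mul_const _ (by fun_prop), lintegral_stdGaussian_eexp_sub, one_mul,
      lintegral_add_left (by fun_prop), ← hR2, lintegral_mul_const _ (by fun_prop)] at h3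
    have h4 : eexp (r ^ 2) * eexp L0 * eexp (2 * -r ^ 2 - L0) = t := by
      rw [← eexp_add, ← eexp_add]; congr 1; ring
    have h5 : t + t ≤ R y + t := by
      rw [← two_mul]
      refine h3.trans (add_le_add_right ?_ _)
      rw [← h4]
      exact mul_le_mul_left h1 _
    exact (ENNReal.add_le_add_iff_right (eexp_ne_top _)).1 h5
  set S : 𝓧 → ℝ≥0∞ := fun y => R y - t with hS
  have hSm : Measurable S := hRm.sub_const t
  have hRS : ∀ y, R y = t + S y := fun y => (add_tsub_cancel_of_le (hlow y)).symm
  have hSmean : t * eexp L0 + ∫⁻ y, eexp (a y) * S y ∂μ = eexp L0 := by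
    conv_rhs => rw [← hmean]
    simp_rw [hRS, mul_add]
    rw [lintegral_add_left (by fun_prop), lintegral_mul_const _ (by fun_prop), hL0e, mul_comm t]
  have hSle : ∫⁻ y, eexp (a y) * S y ∂μ ≤ (1 - t) * eexp L0 := by
    rw [ENNReal.sub_mul fun _ _ => eexp_ne_top _, one_mul]
    refine ENNReal.le_sub_of_add_le_left ?_ hSmean.le
    exact ENNReal.mul_ne_top (eexp_ne_top _) (eexp_ne_top _)
  -- The part t of R factors out of the weighted integral without loss. Only the nonnegative
  -- remainder S, of normalized mean at most 1 - t ≤ r², can correlate with Ψ, losing at most e^o.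
  set J := ∫⁻ y, eexp (a y) * Ψ y ∂μ with hJ
  have hΨJ : ∀ y, eexp L0 * Ψ y ≤ eexp o * J := by
    intro y
    rw [← hL0e, ← lintegral_mul_const _ (by fun_prop), hJ, ← lintegral_const_mul _ (by fun_prop)]
    refine lintegral_mono fun y' => ?_
    rw [mul_left_comm]
    exact mul_le_mul_right (hosc y y') _
  have hSΨ : ∫⁻ y, eexp (a y) * Ψ y * S y ∂μ ≤ eexp o * J * (1 - t) := by
    have h1 : eexp L0 * ∫⁻ y, eexp (a y) * Ψ y * S y ∂μ ≤ eexp L0 * (eexp o * J * (1 - t)) := by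
      rw [← lintegral_const_mul _ (by fun_prop)]
      calc ∫⁻ y, eexp L0 * (eexp (a y) * Ψ y * S y) ∂μ
          ≤ ∫⁻ y, eexp o * J * (eexp (a y) * S y) ∂μ := by
            refine lintegral_mono fun y => ?_
            calc eexp L0 * (eexp (a y) * Ψ y * S y) = eexp L0 * Ψ y * (eexp (a y) * S y) := by ring
              _ ≤ _ := mul_le_mul_left (hΨJ y) _
        _ = eexp o * J * ∫⁻ y, eexp (a y) * S y ∂μ := lintegral_const_mul _ (by fun_prop)
        _ ≤ eexp o * J * ((1 - t) * eexp L0) := mul_le_mul_right hSle _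
        _ = _ := by ring
    exact (ENNReal.mul_le_mul_iff_right (eexp_pos _).ne' (eexp_ne_top _)).1 h1
  calc ∫⁻ y, eexp (a y) * Ψ y * R y ∂μ
      = t * J + ∫⁻ y, eexp (a y) * Ψ y * S y ∂μ := by
        simp_rw [hRS, mul_add]
        rw [lintegral_add_left (by fun_prop), lintegral_mul_const _ (by fun_prop), mul_comm t]
    _ ≤ t * J + eexp o * J * (1 - t) := add_le_add_right hSΨ _
    _ = (t + eexp o * (1 - t)) * J := by ring
    _ ≤ _ := by
        refine mul_le_mul_left ?_ _
        have e1 : (1 : ℝ≥0∞) - t = ENNReal.ofReal (1 - Real.exp (-r ^ 2)) := by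
          rw [ENNReal.ofReal_sub _ (Real.exp_pos _).le, ENNReal.ofReal_one, ht]; rfl
        have e2 : 0 ≤ 1 - Real.exp (-r ^ 2) := by
          have : Real.exp (-r ^ 2) ≤ 1 := Real.exp_le_one_iff.2 (by nlinarith [sq_nonneg r])
          linarith
        rw [e1, ht, eexp, eexp, ← ENNReal.ofReal_mul (Real.exp_pos _).le,
          ← ENNReal.ofReal_add (Real.exp_pos _).le (mul_nonneg (Real.exp_pos _).le e2)]
        refine ENNReal.ofReal_le_ofReal ?_
        have e3 := Real.add_one_le_exp (-r ^ 2)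
        have e4 : 1 ≤ Real.exp o := Real.one_le_exp ho
        nlinarith

namespace AdaptiveQueries

variable {𝓧 : Type*} [MeasurableSpace 𝓧] {d n m T E : ℕ} {r : ℝ}
variable (M : AdaptiveQueries 𝓧 d n m T E r)
variable (P : Fin n → Measure 𝓧) [∀ i, IsProbabilityMeasure (P i)]

/-- Logarithm of the average over sample `i` of its share `e^{δ i}` of the likelihood. -/
noncomputable def logAvg (k : ℕ) (i : Fin n) (u : Fin (E * T) → Param d) (x : Fin n → 𝓧) : ℝ :=
  Real.log (avg P i (fun x => Real.exp (M.δ k i u x)) x)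

@[fun_prop]
theorem measurable_logAvg {α : Type*} [MeasurableSpace α] (k : ℕ) (i : Fin n)
    {f : α → Fin (E * T) → Param d} {h : α → Fin n → 𝓧} (hf : Measurable f) (hh : Measurable h) :
    Measurable fun a => M.logAvg P k i (f a) (h a) := by
  refine Measurable.log ?_
  have h1 : Measurable fun p : α × 𝓧 =>
      Real.exp (M.δ k i (f p.1) (Function.update (h p.1) i p.2)) := by
    have : Measurable fun p : α × 𝓧 => Function.update (h p.1) i p.2 :=
      measurable_update'.comp ((hh.comp measurable_fst).prodMk measurable_snd)
    fun_prop
  exact (h1.stronglyMeasurable.integral_prod_right' (ν := P i)).measurable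

/-- Sample `i` enters δ_l only through the exact answers of the steps they share. Each such step
changes the inner product with φ(x_l) by at most 2r². -/
theorem δ_update_le (k : ℕ) {i l : Fin n} (hil : l ≠ i) (u : Fin (E * T) → Param d)
    (x : Fin n → 𝓧) (y y' : 𝓧) :
    M.δ k l u (Function.update x i y') ≤ M.δ k l u (Function.update x i y) +
      psum k fun j => if i ∈ M.I j ∧ l ∈ M.I j then 2 * r ^ 2 else 0 := by
  rw [δ, δ, ← psum_add]
  refine psum_mono fun j _ => ?_
  by_cases hl : l ∈ M.I j
  · simp only [hl, if_true, and_true, Function.update_of_ne hil]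
    by_cases hi : i ∈ M.I j
    · simp only [hi, if_true, M.g_update hi]
      have h1 := M.inner_le j u y (x l)
      have h2 := M.inner_le j u y' (x l)
      have h3 : inner ℝ (u j - (M.g j u x - M.φ j u (x i) + M.φ j u y')) (M.φ j u (x l)) =
          inner ℝ (u j - (M.g j u x - M.φ j u (x i) + M.φ j u y)) (M.φ j u (x l)) +
          inner ℝ (M.φ j u y) (M.φ j u (x l)) - inner ℝ (M.φ j u y') (M.φ j u (x l)) := by
        simp only [inner_sub_left, inner_add_left]; ring
      rw [h3]
      have := (abs_le.1 h1).2
      have := (abs_le.1 h2).1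
      linarith
    · simp [hi, M.g_update_of_notMem hi]
  · simp [hl]

/-- Sample `i` was used at most once in each of the j/T earlier epochs, each time together with m
samples counting itself. Replacing it therefore costs at most 2r² m (j/T). Its own average does not
depend on x_i. -/
theorem sum_logAvg_update_le {j : ℕ} (hj : j < E * T) {i : Fin n} (hi : i ∈ M.I ⟨j, hj⟩)
    (u : Fin (E * T) → Param d) (x : Fin n → 𝓧) (y y' : 𝓧) :
    ∑ l, M.logAvg P j l u (Function.update x i y') ≤
      ∑ l, M.logAvg P j l u (Function.update x i y) + 2 * r ^ 2 * m * (j / T : ℕ) := by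
  have h1 : ∀ l, M.logAvg P j l u (Function.update x i y') ≤
      M.logAvg P j l u (Function.update x i y) +
        psum j fun k => if i ∈ M.I k ∧ l ∈ M.I k then 2 * r ^ 2 else 0 := by
    intro l
    set c := psum j fun k => if i ∈ M.I k ∧ l ∈ M.I k then 2 * r ^ 2 else 0 with hc
    have hc0 : 0 ≤ c := by
      have := psum_mono (k := j) (f := fun _ : Fin (E * T) => (0 : ℝ))
        (g := fun k => if i ∈ M.I k ∧ l ∈ M.I k then 2 * r ^ 2 else 0)
        (fun k _ => by split_ifs <;> positivity)
      rw [hc]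
      simpa [psum] using this
    have hle : avg P l (fun x => Real.exp (M.δ j l u x)) (Function.update x i y') ≤
        avg P l (fun x => Real.exp (M.δ j l u x)) (Function.update x i y) * Real.exp c := by
      by_cases hli : l = i
      · subst hli
        simp only [avg_update]
        exact le_mul_of_one_le_right
          ((M.bddMeas_δ j l u).posBddMeas_exp.avg P l |>.pos x).le (Real.one_le_exp hc0)
      · simp only [avg]
        rw [← integral_mul_const]
        refine integral_mono ((M.bddMeas_δ j l u).exp.integrable_update P l _)
          (((M.bddMeas_δ j l u).exp.integrable_update P l _).mul_const _) fun z => ?_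
        simp only
        rw [← Real.exp_add]
        refine Real.exp_le_exp.2 ?_
        rw [Function.update_comm (Ne.symm hli), Function.update_comm (Ne.symm hli)]
        exact M.δ_update_le j hli u _ y y'
    have hpos := (M.bddMeas_δ j l u).posBddMeas_exp.avg P l
    calc M.logAvg P j l u (Function.update x i y') ≤ _ := Real.log_le_log (hpos.pos _) hle
      _ = _ := by rw [Real.log_mul (hpos.pos _).ne' (Real.exp_pos _).ne', Real.log_exp]; rfl
  refine (Finset.sum_le_sum fun l _ => h1 l).trans ?_
  rw [Finset.sum_add_distrib]
  refine add_le_add_right ?_ _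
  unfold psum
  rw [Finset.sum_comm]
  have h2 : ∀ k : Fin (E * T), ∑ l, (if k.1 < j then
      (if i ∈ M.I k ∧ l ∈ M.I k then 2 * r ^ 2 else 0) else 0) =
      if k.1 < j ∧ i ∈ M.I k then 2 * r ^ 2 * m else 0 := by
    intro k
    by_cases h1 : k.1 < j
    · by_cases h2 : i ∈ M.I k
      · simp only [h1, h2, if_true, true_and, and_self]
        rw [Finset.sum_ite_mem, Finset.univ_inter, Finset.sum_const, M.card, nsmul_eq_mul, mul_comm]
      · simp [h2]
    · simp [h1]
  simp_rw [h2]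
  rw [← Finset.sum_filter, Finset.sum_const, nsmul_eq_mul, mul_comm]
  refine mul_le_mul_of_nonneg_left ?_ (by positivity)
  norm_cast
  have h3 : (Finset.univ.filter fun k : Fin (E * T) => k.1 < j ∧ i ∈ M.I k).card ≤
      (Finset.range (j / T)).card := by
    refine Finset.card_le_card_of_injOn (fun k => k.1 / T) (fun k hk => ?_) ?_
    · simp only [Finset.coe_filter, Finset.mem_univ, true_and] at hk
      simp only [Finset.coe_range, Set.mem_Iio]
      exact M.epoch_lt k ⟨j, hj⟩ i (Fin.lt_def.2 hk.1) hk.2 hi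
    · intro k hk k' hk' h
      simp only [Finset.coe_filter, Finset.mem_univ, true_and] at hk hk'
      simp only at h
      rcases lt_trichotomy k k' with hlt | heq | hgt
      · exact absurd h (M.epoch_lt k k' i hlt hk.2 hk'.2).ne
      · exact heq
      · exact absurd h (M.epoch_lt k' k i hgt hk'.2 hk.2).ne'
  simpa using h3

/-- `logAvg` after one more step, as a function of the centred answer of that step. -/
noncomputable def logAvgStep (j : Fin (E * T)) (i : Fin n) (u : Fin (E * T) → Param d)
    (x : Fin n → 𝓧) (s : Param d) : ℝ :=
  Real.log (∫ y, Real.exp (M.δ j i u (Function.update x i y) +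
    (inner ℝ s (M.φ j u y) - ‖M.φ j u y‖ ^ 2 / 2)) ∂P i)

@[fun_prop]
theorem measurable_logAvgStep {α : Type*} [MeasurableSpace α] (j : Fin (E * T)) (i : Fin n)
    (u : Fin (E * T) → Param d) {h : α → Fin n → 𝓧} {s : α → Param d}
    (hh : Measurable h) (hs : Measurable s) :
    Measurable fun a => M.logAvgStep P j i u (h a) (s a) := by
  refine Measurable.log ?_
  have h1 : Measurable fun p : α × 𝓧 =>
      Real.exp (M.δ j i u (Function.update (h p.1) i p.2) +
        (inner ℝ (s p.1) (M.φ j u p.2) - ‖M.φ j u p.2‖ ^ 2 / 2)) := by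
    have : Measurable fun p : α × 𝓧 => Function.update (h p.1) i p.2 :=
      measurable_update'.comp ((hh.comp measurable_fst).prodMk measurable_snd)
    fun_prop
  exact (h1.stronglyMeasurable.integral_prod_right' (ν := P i)).measurable

theorem logAvgStep_update (j : Fin (E * T)) (i : Fin n) (u : Fin (E * T) → Param d)
    (x : Fin n → 𝓧) (y : 𝓧) (s : Param d) :
    M.logAvgStep P j i u (Function.update x i y) s = M.logAvgStep P j i u x s := by
  simp [logAvgStep]

/-- v - g + φ(x_i) is the answer minus the contributions of the other samples. It does not change
under resampling x_i, which makes the step an observation of φ(x_i) alone in Gaussian noise. -/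
theorem logAvg_succ_update {j : ℕ} (hj : j < E * T) (i : Fin n) (u : Fin (E * T) → Param d)
    (v : Param d) (x : Fin n → 𝓧) :
    M.logAvg P (j + 1) i (Function.update u ⟨j, hj⟩ v) x =
      if i ∈ M.I ⟨j, hj⟩ then M.logAvgStep P ⟨j, hj⟩ i u x
        (v - M.g ⟨j, hj⟩ u x + M.φ ⟨j, hj⟩ u (x i)) else M.logAvg P j i u x := by
  split_ifs with hi
  · simp only [logAvg, logAvgStep, avg, M.δ_succ_update, hi, if_true, M.g_update hi,
      Function.update_self]
    congr 2
    ext y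
    congr 2
    set φ := M.φ ⟨j, hj⟩ u y
    have : v - (M.g ⟨j, hj⟩ u x - M.φ ⟨j, hj⟩ u (x i) + φ) =
        (v - M.g ⟨j, hj⟩ u x + M.φ ⟨j, hj⟩ u (x i)) - φ := by abel
    rw [this, inner_sub_left _ φ, real_inner_self_eq_norm_sq]
    ring
  · simp only [logAvg, avg, M.δ_succ_update, hi, if_false, add_zero]

/-- Convexity: an exponential of a sum against the sum of the exponentials. -/
theorem eexp_mul_sum_le {ι : Type*} (s : Finset ι) {κ : ℝ} (hκ : 0 ≤ κ) (h1 : κ * s.card ≤ 1)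
    (a : ι → ℝ) : eexp (κ * ∑ i ∈ s, a i) ≤
      ENNReal.ofReal (1 - κ * s.card) + ENNReal.ofReal κ * ∑ i ∈ s, eexp (a i) := by
  classical
  -- The missing weight 1 - κ|s| sits on an extra point with exponent 0.
  have hj := convexOn_exp.map_sum_le (t := Finset.insertNone s)
    (w := fun o => o.elim (1 - κ * s.card) fun _ => κ) (p := fun o => o.elim 0 a)
    (fun o _ => by cases o <;> simp <;> linarith)
    (by rw [Finset.sum_insertNone]; simp; ring) (fun _ _ => Set.mem_univ _)
  rw [Finset.sum_insertNone, Finset.sum_insertNone] at hj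
  simp only [Option.elim, smul_eq_mul, mul_zero, zero_add, Real.exp_zero, mul_one,
    ← Finset.mul_sum] at hj
  refine (ENNReal.ofReal_le_ofReal hj).trans (le_of_eq ?_)
  rw [ENNReal.ofReal_add (by linarith)
    (mul_nonneg hκ (Finset.sum_nonneg fun i _ => (Real.exp_pos _).le)), ENNReal.ofReal_mul hκ,
    ENNReal.ofReal_sum_of_nonneg fun i _ => (Real.exp_pos _).le]
  rfl

/-- With the other samples frozen, the weight is a constant times e^{δ_i} Ψ, where Ψ = e^{-κ∑logAvg}
oscillates little in x_i. The one-sample bound `lintegral_inv_marginal_le` applies. -/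
theorem lintegral_logAvgStep_le {κ : ℝ} (hκ : 0 ≤ κ) {j : ℕ} (hj : j < E * T)
    (u : Fin (E * T) → Param d) {i : Fin n} (hi : i ∈ M.I ⟨j, hj⟩) :
    ∫⁻ x, eexp (M.X j u x - κ * ∑ l, M.logAvg P j l u x) *
      ∫⁻ z, eexp (M.logAvg P j i u x - M.logAvgStep P ⟨j, hj⟩ i u x (z + M.φ ⟨j, hj⟩ u (x i)))
        ∂stdGaussian (Param d) ∂Measure.pi P ≤
    ENNReal.ofReal (1 + r ^ 2 * (Real.exp (κ * (2 * r ^ 2 * m * (j / T : ℕ))) - 1)) *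
      ∫⁻ x, eexp (M.X j u x - κ * ∑ l, M.logAvg P j l u x) ∂Measure.pi P := by
  have hm1 : Measurable fun x => eexp (M.X j u x - κ * ∑ l, M.logAvg P j l u x) := by fun_prop
  have hm2 : Measurable fun x : Fin n → 𝓧 => ∫⁻ z, eexp (M.logAvg P j i u x -
      M.logAvgStep P ⟨j, hj⟩ i u x (z + M.φ ⟨j, hj⟩ u (x i))) ∂stdGaussian (Param d) :=
    Measurable.lintegral_prod_right' (f := fun p : (Fin n → 𝓧) × Param d =>
      eexp (M.logAvg P j i u p.1 -
      M.logAvgStep P ⟨j, hj⟩ i u p.1 (p.2 + M.φ ⟨j, hj⟩ u (p.1 i)))) (by fun_prop)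
  have hm3 : Measurable fun x => eexp (M.X j u x - κ * ∑ l, M.logAvg P j l u x) *
      ∫⁻ z, eexp (M.logAvg P j i u x - M.logAvgStep P ⟨j, hj⟩ i u x (z + M.φ ⟨j, hj⟩ u (x i)))
        ∂stdGaussian (Param d) := hm1.mul hm2
  rw [← lintegral_update P i hm3, ← lintegral_update P i hm1,
    ← lintegral_const_mul _ (Measurable.lintegral_prod_right'
      (f := fun p : (Fin n → 𝓧) × 𝓧 => eexp (M.X j u (Function.update p.1 i p.2) -
        κ * ∑ l, M.logAvg P j l u (Function.update p.1 i p.2))) (hm1.comp measurable_update'))]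
  refine lintegral_mono fun x => ?_
  set c := eexp (M.X j u x - M.δ j i u x) with hc
  set Ψ : 𝓧 → ℝ≥0∞ := fun y =>
    eexp (-(κ * ∑ l, M.logAvg P j l u (Function.update x i y))) with hΨ
  set a : 𝓧 → ℝ := fun y => M.δ j i u (Function.update x i y) with ha
  have haB : BddMeas a := (M.bddMeas_δ j i u).comp (measurable_update x)
  have ham := haB.meas
  have hΨm : Measurable Ψ := by
    simp only [hΨ]; fun_prop
  have h1 : ∀ y, eexp (M.X j u (Function.update x i y) -
      κ * ∑ l, M.logAvg P j l u (Function.update x i y)) = c * (eexp (a y) * Ψ y) := by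
    intro y
    rw [hc, ha, hΨ, ← M.X_sub_δ_update j i u x y, ← eexp_add, ← eexp_add]
    congr 1
    ring
  have hL0 : ∀ y, M.logAvg P j i u (Function.update x i y) =
      Real.log (∫ y, Real.exp (a y) ∂P i) := fun y => by
    rw [logAvg, avg_update]; rfl
  have hA := lintegral_inv_marginal_le (P i) haB (φ := fun y => M.φ ⟨j, hj⟩ u y) (by fun_prop)
    (M.norm_le ⟨j, hj⟩ u) hΨm (o := κ * (2 * r ^ 2 * m * (j / T : ℕ))) (by positivity)
    (fun y y' => by
      rw [hΨ, ← eexp_add]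
      refine eexp_mono ?_
      have := mul_le_mul_of_nonneg_left (M.sum_logAvg_update_le P hj hi u x y y') hκ
      linarith)
    (L := M.logAvgStep P ⟨j, hj⟩ i u x) (fun s => rfl) (by fun_prop)
  simp only [h1, hL0, logAvgStep_update, Function.update_self]
  simp only [mul_assoc c]
  rw [lintegral_const_mul' _ _ (eexp_ne_top _), lintegral_const_mul' _ _ (eexp_ne_top _),
    mul_left_comm]
  exact mul_le_mul_right hA _

/-- A step changes `logAvg` only for its m batch samples. As κm ≤ 1, convexity replaces the
exponential of the sum of these changes by a mixture of 1 and single-sample reciprocals, each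
handled by `lintegral_logAvgStep_le`. -/
theorem lintegral_eexp_X_sub_logAvg_le {κ : ℝ} (hκ : 0 ≤ κ) (hκm : κ * m ≤ 1) :
    ∫⁻ u, ∫⁻ x, eexp (M.X (E * T) u x - κ * ∑ i, M.logAvg P (E * T) i u x) ∂Measure.pi P
        ∂Measure.pi (fun _ => stdGaussian (Param d)) ≤
      ∏ j ∈ Finset.range (E * T), ENNReal.ofReal
        (1 + κ * m * (r ^ 2 * (Real.exp (κ * (2 * r ^ 2 * m * (j / T : ℕ))) - 1))) := by
  refine (lintegral_pi_le_prod (stdGaussian (Param d))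
    (fun k u => ∫⁻ x, eexp (M.X k u x - κ * ∑ i, M.logAvg P k i u x) ∂Measure.pi P)
    (fun j => ENNReal.ofReal
        (1 + κ * m * (r ^ 2 * (Real.exp (κ * (2 * r ^ 2 * m * (j / T : ℕ))) - 1))))
    (fun k => ?_) ?_ (E * T) le_rfl).trans ?_
  · exact Measurable.lintegral_prod_right' (f := fun p : (Fin (E * T) → Param d) × (Fin n → 𝓧) =>
      eexp (M.X k p.1 p.2 - κ * ∑ i, M.logAvg P k i p.1 p.2)) (by fun_prop)
  · intro j hj u
    set jj : Fin (E * T) := ⟨j, hj⟩ with hjj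
    set c := r ^ 2 * (Real.exp (κ * (2 * r ^ 2 * m * (j / T : ℕ))) - 1) with hc
    have hc0 : 0 ≤ c := by
      have : 1 ≤ Real.exp (κ * (2 * r ^ 2 * m * (j / T : ℕ))) := Real.one_le_exp (by positivity)
      exact mul_nonneg (sq_nonneg r) (by linarith)
    set H : (Fin n → 𝓧) → Param d → ℝ≥0∞ := fun x z =>
      eexp (-(κ * ∑ i, M.logAvg P j i u x)) * eexp (κ * ∑ i ∈ M.I jj,
        (M.logAvg P j i u x - M.logAvgStep P jj i u x (z + M.φ jj u (x i)))) with hH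
    have h1 : ∀ v x, eexp (M.X (j + 1) (Function.update u jj v) x -
        κ * ∑ i, M.logAvg P (j + 1) i (Function.update u jj v) x) =
        eexp (M.X (j + 1) (Function.update u jj v) x) * H x (v - M.g jj u x) := by
      intro v x
      simp only [hH]
      rw [← eexp_add, ← eexp_add]
      congr 1
      rw [sub_eq_add_neg]
      congr 1
      rw [Finset.sum_sub_distrib, ← Finset.sum_compl_add_sum (M.I jj) fun i =>
        M.logAvg P j i u x, ← Finset.sum_compl_add_sum (M.I jj)]
      have e1 : ∑ i ∈ (M.I jj)ᶜ, M.logAvg P (j + 1) i (Function.update u jj v) x =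
          ∑ i ∈ (M.I jj)ᶜ, M.logAvg P j i u x := Finset.sum_congr rfl fun i hi => by
        rw [Finset.mem_compl] at hi
        rw [hjj, M.logAvg_succ_update P hj, if_neg hi]
      have e2 : ∑ i ∈ M.I jj, M.logAvg P (j + 1) i (Function.update u jj v) x =
          ∑ i ∈ M.I jj, M.logAvgStep P jj i u x (v - M.g jj u x + M.φ jj u (x i)) :=
        Finset.sum_congr rfl fun i hi => by
          rw [hjj, M.logAvg_succ_update P hj, if_pos hi]
      rw [e1, e2]
      ring
    simp_rw [h1]
    have hs := M.lintegral_step (Measure.pi P) (π := fun x => x) measurable_id (H := H)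
      (by fun_prop) hj u
    rw [hs]
    have hHle : ∀ x, eexp (M.X j u x) * ∫⁻ z, H x z ∂stdGaussian (Param d) ≤
        ENNReal.ofReal (1 - κ * m) * eexp (M.X j u x - κ * ∑ l, M.logAvg P j l u x) +
        ENNReal.ofReal κ * ∑ i ∈ M.I jj, eexp (M.X j u x - κ * ∑ l, M.logAvg P j l u x) *
          ∫⁻ z, eexp (M.logAvg P j i u x - M.logAvgStep P jj i u x (z + M.φ jj u (x i)))
            ∂stdGaussian (Param d) := by
      intro x
      have h2 : ∫⁻ z, H x z ∂stdGaussian (Param d) ≤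
          ∫⁻ z, eexp (-(κ * ∑ i, M.logAvg P j i u x)) * (ENNReal.ofReal (1 - κ * m) +
            ENNReal.ofReal κ * ∑ i ∈ M.I jj, eexp (M.logAvg P j i u x -
              M.logAvgStep P jj i u x (z + M.φ jj u (x i)))) ∂stdGaussian (Param d) := by
        refine lintegral_mono fun z => mul_le_mul_right ?_ _
        have := eexp_mul_sum_le (M.I jj) hκ (by rwa [M.card]) fun i =>
          M.logAvg P j i u x - M.logAvgStep P jj i u x (z + M.φ jj u (x i))
        rwa [M.card] at this
      refine (mul_le_mul_right h2 _).trans (le_of_eq ?_)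
      rw [lintegral_const_mul _ (by fun_prop), lintegral_add_left (by fun_prop),
        lintegral_const_mul _ (by fun_prop), lintegral_finsetSum _ fun i _ => by fun_prop,
        sub_eq_add_neg (M.X j u x), eexp_add, ← Finset.mul_sum]
      simp only [lintegral_const, measure_univ, mul_one]
      ring
    refine (lintegral_mono hHle).trans ?_
    have hm1 : Measurable fun x => eexp (M.X j u x - κ * ∑ l, M.logAvg P j l u x) := by fun_prop
    have hm2 : ∀ i, Measurable fun x : Fin n → 𝓧 => ∫⁻ z, eexp (M.logAvg P j i u x -
      M.logAvgStep P jj i u x (z + M.φ jj u (x i))) ∂stdGaussian (Param d) := fun i =>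
      Measurable.lintegral_prod_right' (f := fun p : (Fin n → 𝓧) × Param d =>
        eexp (M.logAvg P j i u p.1 -
        M.logAvgStep P jj i u p.1 (p.2 + M.φ jj u (p.1 i)))) (by fun_prop)
    have hm3 : ∀ i, Measurable fun x => eexp (M.X j u x - κ * ∑ l, M.logAvg P j l u x) *
      ∫⁻ z, eexp (M.logAvg P j i u x - M.logAvgStep P jj i u x (z + M.φ jj u (x i)))
        ∂stdGaussian (Param d) := fun i => hm1.mul (hm2 i)
    rw [lintegral_add_left (by fun_prop), lintegral_const_mul _ hm1,
      lintegral_const_mul _ (Finset.measurable_sum _ fun i _ => hm3 i),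
      lintegral_finsetSum _ fun i _ => hm3 i]
    set J := ∫⁻ x, eexp (M.X j u x - κ * ∑ l, M.logAvg P j l u x) ∂Measure.pi P
    calc _ ≤ ENNReal.ofReal (1 - κ * m) * J + ENNReal.ofReal κ *
          ∑ i ∈ M.I jj, ENNReal.ofReal (1 + c) * J := by
          gcongr with i hi
          exact M.lintegral_logAvgStep_le P hκ hj u hi
      _ = ENNReal.ofReal (1 + κ * m * c) * J := by
          rw [Finset.sum_const, M.card, nsmul_eq_mul, ← mul_assoc, ← mul_assoc, ← add_mul,
            ← ENNReal.ofReal_natCast, ← ENNReal.ofReal_mul hκ,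
            ← ENNReal.ofReal_mul (by positivity),
            ← ENNReal.ofReal_add (by linarith) (by positivity)]
          congr 2
          ring
  · simp [X, logAvg, avg, δ]

end AdaptiveQueries

/-! ### Real inequalities comparing both regimes with F. -/

section RealInequalities

/-- The tangent to e^{4·} at s lies below the exponential at b, so e^{4s} ≤ e^{4b}/(1 + 4(b - s)).
Taking b = 0, 1/4, 1/2, 3/4 on successive subintervals leaves polynomial inequalities, with e^{4b}
an integer power of e. -/
theorem exp_four_mul_mul_le {s : ℝ} (h0 : 0 ≤ s) (h1 : s < 1) :
    Real.exp (4 * s) * (1 - s) ≤ 1 + 8 * s := by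
  have he := Real.exp_one_lt_d9
  have hp := Real.exp_pos (4 * s)
  have hb : ∀ b : ℝ, Real.exp (4 * s) * (1 + 4 * (b - s)) ≤ Real.exp (4 * b) := by
    intro b
    have h2 := Real.add_one_le_exp (4 * (b - s))
    have h3 : Real.exp (4 * b) = Real.exp (4 * s) * Real.exp (4 * (b - s)) := by
      rw [← Real.exp_add]; congr 1; ring
    rw [h3]
    exact mul_le_mul_of_nonneg_left (by linarith) hp.le
  have aux : ∀ b c : ℝ, Real.exp (4 * b) ≤ c → 0 < 1 + 4 * (b - s) →
      c * (1 - s) ≤ (1 + 8 * s) * (1 + 4 * (b - s)) → Real.exp (4 * s) * (1 - s) ≤ 1 + 8 * s := by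
    intro b c h2 h3 h4
    have h5 := (hb b).trans h2
    have h6 := mul_le_mul_of_nonneg_right h5 (by linarith : 0 ≤ 1 - s)
    refine le_of_mul_le_mul_right ?_ h3
    nlinarith
  have hexp : ∀ k : ℕ, Real.exp (4 * (k / 4)) ≤ 2.7182818286 ^ k := by
    intro k
    have : Real.exp (4 * (k / 4)) = Real.exp 1 ^ k := by
      rw [← Real.exp_nat_mul]; congr 1; ring
    rw [this]
    exact pow_le_pow_left₀ (Real.exp_pos _).le he.le k
  rcases le_total s 0.15 with h | h
  · refine aux 0 1 (by simp) (by linarith) (by nlinarith)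
  rcases le_total s 0.25 with h' | h'
  · refine aux _ _ (hexp 1) (by push_cast; linarith) (by push_cast; nlinarith)
  rcases le_total s 0.6 with h'' | h''
  · refine aux _ _ (hexp 2) (by push_cast; linarith) (by push_cast; nlinarith)
  · refine aux _ _ (hexp 3) (by push_cast; linarith) (by push_cast; nlinarith)

theorem expoF_eq (ν l : ℝ) : expoF ν ((l + l ^ 2) / 2) =
    (4 * (ν * (l + l ^ 2)) ^ 2 + ν * (l + l ^ 2) / 2) / (1 - ν * (l + l ^ 2)) := by
  rw [expoF]; congr 1 <;> ring

/-- In the variable t = ν(l + l²), F is (4t² + t/2)/(1 - t), which is increasing. The left side is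
its value at s ≤ t, split into linear and quadratic parts; the coefficient 9/2 is the budget for all
second order terms. -/
theorem le_expoF {ν l s : ℝ} (hs0 : 0 ≤ s) (hs : s ≤ ν * (l + l ^ 2))
    (hlt : ν * (l + l ^ 2) < 1) :
    s / 2 + 9 / 2 * (s ^ 2 / (1 - s)) ≤ expoF ν ((l + l ^ 2) / 2) := by
  rw [expoF_eq]
  set t := ν * (l + l ^ 2)
  have h1 : s / 2 + 9 / 2 * (s ^ 2 / (1 - s)) = (4 * s ^ 2 + s / 2) / (1 - s) := by
    have : 1 - s ≠ 0 := by linarith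
    field_simp; ring
  rw [h1]
  have ht : 0 ≤ t := hs0.trans hs
  exact div_le_div₀ (by positivity) (by gcongr) (by linarith) (by linarith)

/-- The numerical estimate when few samples per batch are relevant: `κ m` is small. -/
theorem smallBatch_numeric {ν l s q b : ℝ} (hs0 : 0 ≤ s) (hs : s ≤ ν * (l + l ^ 2))
    (hlt : ν * (l + l ^ 2) < 1) (hb : b ≤ q / 2) :
    s / 2 + b * s + s / 2 * (Real.exp (4 * s) - 1) ≤ q * s / 2 + expoF ν ((l + l ^ 2) / 2) := by
  have h1 := le_expoF hs0 hs hlt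
  have h2 := exp_four_mul_mul_le hs0 (hs.trans_lt hlt)
  have h3 : 0 < 1 - s := by linarith
  have h4 : Real.exp (4 * s) - 1 ≤ 9 * (s / (1 - s)) := by
    rw [← mul_div_assoc, le_div_iff₀ h3]; linarith
  have h5 : s / 2 * (Real.exp (4 * s) - 1) ≤ 9 / 2 * (s ^ 2 / (1 - s)) := by
    have := mul_le_mul_of_nonneg_left h4 (by linarith : 0 ≤ s / 2)
    refine this.trans (le_of_eq ?_)
    ring
  nlinarith [mul_le_mul_of_nonneg_right hb hs0]

theorem neg_log_one_sub_le {y : ℝ} (h0 : 0 ≤ y) (h1 : y < 1) :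
    -Real.log (1 - y) ≤ y + y ^ 2 / (2 * (1 - y)) := by
  have h2 : ∀ x ∈ Set.Ico (0 : ℝ) 1, HasDerivAt
      (fun x : ℝ => x + x ^ 2 / (2 * (1 - x)) + Real.log (1 - x)) (x ^ 2 / (2 * (1 - x) ^ 2)) x := by
    intro x hx
    have hx1 : 1 - x ≠ 0 := by have := hx.2; linarith
    have e1 : HasDerivAt (fun x : ℝ => 1 - x) (-1) x := by
      simpa using (hasDerivAt_id x).const_sub 1
    have e2 : HasDerivAt (fun x : ℝ => 2 * (1 - x)) (2 * -1) x := e1.const_mul 2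
    have e3 := ((hasDerivAt_id x).add ((hasDerivAt_pow 2 x).div e2 (by simpa using hx1))).add
      (e1.log hx1)
    refine e3.congr_deriv ?_
    field_simp
    push_cast
    ring
  have hm : MonotoneOn (fun x : ℝ => x + x ^ 2 / (2 * (1 - x)) + Real.log (1 - x))
      (Set.Ico 0 1) := by
    refine monotoneOn_of_deriv_nonneg (convex_Ico 0 1)
      (fun x hx => (h2 x hx).continuousAt.continuousWithinAt)
      (fun x hx => (h2 x (interior_subset hx)).differentiableAt.differentiableWithinAt)
      fun x hx => ?_
    rw [(h2 x (interior_subset hx)).deriv]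
    positivity
  have := hm ⟨le_rfl, one_pos⟩ ⟨h0, h1⟩ h0
  simp at this
  linarith

/-- The numerical estimate when many samples per batch are relevant: `κ m` is large. -/
theorem largeBatch_numeric {ν l s q b : ℝ} (hs0 : 0 < s) (hs : s ≤ ν * (l + l ^ 2))
    (hlt : ν * (l + l ^ 2) < 1) (hq0 : 0 < q) (hq1 : q < 1) (hb1 : q / 2 ≤ b)
    (hb2 : (1 - q) / (2 * q ^ 2) ≤ b) :
    -(Real.log (1 - s * (1 + (1 - s) * q))) / 2 +
      11 / 24 * (s * (s / b)) * (1 + 1 / ((1 - s) * q)) ≤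
      q * s / 2 + expoF ν ((l + l ^ 2) / 2) := by
  have h1 := le_expoF hs0.le hs hlt
  have hs1 : 0 < 1 - s := by linarith
  have hsq : 0 < 1 - s * q := by nlinarith
  have hb0 : 0 < b := lt_of_lt_of_le (by positivity) hb1
  -- This factorization is the reason for the choice η = (1 - s)q in the Young inequality behind the
  -- left side.
  have h2 : 1 - s * (1 + (1 - s) * q) = (1 - s) * (1 - s * q) := by ring
  rw [h2, Real.log_mul hs1.ne' hsq.ne']
  have h3 := neg_log_one_sub_le hs0.le (by linarith : s < 1)
  have h4 := neg_log_one_sub_le (mul_pos hs0 hq0).le (by linarith : s * q < 1)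
  set A := s ^ 2 / (1 - s) with hA
  have hA0 : 0 < A := by positivity
  have h3' : s ^ 2 / (2 * (1 - s)) = A / 2 := by rw [hA]; field_simp
  have h4' : (s * q) ^ 2 / (2 * (1 - s * q)) ≤ A / 2 := by
    rw [← h3']
    apply div_le_div₀ (by positivity) _ (by positivity) (by nlinarith)
    rw [mul_pow]
    exact mul_le_of_le_one_right (by positivity) (by nlinarith)
  -- The two lower bounds on b serve small and large q, with 0.65 a convenient crossover. The value
  -- 8 suffices: the quadratic terms add up to (1/2 + 11/24 · 8)A = 25/6 · A ≤ 9/2 · A.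
  have h5 : (1 + q) / (q * b) ≤ 8 := by
    rw [div_le_iff₀ (by positivity)]
    rcases le_total q 0.65 with h | h
    · have h6 : (1 - q) ≤ b * (2 * q ^ 2) := by
        rwa [div_le_iff₀ (by positivity)] at hb2
      have h7 : q * ((1 + q)) ≤ q * (8 * (q * b)) := by nlinarith
      exact le_of_mul_le_mul_left h7 hq0
    · nlinarith [mul_le_mul_of_nonneg_left hb1 hq0.le]
  have h6 : s * (s / b) * (1 + 1 / ((1 - s) * q)) ≤ A * ((1 + q) / (q * b)) := by
    have : A * ((1 + q) / (q * b)) = s * (s / b) * ((1 + 1 / q) / (1 - s)) := by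
      rw [hA]; field_simp; ring
    rw [this]
    refine mul_le_mul_of_nonneg_left ?_ (by positivity)
    rw [le_div_iff₀ hs1]
    have : (1 + 1 / ((1 - s) * q)) * (1 - s) = (1 - s) + 1 / q := by field_simp
    rw [this]
    linarith
  have h7 := h6.trans (mul_le_mul_of_nonneg_left h5 hA0.le)
  rw [h3'] at h3
  have h8 : -(Real.log (1 - s) + Real.log (1 - s * q)) / 2 ≤ s / 2 + s * q / 2 + A / 2 := by
    linarith
  nlinarith

end RealInequalities

/-! ### Moment bounds for two or more epochs. -/

theorem sum_range_mul_div (E T : ℕ) (f : ℕ → ℝ) :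
    ∑ j ∈ Finset.range (E * T), f (j / T) = T * ∑ e ∈ Finset.range E, f e := by
  rcases Nat.eq_zero_or_pos T with rfl | hT
  · simp
  induction E with
  | zero => simp
  | succ E ih =>
    rw [Nat.succ_mul, Finset.sum_range_add, ih, Finset.sum_range_succ, mul_add]
    congr 1
    rw [Finset.sum_congr rfl fun x hx => ?_, Finset.sum_const, Finset.card_range, nsmul_eq_mul]
    rw [Finset.mem_range] at hx
    rw [Nat.mul_comm E T, Nat.mul_add_div hT, Nat.div_eq_of_lt hx, add_zero]

/-- Consequence of the Herbst argument for the normalized moment of order `1 + α`. -/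
theorem lintegral_eexp_moment_le {Ω : Type*} [MeasurableSpace Ω] {X D : Ω → ℝ} (hX : BddMeas X)
    (hD : BddMeas D) (μ : Measure Ω) [IsProbabilityMeasure μ] {α k : ℝ} (hα : 0 < α)
    (hk : 2 * k = α + 2 * α ^ 2)
    (hent : ∀ r : ℝ, 1 ≤ r → r ≤ 1 + α →
      ∫ x, Real.exp (r * X x) * (r * X x - Real.log (∫ x, Real.exp (r * X x) ∂μ)) ∂μ ≤
        r ^ 2 / 2 * ∫ x, Real.exp (r * X x) * D x ∂μ) :
    ∫⁻ x, eexp ((1 + α) * X x - α * Real.log (∫ x, Real.exp (X x) ∂μ)) ∂μ ≤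
      ∫⁻ x, eexp (X x + k * D x) ∂μ := by
  have h := integral_exp_le_of_entropy_le hX hD μ hα hk hent
  rw [lintegral_eexp_eq (hX.add (hD.const_mul k)) μ]
  simp_rw [sub_eq_add_neg, eexp_add]
  rw [lintegral_mul_const' _ _ (eexp_ne_top _),
    lintegral_eexp_eq (hX.const_mul _) μ, ← eexp_add]
  refine eexp_mono ?_
  linarith

theorem exp_integral_le {Ω : Type*} [MeasurableSpace Ω] {f : Ω → ℝ} (hf : BddMeas f)
    (μ : Measure Ω) [IsProbabilityMeasure μ] :
    eexp (∫ x, f x ∂μ) ≤ ∫⁻ x, eexp (f x) ∂μ := by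
  rw [lintegral_eexp_eq hf μ]
  refine eexp_mono ?_
  rw [Real.le_log_iff_exp_le (hf.posBddMeas_exp.integral_pos μ)]
  exact convexOn_exp.map_integral_le Real.continuous_exp.continuousOn isClosed_univ
    (ae_of_all _ fun _ => Set.mem_univ _) (hf.integrable μ) (hf.exp.integrable μ)

/-- The exponential lies below its chord from 0 to `o`. -/
theorem exp_mul_sub_one_le_mul {o x : ℝ} (hx0 : 0 ≤ x) (hx1 : x ≤ 1) :
    Real.exp (o * x) - 1 ≤ x * (Real.exp o - 1) := by
  have h := convexOn_exp.2 (Set.mem_univ 0) (Set.mem_univ o) (by linarith : 0 ≤ 1 - x) hx0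
    (by ring)
  simp only [smul_eq_mul, mul_zero, zero_add, Real.exp_zero, mul_one] at h
  rw [mul_comm o]
  linarith

namespace AdaptiveQueries

variable {𝓧 : Type*} [MeasurableSpace 𝓧] {d n m T E : ℕ} {r : ℝ}
variable (M : AdaptiveQueries 𝓧 d n m T E r)
variable (P : Fin n → Measure 𝓧) [∀ i, IsProbabilityMeasure (P i)]

theorem log_avg_exp_X (k : ℕ) (i : Fin n) (u : Fin (E * T) → Param d) (x : Fin n → 𝓧) :
    Real.log (avg P i (fun x => Real.exp (M.X k u x)) x) =
      M.X k u x - M.δ k i u x + M.logAvg P k i u x := by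
  rw [avg_exp_eq P i (M.X_sub_δ_update k i u), Real.log_mul (Real.exp_pos _).ne'
    ((M.bddMeas_δ k i u).posBddMeas_exp.avg P i |>.pos x).ne', Real.log_exp]
  rfl

/-- Moment bound through the Cauchy-Schwarz inequality, good for small batches. -/
theorem lintegral_moment_le_of_small (hE : 0 < E) {α κ : ℝ} (hα : 0 < α)
    (hκ : κ = α + 2 * α ^ 2) (hκm : 2 * κ * m ≤ 1) :
    ∫⁻ u, ∫⁻ x, eexp ((1 + α) * M.X (E * T) u x -
        α * Real.log (∫ x, Real.exp (M.X (E * T) u x) ∂Measure.pi P)) ∂Measure.pi P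
        ∂Measure.pi (fun _ => stdGaussian (Param d)) ≤
      eexp (T * (κ * (m * r ^ 2) * E / 2 + κ * m * (κ * (m * r ^ 2) * E) +
        κ * (m * r ^ 2) * E / 2 * (Real.exp (4 * (κ * (m * r ^ 2) * E)) - 1))) := by
  set s := κ * (m * r ^ 2) * E with hs
  have hκ0 : 0 ≤ κ := by rw [hκ]; positivity
  set γ := Measure.pi (fun _ : Fin (E * T) => stdGaussian (Param d))
  -- Here kD = κ∑(δ_i - logAvg_i). Half of X goes to each of the two parts, so that F² and G² are
  -- again integrals against the density e^X.
  set F : (Fin (E * T) → Param d) × (Fin n → 𝓧) → ℝ≥0∞ := fun p =>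
    eexp ((M.X (E * T) p.1 p.2 + 2 * κ * ∑ i, M.δ (E * T) i p.1 p.2) / 2) with hF
  set G : (Fin (E * T) → Param d) × (Fin n → 𝓧) → ℝ≥0∞ := fun p =>
    eexp ((M.X (E * T) p.1 p.2 - 2 * κ * ∑ i, M.logAvg P (E * T) i p.1 p.2) / 2) with hG
  have hFm : Measurable F := by simp only [hF]; fun_prop
  have hGm : Measurable G := by simp only [hG]; fun_prop
  have h1 : ∀ u, ∫⁻ x, eexp ((1 + α) * M.X (E * T) u x -
      α * Real.log (∫ x, Real.exp (M.X (E * T) u x) ∂Measure.pi P)) ∂Measure.pi P ≤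
      ∫⁻ x, (F * G) (u, x) ∂Measure.pi P := by
    intro u
    have hX := M.bddMeas_X (E * T) u
    have hD : BddMeas fun x => 2 * ∑ i, (M.X (E * T) u x -
        Real.log (avg P i (fun x => Real.exp (M.X (E * T) u x)) x)) :=
      (BddMeas.sum _ fun i _ => hX.sub (hX.posBddMeas_exp.avg P i).log).const_mul 2
    refine (lintegral_eexp_moment_le hX hD (Measure.pi P) hα (k := κ / 2) (by linarith)
      fun t ht _ => entropy_exp_le_log_avg P hX ht).trans (le_of_eq ?_)
    congr 1
    ext x
    simp only [Pi.mul_apply, hF, hG, M.log_avg_exp_X P, ← eexp_add]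
    congr 1
    have : ∀ i, M.X (E * T) u x - (M.X (E * T) u x - M.δ (E * T) i u x +
        M.logAvg P (E * T) i u x) = M.δ (E * T) i u x - M.logAvg P (E * T) i u x := fun i => by ring
    simp only [this, Finset.sum_sub_distrib]
    ring
  refine (lintegral_mono h1).trans ?_
  rw [← lintegral_prod _ (hFm.mul hGm).aemeasurable]
  refine (ENNReal.lintegral_mul_le_Lp_mul_Lq _ Real.HolderConjugate.two_two hFm.aemeasurable
    hGm.aemeasurable).trans ?_
  have hF2 : ∫⁻ p, F p ^ (2 : ℝ) ∂(γ.prod (Measure.pi P)) ≤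
      eexp (T * (2 * (s / 2 + κ * m * s))) := by
    rw [lintegral_prod _ (hFm.pow_const _).aemeasurable]
    have h2 := M.lintegral_eexp_X_add_δ_le P (2 * κ) (by positivity) (E * T) le_rfl
    refine (le_of_eq ?_).trans (h2.trans (eexp_mono (le_of_eq ?_)))
    · simp only [hF, eexp_rpow, mul_div_cancel₀ _ (two_ne_zero (α := ℝ))]
      rfl
    · rw [hs]; push_cast; ring
  have hG2 : ∫⁻ p, G p ^ (2 : ℝ) ∂(γ.prod (Measure.pi P)) ≤
      eexp (T * (2 * (s / 2 * (Real.exp (4 * s) - 1)))) := by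
    rw [lintegral_prod _ (hGm.pow_const _).aemeasurable]
    have h2 := M.lintegral_eexp_X_sub_logAvg_le P (κ := 2 * κ) (by positivity) hκm
    refine (le_of_eq ?_).trans (h2.trans ?_)
    · simp only [hG, eexp_rpow, mul_div_cancel₀ _ (two_ne_zero (α := ℝ))]
      rfl
    · refine (Finset.prod_le_prod' (g := fun j => eexp (2 * κ * m *
        (r ^ 2 * (Real.exp (4 * s * ((j / T : ℕ) / E)) - 1)))) fun j _ => ?_).trans ?_
      · refine ENNReal.ofReal_le_ofReal ?_
        rw [add_comm]
        refine (Real.add_one_le_exp _).trans (Real.exp_le_exp.2 (le_of_eq ?_))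
        congr 4
        rw [hs]
        have : (E : ℝ) ≠ 0 := by positivity
        field_simp
        ring
      · rw [← eexp_sum, sum_range_mul_div E T fun e => 2 * κ * m *
          (r ^ 2 * (Real.exp (4 * s * ((e : ℕ) / E)) - 1))]
        refine eexp_mono (mul_le_mul_of_nonneg_left ?_ (Nat.cast_nonneg _))
        have hE' : (0 : ℝ) < E := by exact_mod_cast hE
        have h3 : ∀ e ∈ Finset.range E, 2 * κ * m * (r ^ 2 *
            (Real.exp (4 * s * ((e : ℕ) / E)) - 1)) ≤
            2 * κ * m * (r ^ 2 * ((e : ℝ) / E * (Real.exp (4 * s) - 1))) := by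
          intro e he
          have he' : (e : ℝ) ≤ E := by exact_mod_cast (Finset.mem_range.1 he).le
          have := exp_mul_sub_one_le_mul (o := 4 * s) (x := e / E) (by positivity)
            ((div_le_one hE').2 he')
          gcongr
        refine (Finset.sum_le_sum h3).trans ?_
        rw [← Finset.mul_sum, ← Finset.mul_sum, ← Finset.sum_mul, ← Finset.sum_div]
        -- The chord bound makes the loss linear in the epoch number e, and its sum over the epochs
        -- yields the factor E/2.
        have h4 : ∑ e ∈ Finset.range E, (e : ℝ) ≤ E ^ 2 / 2 := by
          have h5 := Finset.sum_range_id_mul_two E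
          have h6 := congrArg (Nat.cast : ℕ → ℝ) h5
          rw [Nat.cast_mul, Nat.cast_sum, Nat.cast_mul, Nat.cast_sub hE] at h6
          push_cast at h6
          nlinarith
        have h5 : 0 ≤ Real.exp (4 * s) - 1 := by
          have : 1 ≤ Real.exp (4 * s) := Real.one_le_exp (by positivity)
          linarith
        have h7 : (∑ e ∈ Finset.range E, (e : ℝ)) / E ≤ E / 2 := by
          rw [div_le_iff₀ hE']; nlinarith
        calc 2 * κ * m * (r ^ 2 * ((∑ e ∈ Finset.range E, (e : ℝ)) / E * (Real.exp (4 * s) - 1)))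
            ≤ 2 * κ * m * (r ^ 2 * (E / 2 * (Real.exp (4 * s) - 1))) := by gcongr
          _ = _ := by rw [hs]; ring
  refine (mul_le_mul' (ENNReal.rpow_le_rpow hF2 (by norm_num))
    (ENNReal.rpow_le_rpow hG2 (by norm_num))).trans (le_of_eq ?_)
  rw [eexp_rpow, eexp_rpow, ← eexp_add]
  congr 1
  ring

/-- Number of steps that use sample `i`. -/
noncomputable def uses (i : Fin n) : ℝ := ∑ l : Fin (E * T), if i ∈ M.I l then (1 : ℝ) else 0

theorem uses_nonneg (i : Fin n) : 0 ≤ M.uses i :=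
  Finset.sum_nonneg fun l _ => by split_ifs <;> norm_num

theorem uses_le (i : Fin n) : M.uses i ≤ E := by
  unfold uses
  rw [← Finset.sum_filter, Finset.sum_const, nsmul_eq_mul, mul_one]
  norm_cast
  have h : (Finset.univ.filter fun l : Fin (E * T) => i ∈ M.I l).card ≤
      (Finset.range E).card := by
    refine Finset.card_le_card_of_injOn (fun l => l.1 / T) (fun l hl => ?_) ?_
    · simp only [Finset.coe_range, Set.mem_Iio]
      exact Nat.div_lt_of_lt_mul (l.2.trans_eq (mul_comm _ _))
    · intro k hk k' hk' h
      simp only [Finset.coe_filter, Finset.mem_univ, true_and] at hk hk'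
      simp only at h
      rcases lt_trichotomy k k' with hlt | heq | hgt
      · exact absurd h (M.epoch_lt k k' i hlt hk hk').ne
      · exact heq
      · exact absurd h (M.epoch_lt k' k i hgt hk' hk).ne'
  simpa using h

theorem sum_uses : ∑ i, M.uses i = E * T * m := by
  unfold uses
  rw [Finset.sum_comm]
  have h : ∀ l : Fin (E * T), ∑ i, (if i ∈ M.I l then (1 : ℝ) else 0) = m := fun l => by
    rw [Finset.sum_ite_mem, Finset.univ_inter, Finset.sum_const, M.card, nsmul_eq_mul, mul_one]
  simp_rw [h]
  simp

/-- Putting x'_i in place of x_i alters the residual u - g too. Each use contributes ⟨φ(x_i),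
φ(x'_i)⟩ - ‖φ(x'_i)‖²/2, hence the constant 1 + 1/2. -/
theorem abs_δ_update_sub_corr_le (i : Fin n) (u : Fin (E * T) → Param d) (x x' : Fin n → 𝓧) :
    |M.δ (E * T) i u (Function.update x i (x' i)) - M.corr (E * T) i u x x'| ≤
      3 / 2 * r ^ 2 * M.uses i := by
  rw [δ, corr, ← psum_sub, uses, Finset.mul_sum]
  refine (abs_psum_le _ _).trans ?_
  rw [psum_full]
  refine Finset.sum_le_sum fun l _ => ?_
  by_cases hi : i ∈ M.I l
  · simp only [hi, if_true, Function.update_self, M.g_update hi, mul_one]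
    have h1 := abs_le.1 (M.inner_le l u (x i) (x' i))
    have h2 := M.norm_sq_le l u (x' i)
    have h3 : inner ℝ (u l - (M.g l u x - M.φ l u (x i) + M.φ l u (x' i))) (M.φ l u (x' i)) +
        ‖M.φ l u (x' i)‖ ^ 2 / 2 - inner ℝ (u l - M.g l u x) (M.φ l u (x' i)) =
        inner ℝ (M.φ l u (x i)) (M.φ l u (x' i)) - ‖M.φ l u (x' i)‖ ^ 2 / 2 := by
      simp only [inner_sub_left, inner_add_left, real_inner_self_eq_norm_sq]; ring
    rw [h3, abs_le]
    constructor <;> nlinarith [sq_nonneg ‖M.φ l u (x' i)‖]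
  · simp [hi]

theorem abs_δ_sub_corr_le (i : Fin n) (u : Fin (E * T) → Param d) (x : Fin n → 𝓧) :
    |M.δ (E * T) i u x - M.corr (E * T) i u x x| ≤ 1 / 2 * r ^ 2 * M.uses i := by
  rw [δ, corr, ← psum_sub, uses, Finset.mul_sum]
  refine (abs_psum_le _ _).trans ?_
  rw [psum_full]
  refine Finset.sum_le_sum fun l _ => ?_
  by_cases hi : i ∈ M.I l
  · simp only [hi, if_true, add_sub_cancel_left, mul_one]
    rw [abs_of_nonneg (by positivity)]
    linarith [M.norm_sq_le l u (x i)]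
  · simp [hi]

theorem sq_le_of_abs_sub_le {a b c η : ℝ} (hη : 0 < η) (h : |a - b| ≤ c) :
    a ^ 2 ≤ (1 + η) * b ^ 2 + (1 + 1 / η) * c ^ 2 := by
  have h1 : (a - b) ^ 2 ≤ c ^ 2 := by
    rw [← sq_abs]; exact pow_le_pow_left₀ (abs_nonneg _) h 2
  have h2 : a ^ 2 ≤ (1 + η) * b ^ 2 + (1 + 1 / η) * (a - b) ^ 2 := by
    have h3 : (1 + η) * b ^ 2 + (1 + 1 / η) * (a - b) ^ 2 - a ^ 2 =
        (η * b - (a - b)) ^ 2 / η := by field_simp; ring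
    have : 0 ≤ (η * b - (a - b)) ^ 2 / η := by positivity
    linarith
  have h4 : 0 ≤ 1 + 1 / η := by positivity
  nlinarith [mul_le_mul_of_nonneg_left h1 h4]

/-- Young's inequality with parameter η trades δ for the Gaussian correlation. The errors combine to
2/3 · (1/2)² + 1/3 · (3/2)² = 11/12, and ∑ uses² ≤ E ∑ uses. -/
theorem sum_δ_sq_le (u : Fin (E * T) → Param d) (x x' : Fin n → 𝓧) {η : ℝ} (hη : 0 < η) :
    ∑ i, (2 / 3 * M.δ (E * T) i u x ^ 2 +
        1 / 3 * M.δ (E * T) i u (Function.update x i (x' i)) ^ 2) ≤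
      (1 + η) * ∑ i, M.corrSq (E * T) i u x x' +
        (1 + 1 / η) * (11 / 12 * (r ^ 4 * (E * (E * T * m)))) := by
  have h1 : ∀ i, 2 / 3 * M.δ (E * T) i u x ^ 2 +
        1 / 3 * M.δ (E * T) i u (Function.update x i (x' i)) ^ 2 ≤
      (1 + η) * M.corrSq (E * T) i u x x' +
        (1 + 1 / η) * (11 / 12 * (r ^ 4 * (E * M.uses i))) := by
    intro i
    have h2 := sq_le_of_abs_sub_le hη (M.abs_δ_sub_corr_le i u x)
    have h3 := sq_le_of_abs_sub_le hη (M.abs_δ_update_sub_corr_le i u x x')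
    have h4 : (1 + 1 / η) * (11 / 12 * (r ^ 4 * M.uses i ^ 2)) ≤
        (1 + 1 / η) * (11 / 12 * (r ^ 4 * (E * M.uses i))) := by
      have := mul_le_mul_of_nonneg_right (M.uses_le i) (M.uses_nonneg i)
      rw [pow_two]
      gcongr
    have h5 : (1 + 1 / η) * (11 / 12 * (r ^ 4 * M.uses i ^ 2)) =
      2 / 3 * ((1 + 1 / η) * (1 / 2 * r ^ 2 * M.uses i) ^ 2) +
        1 / 3 * ((1 + 1 / η) * (3 / 2 * r ^ 2 * M.uses i) ^ 2) := by ring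
    rw [corrSq]
    linarith
  refine (Finset.sum_le_sum fun i _ => h1 i).trans (le_of_eq ?_)
  rw [Finset.sum_add_distrib, ← Finset.mul_sum, ← Finset.mul_sum, ← Finset.mul_sum,
    ← Finset.mul_sum, ← Finset.mul_sum, M.sum_uses]

theorem avg_eq_integral (i : Fin n) {F : (Fin n → 𝓧) → ℝ} (hF : BddMeas F) (x : Fin n → 𝓧) :
    avg P i F x = ∫ x', F (Function.update x i (x' i)) ∂Measure.pi P := by
  have h := measurePreserving_eval P i
  have hm : AEStronglyMeasurable (fun y => F (Function.update x i y))
      (Measure.map (Function.eval i) (Measure.pi P)) :=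
    (hF.meas.comp (measurable_update x)).aestronglyMeasurable
  have := integral_map h.measurable.aemeasurable hm
  rw [h.map_eq] at this
  exact this

/-- Moment bound through a second order entropy estimate, good for large batches. -/
theorem lintegral_moment_le_of_large (hE : 0 < E) (hm : 0 < m) (hr : 0 < r) {α κ η : ℝ}
    (hα : 0 < α) (hκ : κ = α + 2 * α ^ 2) (hη : 0 < η)
    (hlt : κ * (m * r ^ 2) * E * (1 + η) < 1) :
    ∫⁻ u, ∫⁻ x, eexp ((1 + α) * M.X (E * T) u x -
        α * Real.log (∫ x, Real.exp (M.X (E * T) u x) ∂Measure.pi P)) ∂Measure.pi P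
        ∂Measure.pi (fun _ => stdGaussian (Param d)) ≤
      eexp (T * (-(Real.log (1 - κ * (m * r ^ 2) * E * (1 + η))) / 2 +
        11 / 24 * (κ * (m * r ^ 2) * E * (E * r ^ 2)) * (1 + 1 / η))) := by
  set s := κ * (m * r ^ 2) * E with hs
  have hκ0 : 0 < κ := by rw [hκ]; positivity
  have hE' : (0 : ℝ) < E := by exact_mod_cast hE
  have hm' : (0 : ℝ) < m := by exact_mod_cast hm
  set c := κ / 2 * ((1 + 1 / η) * (11 / 12 * (r ^ 4 * (E * (E * T * m))))) with hc
  set k := κ / 2 * (1 + η) with hk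
  have hk0 : 0 < k := by positivity
  have h2kE : 2 * (m * r ^ 2) * E * k < 1 := by
    have : 2 * (m * r ^ 2) * E * k = s * (1 + η) := by rw [hk, hs]; ring
    rwa [this]
  -- Taking reciprocals linearizes the recursion kap e = kap(e+1)/(1 - 2kap(e+1) m r²): D e = 1/kap
  -- e is an arithmetic progression ending at D E = 1/k. Truncated subtraction freezes it beyond E,
  -- so it is positive and monotone for all e.
  set D : ℕ → ℝ := fun e => 1 / k - 2 * (m * r ^ 2) * ((E - e : ℕ) : ℝ) with hD
  have hDpos : ∀ e, 0 < D e := by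
    intro e
    have h1 : ((E - e : ℕ) : ℝ) ≤ E := by exact_mod_cast Nat.sub_le E e
    have h2 : 2 * (m * r ^ 2) * ((E - e : ℕ) : ℝ) ≤ 2 * (m * r ^ 2) * E := by gcongr
    have h3 : 2 * (m * r ^ 2) * E < 1 / k := by rwa [lt_div_iff₀ hk0]
    simp only [hD]
    linarith
  have hDmono : Monotone D := by
    intro e e' h
    have : ((E - e' : ℕ) : ℝ) ≤ ((E - e : ℕ) : ℝ) := by exact_mod_cast Nat.sub_le_sub_left h E
    simp only [hD]
    gcongr
  have hDE : (D E)⁻¹ = k := by simp [hD]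
  have hDstep : ∀ e < E, 1 - 2 * (D (e + 1))⁻¹ * m * r ^ 2 = D e / D (e + 1) := by
    intro e he
    have h1 : D e = D (e + 1) - 2 * (m * r ^ 2) := by
      have : E - e = (E - (e + 1)) + 1 := by omega
      simp only [hD]
      rw [this]
      push_cast
      ring
    have h2 := (hDpos (e + 1)).ne'
    rw [eq_div_iff h2, h1]
    field_simp
  have hstep := M.lintegral_eexp_X_add_corrSq_le P hm (fun e => (D e)⁻¹)
    (fun e e' h => inv_anti₀ (hDpos e) (hDmono h)) (fun e => (inv_pos.2 (hDpos e)).le)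
    (fun e he => by
      have := hDstep e he
      have := div_pos (hDpos e) (hDpos (e + 1))
      linarith)
    (fun e he => by
      rw [hDstep e he]
      have h1 := hDpos e
      have h2 := hDpos (e + 1)
      apply le_of_eq
      field_simp)
  simp only [hDE] at hstep
  -- Each factor is (D e / D (e+1))^{-1/2}, so the product over the epochs telescopes to D 0 / D E =
  -- 1 - s(1 + η), once for each of the T steps.
  have hprod : ∏ j ∈ Finset.range (E * T), ENNReal.ofReal
      ((1 - 2 * (D (j / T + 1))⁻¹ * m * r ^ 2) ^ (-(1 / 2) : ℝ)) =
      eexp (T * (-(Real.log (1 - s * (1 + η))) / 2)) := by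
    have h1 : ∀ j ∈ Finset.range (E * T), ENNReal.ofReal
        ((1 - 2 * (D (j / T + 1))⁻¹ * m * r ^ 2) ^ (-(1 / 2) : ℝ)) =
        eexp ((fun e => (Real.log (D (e + 1)) - Real.log (D e)) / 2) (j / T)) := by
      intro j hj
      have he : j / T < E := Nat.div_lt_of_lt_mul ((Finset.mem_range.1 hj).trans_eq (mul_comm _ _))
      rw [hDstep _ he, Real.rpow_def_of_pos (div_pos (hDpos _) (hDpos _)),
        Real.log_div (hDpos _).ne' (hDpos _).ne']
      change eexp _ = _
      congr 1
      ring
    rw [Finset.prod_congr rfl h1, ← eexp_sum, sum_range_mul_div E T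
      fun e => (Real.log (D (e + 1)) - Real.log (D e)) / 2, ← Finset.sum_div,
      Finset.sum_range_sub fun e => Real.log (D e)]
    congr 3
    have h2 : D 0 = (1 - s * (1 + η)) / k := by
      simp only [hD, hs, hk]
      field_simp
      simp
    have h3 : D E = 1 / k := by rw [one_div, ← hDE, inv_inv]
    rw [h2, h3, Real.log_div one_ne_zero hk0.ne', Real.log_div (by linarith) hk0.ne', Real.log_one]
    ring
  have hpt : ∀ u x, eexp (M.X (E * T) u x + κ / 2 * ∑ i, (2 / 3 * M.δ (E * T) i u x ^ 2 +
      1 / 3 * avg P i (fun x => M.δ (E * T) i u x ^ 2) x)) ≤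
      eexp c * ∫⁻ x', eexp (M.X (E * T) u x + k * ∑ i, M.corrSq (E * T) i u x x')
        ∂Measure.pi P := by
    -- The average over x_i in the energy is written as an integral over an independent dataset x'.
    -- Jensen then pulls this integral out of the exponential.
    intro u x
    have hδ2 : ∀ i, BddMeas fun x => M.δ (E * T) i u x ^ 2 := fun i =>
      (M.bddMeas_δ (E * T) i u).pow 2
    have hδ2' : ∀ i, BddMeas fun x' : Fin n → 𝓧 =>
        M.δ (E * T) i u (Function.update x i (x' i)) ^ 2 := fun i =>
      (hδ2 i).comp ((measurable_update x).comp (measurable_pi_apply i))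
    have hsumB : ∀ i, BddMeas fun x' : Fin n → 𝓧 => 2 / 3 * M.δ (E * T) i u x ^ 2 +
        1 / 3 * M.δ (E * T) i u (Function.update x i (x' i)) ^ 2 := fun i =>
      (BddMeas.const _).add ((hδ2' i).const_mul _)
    set f : (Fin n → 𝓧) → ℝ := fun x' => M.X (E * T) u x + κ / 2 *
      ∑ i, (2 / 3 * M.δ (E * T) i u x ^ 2 +
        1 / 3 * M.δ (E * T) i u (Function.update x i (x' i)) ^ 2) with hf
    have hfB : BddMeas f := (BddMeas.const _).add ((BddMeas.sum _ fun i _ => hsumB i).const_mul _)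
    have h1 : M.X (E * T) u x + κ / 2 * ∑ i, (2 / 3 * M.δ (E * T) i u x ^ 2 +
        1 / 3 * avg P i (fun x => M.δ (E * T) i u x ^ 2) x) = ∫ x', f x' ∂Measure.pi P := by
      simp only [hf]
      rw [integral_add (integrable_const _)
        (((BddMeas.sum _ fun i _ => hsumB i).const_mul _).integrable _), integral_const_mul,
        integral_finsetSum _ fun i _ => (hsumB i).integrable _]
      simp only [integral_const, probReal_univ, one_smul]
      congr 2
      refine Finset.sum_congr rfl fun i _ => ?_
      rw [integral_add (integrable_const _) (((hδ2' i).const_mul _).integrable _),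
        avg_eq_integral P i (hδ2 i)]
      simp [integral_const_mul]
    rw [h1, ← lintegral_const_mul' _ _ (eexp_ne_top _)]
    refine (exp_integral_le hfB _).trans (lintegral_mono fun x' => ?_)
    rw [← eexp_add]
    refine eexp_mono ?_
    have := mul_le_mul_of_nonneg_left (M.sum_δ_sq_le u x x' hη) (by positivity : 0 ≤ κ / 2)
    simp only [hf, hc, hk]
    linarith
  calc _ ≤ ∫⁻ u, ∫⁻ x, eexp c * ∫⁻ x', eexp (M.X (E * T) u x +
        k * ∑ i, M.corrSq (E * T) i u x x') ∂Measure.pi P ∂Measure.pi P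
        ∂Measure.pi (fun _ => stdGaussian (Param d)) := by
        refine lintegral_mono fun u => ?_
        have hX := M.bddMeas_X (E * T) u
        have hD : BddMeas fun x => ∑ i, (2 / 3 * M.δ (E * T) i u x ^ 2 +
            1 / 3 * avg P i (fun x => M.δ (E * T) i u x ^ 2) x) :=
          BddMeas.sum _ fun i _ => (((M.bddMeas_δ (E * T) i u).pow 2).const_mul _).add
            ((((M.bddMeas_δ (E * T) i u).pow 2).avg P i).const_mul _)
        exact (lintegral_eexp_moment_le hX hD (Measure.pi P) hα (k := κ / 2) (by linarith)
          fun t ht _ => entropy_exp_le_sq P hX (fun i => M.bddMeas_δ (E * T) i u)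
            (fun i => M.X_sub_δ_update (E * T) i u) t).trans (lintegral_mono fun x => hpt u x)
    _ = eexp c * ∫⁻ u, ∫⁻ p, eexp (M.X (E * T) u p.1 + k * ∑ i, M.corrSq (E * T) i u p.1 p.2)
        ∂(Measure.pi P).prod (Measure.pi P) ∂Measure.pi (fun _ => stdGaussian (Param d)) := by
        rw [← lintegral_const_mul' _ _ (eexp_ne_top _)]
        congr 1
        ext u
        rw [lintegral_const_mul' _ _ (eexp_ne_top _), lintegral_prod _ (by fun_prop)]
    _ ≤ eexp c * eexp (T * (-(Real.log (1 - s * (1 + η))) / 2)) := by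
        rw [← hprod]
        exact mul_le_mul_right hstep _
    _ = _ := by
        rw [← eexp_add]
        congr 1
        rw [hc, hs]
        ring

/-- Moment bound for at least two epochs. -/
theorem lintegral_moment_le_of_two_le (hE : 2 ≤ E) (hm : 0 < m) (hr : 0 < r) {l ν : ℝ}
    (hν : ν = m * r ^ 2) (hl : 0 < l) (hlt : ν * (l + l ^ 2) < 1) :
    ∫⁻ u, ∫⁻ x, eexp ((1 + l / E) * M.X (E * T) u x -
        l / E * Real.log (∫ x, Real.exp (M.X (E * T) u x) ∂Measure.pi P)) ∂Measure.pi P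
        ∂Measure.pi (fun _ => stdGaussian (Param d)) ≤
      eexp (T * (ν * l / 2 + expoF ν ((l + l ^ 2) / 2))) := by
  have hE0 : 0 < E := by omega
  have hE' : (2 : ℝ) ≤ E := by exact_mod_cast hE
  have hm' : (1 : ℝ) ≤ m := by exact_mod_cast hm
  have hν0 : 0 < ν := by rw [hν]; positivity
  set α := l / E with hα
  have hα0 : 0 < α := by positivity
  have hαE : α * E = l := by rw [hα]; field_simp
  set κ := α + 2 * α ^ 2 with hκ
  have hκ0 : 0 < κ := by positivity
  set s := κ * (m * r ^ 2) * E with hs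
  have hs' : s = ν * (l + 2 * l * α) := by
    rw [hs, hκ, hν, ← hαE]; ring
  have hs0 : 0 < s := by positivity
  -- Here two epochs are needed: 2α = 2l/E ≤ l.
  have hst : s ≤ ν * (l + l ^ 2) := by
    rw [hs']
    refine mul_le_mul_of_nonneg_left ?_ hν0.le
    have : 2 * α ≤ l := by rw [← hαE]; nlinarith
    nlinarith
  -- Chosen so that q s = νl, matching the linear term of the target.
  set q := 1 / (1 + 2 * α) with hq
  have hq0 : 0 < q := by positivity
  have hq1 : q < 1 := by rw [hq, div_lt_one (by positivity)]; linarith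
  have hqs : q * s = ν * l := by rw [hq, hs']; field_simp
  have hfin : q * s / 2 + expoF ν ((l + l ^ 2) / 2) = ν * l / 2 + expoF ν ((l + l ^ 2) / 2) := by
    rw [hqs]
  rw [← hfin]
  -- The Cauchy-Schwarz bound needs 2κm ≤ 1, which q < 1 provides in the first case. In the second
  -- case κm ≥ q/2, and also κm ≥ κ = (1-q)/(2q²).
  rcases le_total (κ * m) (q / 2) with h | h
  · refine (M.lintegral_moment_le_of_small P hE0 hα0 hκ (by linarith)).trans (eexp_mono ?_)
    exact mul_le_mul_of_nonneg_left (smallBatch_numeric hs0.le hst hlt h) (Nat.cast_nonneg _)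
  · have hs1 : 0 < 1 - s := by linarith
    have hη : 0 < (1 - s) * q := by positivity
    have hlt' : s * (1 + (1 - s) * q) < 1 := by
      have : 0 < (1 - s) * (1 - s * q) := mul_pos hs1 (by nlinarith)
      nlinarith
    refine (M.lintegral_moment_le_of_large P hE0 hm hr hα0 hκ hη hlt').trans (eexp_mono ?_)
    refine mul_le_mul_of_nonneg_left ?_ (Nat.cast_nonneg _)
    have hb2 : (1 - q) / (2 * q ^ 2) ≤ κ * m := by
      have : (1 - q) / (2 * q ^ 2) = κ := by
        rw [hq, hκ]; field_simp; ring
      rw [this]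
      exact le_mul_of_one_le_right hκ0.le hm'
    have := largeBatch_numeric hs0 hst hlt hq0 hq1 h hb2
    have h2 : (E : ℝ) * r ^ 2 = s / (κ * m) := by rw [hs]; field_simp
    rw [h2]
    exact this

end AdaptiveQueries

/-! ### Bounded differences and exponential moments of squares. -/

section Concentration

variable {ι : Type*} [Fintype ι] [DecidableEq ι] {𝓧 : Type*} [MeasurableSpace 𝓧]
variable (P : ι → Measure 𝓧) [∀ i, IsProbabilityMeasure (P i)]

/-- Hoeffding's lemma for a function of bounded oscillation. -/
theorem integral_exp_le_of_osc {Ω : Type*} [MeasurableSpace Ω] {f : Ω → ℝ} (hf : BddMeas f)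
    (μ : Measure Ω) [IsProbabilityMeasure μ] {b : ℝ} (hb : ∀ y y', f y - f y' ≤ b) :
    ∫ y, Real.exp (f y) ∂μ ≤ Real.exp (∫ y, f y ∂μ + b ^ 2 / 8) := by
  have : Nonempty Ω := nonempty_of_isProbabilityMeasure μ
  obtain ⟨C, hC⟩ := hf.bdd
  have hbdd : BddBelow (Set.range f) := ⟨-C, by
    rintro _ ⟨x, rfl⟩; exact (abs_le.1 (hC x)).1⟩
  set a := sInf (Set.range f)
  have h1 : ∀ y, f y ∈ Set.Icc a (a + b) := fun y => by
    refine ⟨csInf_le hbdd ⟨y, rfl⟩, ?_⟩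
    have : f y - b ≤ a := le_csInf (Set.range_nonempty f) (by
      rintro _ ⟨x, rfl⟩; linarith [hb y x])
    linarith
  have h2 := (hasSubgaussianMGF_of_mem_Icc (μ := μ) hf.meas.aemeasurable (ae_of_all _ h1)).mgf_le 1
  have h3 : ((((‖a + b - a‖₊ / 2) ^ 2 : NNReal) : ℝ)) * 1 ^ 2 / 2 = b ^ 2 / 8 := by
    simp only [add_sub_cancel_left]
    push_cast
    rw [Real.norm_eq_abs, div_pow, sq_abs]
    ring
  rw [h3, mgf] at h2
  have h4 : ∀ y, Real.exp (1 * (f y - ∫ y, f y ∂μ)) =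
      Real.exp (f y) * Real.exp (-∫ y, f y ∂μ) := fun y => by
    rw [← Real.exp_add]; congr 1; ring
  simp_rw [h4] at h2
  rw [integral_mul_const, Real.exp_neg, ← div_eq_mul_inv, div_le_iff₀ (Real.exp_pos _)] at h2
  rw [add_comm, Real.exp_add]
  exact h2

/-- McDiarmid's exponential inequality. -/
theorem integral_exp_le_of_bounded_differences {F : (ι → 𝓧) → ℝ} (hF : BddMeas F) {b : ι → ℝ}
    (hb : ∀ i x y y', F (Function.update x i y) - F (Function.update x i y') ≤ b i) :
    ∫ x, Real.exp (F x) ∂Measure.pi P ≤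
      Real.exp (∫ x, F x ∂Measure.pi P + (∑ i, b i ^ 2) / 8) := by
  -- Averaging over some coordinates preserves the bounded differences, so Hoeffding's lemma applies
  -- to every partial average in turn.
  have hbl : ∀ (l : List ι) i x y y', avgList P F l (Function.update x i y) -
      avgList P F l (Function.update x i y') ≤ b i := by
    intro l
    induction l with
    | nil => exact hb
    | cons k l ih =>
      intro i x y y'
      simp only [avgList]
      by_cases hki : k = i
      · subst hki
        rw [avg_update, avg_update, sub_self]
        have := hb k x y y
        simpa using this
      · simp only [avg]
        rw [← integral_sub ((hF.avgList P l).integrable_update P k _)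
          ((hF.avgList P l).integrable_update P k _)]
        have h1 := integral_mono (μ := P k)
          (((hF.avgList P l).integrable_update P k (Function.update x i y)).sub
            ((hF.avgList P l).integrable_update P k (Function.update x i y')))
          (integrable_const (b i)) fun z => by
            simp only [Pi.sub_apply]
            rw [Function.update_comm (Ne.symm hki), Function.update_comm (Ne.symm hki)]
            exact ih i _ y y'
        simpa using h1
  have key : ∀ l : List ι, l.Nodup → ∫ x, Real.exp (F x) ∂Measure.pi P ≤
      Real.exp ((∑ i ∈ l.toFinset, b i ^ 2) / 8) *
        ∫ x, Real.exp (avgList P F l x) ∂Measure.pi P := by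
    intro l
    induction l with
    | nil => intro _; simp [avgList]
    | cons k l ih =>
      intro hl
      rw [List.nodup_cons] at hl
      refine (ih hl.2).trans ?_
      rw [List.toFinset_cons, Finset.sum_insert (by simpa using hl.1)]
      have hFl := hF.avgList P l
      have h1 : ∫ x, Real.exp (avgList P F l x) ∂Measure.pi P ≤
          ∫ x, Real.exp (b k ^ 2 / 8) * Real.exp (avgList P F (k :: l) x) ∂Measure.pi P := by
        rw [← integral_avg P hFl.exp k]
        refine integral_mono ((hFl.exp.avg P k).integrable _)
          (((hF.avgList P (k :: l)).exp.const_mul _).integrable _) fun x => ?_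
        have h2 := integral_exp_le_of_osc (hFl.comp (measurable_update x (a := k))) (P k)
          (fun y y' => hbl l k x y y')
        rw [add_comm, Real.exp_add] at h2
        exact h2
      rw [integral_const_mul] at h1
      refine (mul_le_mul_of_nonneg_left h1 (Real.exp_pos _).le).trans (le_of_eq ?_)
      rw [← mul_assoc, ← Real.exp_add]
      congr 2
      ring
  have h := key (Finset.univ : Finset ι).toList (Finset.nodup_toList _)
  simp only [avgList_univ P hF _ (fun i => by simp : ∀ i, i ∈ (Finset.univ : Finset ι).toList),
    integral_const, probReal_univ, one_smul, Finset.toList_toFinset] at h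
  refine h.trans (le_of_eq ?_)
  rw [← Real.exp_add, add_comm]

theorem avgList_congr_on {F : (ι → 𝓧) → ℝ} {I : Finset ι}
    (hF : ∀ x x' : ι → 𝓧, (∀ i ∈ I, x i = x' i) → F x = F x') (l : List ι) :
    ∀ x x' : ι → 𝓧, (∀ i ∈ I, x i = x' i) → avgList P F l x = avgList P F l x' := by
  induction l with
  | nil => exact hF
  | cons k l ih =>
    intro x x' h
    simp only [avgList, avg]
    congr 1
    ext y
    refine ih _ _ fun i hi => ?_
    by_cases hik : i = k
    · subst hik; simp
    · simp only [Function.update_of_ne hik]; exact h i hi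

/-- Functions of disjoint sets of coordinates are independent. -/
theorem integral_mul_eq_of_disjoint {F c : (ι → 𝓧) → ℝ} (hF : BddMeas F) (hc : BddMeas c)
    (I : Finset ι) (hFI : ∀ x x' : ι → 𝓧, (∀ i ∈ I, x i = x' i) → F x = F x')
    (hcI : ∀ i ∈ I, ∀ x y, c (Function.update x i y) = c x) :
    ∫ x, F x * c x ∂Measure.pi P =
      (∫ x, F x ∂Measure.pi P) * ∫ x, c x ∂Measure.pi P := by
  have h1 : ∀ l : List ι, (∀ i ∈ l, i ∈ I) → ∫ x, F x * c x ∂Measure.pi P =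
      ∫ x, avgList P F l x * c x ∂Measure.pi P := by
    intro l
    induction l with
    | nil => intro _; rfl
    | cons k l ih =>
      intro hl
      rw [ih fun i hi => hl i (by simp [hi])]
      exact (integral_avg_mul P (hF.avgList P l) hc k (hcI k (hl k (by simp)))).symm
  have h2 : ∀ x x', avgList P F I.toList x = avgList P F I.toList x' := by
    classical
    intro x x'
    set x'' : ι → 𝓧 := fun i => if i ∈ I then x i else x' i with hx''
    rw [avgList_congr_on P hFI I.toList x x'' fun i hi => by simp [hx'', hi]]
    exact avgList_congr P F I.toList x'' x' fun i hi => by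
      have : i ∉ I := by simpa using hi
      simp [hx'', this]
  have : Nonempty (ι → 𝓧) := nonempty_of_isProbabilityMeasure (Measure.pi P)
  obtain ⟨x₀⟩ := this
  have h3 : ∫ x, F x ∂Measure.pi P = avgList P F I.toList x₀ := by
    rw [← integral_avgList P hF I.toList]
    simp_rw [fun x => h2 x x₀]
    simp
  rw [h1 I.toList (by simp), h3]
  simp_rw [fun x => h2 x x₀]
  rw [integral_const_mul]

/-- Exponential moment of a square from sub-Gaussian exponential moments. -/
theorem lintegral_eexp_sq_le {Ω : Type*} [MeasurableSpace Ω] {f : Ω → ℝ} (hf : BddMeas f)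
    (μ : Measure Ω) [IsProbabilityMeasure μ] {ν a : ℝ} (ha : a ^ 2 ≤ ν)
    (hsub : ∀ s : ℝ, ∫ x, Real.exp (s * f x) ∂μ ≤ Real.exp (s * a + s ^ 2 * ν / 2)) {c : ℝ}
    (hc : 0 ≤ c) (hlt : 2 * (ν * c) < 1) :
    ∫⁻ x, eexp (c * f x ^ 2) ∂μ ≤
      eexp (-(Real.log (1 - 2 * (ν * c))) / 2 + ν * c / (1 - 2 * (ν * c))) := by
  -- The square is again linearized by an auxiliary Gaussian y, so that only linear exponential
  -- moments of f are needed.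
  set s := Real.sqrt (2 * c) with hs
  have hs2 : s ^ 2 = 2 * c := Real.sq_sqrt (by linarith)
  have hfm := hf.meas
  have h1 : ∀ x, eexp (c * f x ^ 2) = ∫⁻ y, eexp (s * y * f x) ∂gaussianReal 0 1 := by
    intro x
    have h := lintegral_gaussianReal_eexp_quadratic (t := 0) (by norm_num) (s * f x)
    simp only [zero_mul, zero_add, mul_zero, sub_zero, Real.one_rpow, ENNReal.ofReal_one, one_mul,
      mul_one] at h
    have h2 : ∀ y : ℝ, s * y * f x = s * f x * y := fun y => by ring
    simp_rw [h2]
    rw [h, mul_pow, hs2]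
    congr 1
    ring
  simp_rw [h1]
  rw [lintegral_lintegral_swap (by fun_prop)]
  have hpos : 0 < 1 - 2 * (ν * c) := by linarith
  calc ∫⁻ y, ∫⁻ x, eexp (s * y * f x) ∂μ ∂gaussianReal 0 1
      ≤ ∫⁻ y, eexp (ν * c * y ^ 2 + s * a * y) ∂gaussianReal 0 1 := by
        refine lintegral_mono fun y => ?_
        rw [lintegral_eexp_eq (hf.const_mul _)]
        refine eexp_mono ?_
        rw [Real.log_le_iff_le_exp ((hf.const_mul _).posBddMeas_exp.integral_pos μ)]
        refine (hsub (s * y)).trans (Real.exp_le_exp.2 (le_of_eq ?_))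
        rw [mul_pow, hs2]
        ring
    _ = ENNReal.ofReal ((1 - 2 * (ν * c)) ^ (-(1 / 2) : ℝ)) *
        eexp ((s * a) ^ 2 / (2 * (1 - 2 * (ν * c)))) :=
        lintegral_gaussianReal_eexp_quadratic hlt _
    _ ≤ _ := by
        rw [Real.rpow_def_of_pos hpos]
        change eexp _ * _ ≤ _
        rw [← eexp_add]
        refine eexp_mono ?_
        have h2 : (s * a) ^ 2 / (2 * (1 - 2 * (ν * c))) ≤ ν * c / (1 - 2 * (ν * c)) := by
          rw [mul_pow, hs2, mul_assoc, mul_div_mul_left _ _ two_ne_zero]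
          refine div_le_div_of_nonneg_right ?_ hpos.le
          nlinarith
        linarith

/-- Divided by e^x this says that (1 + x)e^{-x} + x²/2 is at least its value 1 at x = 0; its
derivative is x(1 - e^{-x}). -/
theorem exp_le_one_add_sq {x : ℝ} (hx : 0 ≤ x) :
    Real.exp x ≤ 1 + x + x ^ 2 / 2 * Real.exp x := by
  have hd : ∀ y : ℝ, HasDerivAt (fun y => (1 + y) * Real.exp (-y) + y ^ 2 / 2)
      (y * (1 - Real.exp (-y))) y := by
    intro y
    have h1 : HasDerivAt (fun y : ℝ => 1 + y) 1 y := (hasDerivAt_id y).const_add 1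
    have h2 : HasDerivAt (fun y : ℝ => Real.exp (-y)) (Real.exp (-y) * -1) y :=
      (hasDerivAt_neg y).exp
    refine ((h1.mul h2).add ((hasDerivAt_pow 2 y).div_const 2)).congr_deriv ?_
    norm_num
    ring
  have hm : MonotoneOn (fun y => (1 + y) * Real.exp (-y) + y ^ 2 / 2) (Set.Ici 0) := by
    refine monotoneOn_of_deriv_nonneg (convex_Ici 0)
      (fun y _ => (hd y).continuousAt.continuousWithinAt)
      (fun y _ => (hd y).differentiableAt.differentiableWithinAt) fun y hy => ?_
    rw [(hd y).deriv]
    have hy' : 0 < y := by simpa using hy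
    have : Real.exp (-y) ≤ 1 := Real.exp_le_one_iff.2 (by linarith)
    exact mul_nonneg hy'.le (by linarith)
  have h := hm (Set.mem_Ici.2 le_rfl) (Set.mem_Ici.2 hx) hx
  simp only [add_zero, neg_zero, Real.exp_zero, mul_one, ne_eq, OfNat.ofNat_ne_zero,
    not_false_eq_true, zero_pow, zero_div] at h
  have h2 := mul_le_mul_of_nonneg_right h (Real.exp_pos x).le
  rw [add_mul, mul_assoc, ← Real.exp_add] at h2
  simp at h2
  linarith

/-- Exponential moment of the square of a sub-Gaussian variable with bounded second moment. -/
theorem lintegral_eexp_sq_le_expoF {Ω : Type*} [MeasurableSpace Ω] {f : Ω → ℝ} (hf : BddMeas f)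
    (μ : Measure Ω) [IsProbabilityMeasure μ] {ν a : ℝ} (hν : 0 < ν) (ha : a ^ 2 ≤ ν)
    (hsq : ∫ x, f x ^ 2 ∂μ ≤ ν)
    (hsub : ∀ s : ℝ, ∫ x, Real.exp (s * f x) ∂μ ≤ Real.exp (s * a + s ^ 2 * ν / 2)) {c : ℝ}
    (hc : 0 ≤ c) (hlt : 2 * ν * c < 1) :
    ∫⁻ x, eexp (c * f x ^ 2) ∂μ ≤ eexp (expoF ν c) := by
  set y := ν * c with hy
  have hy0 : 0 ≤ y := by positivity
  have hlt' : 2 * y < 1 := by rw [hy]; linarith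
  have hF : expoF ν c = (16 * y ^ 2 + y) / (1 - 2 * y) := by
    rw [expoF, hy]; congr 1 <;> ring
  have hpos : 0 < 1 - 2 * y := by linarith
  -- Bounding the logarithm turns the general estimate into 2y/(1 - 2y), which is below F exactly
  -- when y ≥ 1/16. For smaller y the second moment is needed, to get the linear term y instead of
  -- 2y.
  rcases le_total (1 / 16) y with h | h
  · refine (lintegral_eexp_sq_le hf μ ha hsub hc hlt').trans (eexp_mono ?_)
    rw [hF, le_div_iff₀ hpos, add_mul, div_mul_cancel₀ _ hpos.ne']
    have h1 := Real.one_sub_inv_le_log_of_pos hpos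
    have h2 := mul_le_mul_of_nonneg_right h1 hpos.le
    rw [sub_mul, inv_mul_cancel₀ hpos.ne'] at h2
    nlinarith
  · have hB : ∀ t : ℝ, BddMeas fun x => t * f x ^ 2 := fun t => (hf.pow 2).const_mul t
    have hbig := lintegral_eexp_sq_le hf μ ha hsub (c := 5 / (16 * ν)) (by positivity)
      (by field_simp; norm_num)
    rw [lintegral_eexp_eq (hB _)] at hbig
    have hν5 : ν * (5 / (16 * ν)) = 5 / 16 := by field_simp
    rw [hν5] at hbig
    have hbig' : ∫ x, Real.exp (5 / (16 * ν) * f x ^ 2) ∂μ ≤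
        Real.exp (-(Real.log (1 - 2 * (5 / 16))) / 2 + 5 / 16 / (1 - 2 * (5 / 16))) := by
      have h1 := (ENNReal.ofReal_le_ofReal_iff (Real.exp_pos _).le).1 hbig
      rwa [Real.exp_log ((hB _).posBddMeas_exp.integral_pos μ)] at h1
    set B := Real.exp (-(Real.log (1 - 2 * (5 / 16))) / 2 + 5 / 16 / (1 - 2 * (5 / 16))) with hBdef
    have hBle : Real.exp (-2) * B ≤ 9 / 16 := by
      have e1 : Real.exp (-2) * B =
          Real.exp (-(Real.log (3 / 8)) / 2) * (Real.exp (7 / 6))⁻¹ := by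
        rw [hBdef, ← Real.exp_neg, ← Real.exp_add, ← Real.exp_add]
        congr 1
        rw [show (1 : ℝ) - 2 * (5 / 16) = 3 / 8 by norm_num]
        ring
      have e2 : Real.exp (-(Real.log (3 / 8)) / 2) ≤ 5 / 3 := by
        rw [← Real.le_log_iff_exp_le (by norm_num), ← Real.log_inv, div_le_iff₀ two_pos,
          mul_comm, ← Real.log_rpow (by norm_num)]
        refine Real.log_le_log (by norm_num) (by norm_num)
      have e3 : 3 ≤ Real.exp (7 / 6) := by
        have h1 : Real.exp (7 / 6) = Real.exp 1 * Real.exp (1 / 6) := by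
          rw [← Real.exp_add]; norm_num
        have h2 := Real.add_one_le_exp (1 / 6 : ℝ)
        have h3 := Real.exp_one_gt_d9
        rw [h1]
        nlinarith
      have e4 : (Real.exp (7 / 6))⁻¹ ≤ 3⁻¹ := inv_anti₀ (by norm_num) e3
      rw [e1]
      calc _ ≤ (5 / 3 : ℝ) * 3⁻¹ := by gcongr
        _ ≤ _ := by norm_num
    have hpt : ∀ x, Real.exp (c * f x ^ 2) ≤
        1 + c * f x ^ 2 + 32 * y ^ 2 * Real.exp (-2) * Real.exp (5 / (16 * ν) * f x ^ 2) := by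
      intro x
      set w := f x ^ 2 / ν with hw
      have hw0 : 0 ≤ w := by positivity
      have hcw : c * f x ^ 2 = y * w := by rw [hy, hw]; field_simp
      have h5w : 5 / (16 * ν) * f x ^ 2 = 5 / 16 * w := by rw [hw]; field_simp
      rw [hcw, h5w]
      refine (exp_le_one_add_sq (by positivity)).trans ?_
      -- Tangent bound, with equality at w = 8. The growth rates 1/4 from w² and at most 1/16 from
      -- e^{yw} add up to the 5/16 of the reference moment `hbig`.
      have h1 : w ^ 2 ≤ 64 * Real.exp (w / 4 - 2) := by
        have h2 := Real.add_one_le_exp (w / 8 - 1)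
        have h3 : Real.exp (w / 4 - 2) = Real.exp (w / 8 - 1) ^ 2 := by
          rw [← Real.exp_nat_mul]; congr 1; push_cast; ring
        rw [h3]
        nlinarith
      have h2 : (y * w) ^ 2 / 2 * Real.exp (y * w) ≤
          32 * y ^ 2 * Real.exp (-2) * Real.exp (5 / 16 * w) := by
        calc (y * w) ^ 2 / 2 * Real.exp (y * w)
            ≤ (y ^ 2 * (64 * Real.exp (w / 4 - 2))) / 2 * Real.exp (1 / 16 * w) := by
              rw [mul_pow]; gcongr
          _ = 32 * y ^ 2 * (Real.exp (w / 4 - 2) * Real.exp (1 / 16 * w)) := by ring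
          _ = _ := by
              rw [mul_assoc (32 * y ^ 2), ← Real.exp_add, ← Real.exp_add]
              congr 2
              ring
      linarith
    rw [lintegral_eexp_eq (hB c)]
    refine eexp_mono ?_
    rw [Real.log_le_iff_le_exp ((hB c).posBddMeas_exp.integral_pos μ)]
    have i1 := (hB c).integrable μ
    have i2 := (((hB (5 / (16 * ν))).exp.const_mul (32 * y ^ 2 * Real.exp (-2)))).integrable μ
    have h1 := integral_mono ((hB c).exp.integrable μ)
      (((integrable_const 1).add i1).add i2) hpt
    simp only [Pi.add_apply] at h1
    rw [integral_add (((BddMeas.const 1).add (hB c)).integrable μ) i2,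
      integral_add (integrable_const 1) i1, integral_const_mul, integral_const_mul] at h1
    simp only [integral_const, probReal_univ, one_smul] at h1
    have h2 : c * ∫ x, f x ^ 2 ∂μ ≤ y := by
      rw [hy, mul_comm ν]; exact mul_le_mul_of_nonneg_left hsq hc
    have h3 : 32 * y ^ 2 * Real.exp (-2) * ∫ x, Real.exp (5 / (16 * ν) * f x ^ 2) ∂μ ≤
        18 * y ^ 2 := by
      have := mul_le_mul_of_nonneg_left hbig' (by positivity : 0 ≤ 32 * y ^ 2 * Real.exp (-2))
      have h4 := mul_le_mul_of_nonneg_left hBle (by positivity : 0 ≤ 32 * y ^ 2)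
      linarith
    have h4 : y + 18 * y ^ 2 ≤ (16 * y ^ 2 + y) / (1 - 2 * y) := by
      rw [le_div_iff₀ hpos]
      nlinarith [pow_nonneg hy0 3]
    rw [hF]
    have h5 := Real.add_one_le_exp ((16 * y ^ 2 + y) / (1 - 2 * y))
    linarith

end Concentration

/-! ### Sums of bounded independent vectors. -/

section SumOfIndependent

variable {ι : Type*} [Fintype ι] [DecidableEq ι] {𝓧 : Type*} [MeasurableSpace 𝓧] {d : ℕ}
variable (P : ι → Measure 𝓧) [∀ i, IsProbabilityMeasure (P i)]

theorem integrable_of_norm_le {φ : 𝓧 → Param d} (hφ : Measurable φ) {r : ℝ} (hr : ∀ y, ‖φ y‖ ≤ r)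
    (μ : Measure 𝓧) [IsProbabilityMeasure μ] : Integrable φ μ :=
  Integrable.of_bound hφ.aestronglyMeasurable r (ae_of_all _ hr)

theorem norm_integral_le_of_norm_le {φ : 𝓧 → Param d} {r : ℝ} (hr : ∀ y, ‖φ y‖ ≤ r)
    (μ : Measure 𝓧) [IsProbabilityMeasure μ] : ‖∫ y, φ y ∂μ‖ ≤ r := by
  simpa using norm_integral_le_of_norm_le_const (μ := μ) (ae_of_all _ hr)

theorem integral_inner_sum_eval {φ : 𝓧 → Param d} (hφ : Measurable φ) {r : ℝ}
    (hr : ∀ y, ‖φ y‖ ≤ r) (I : Finset ι) (v : Param d) :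
    ∫ x, inner ℝ v (∑ i ∈ I, φ (x i)) ∂Measure.pi P = inner ℝ v (∑ i ∈ I, ∫ y, φ y ∂P i) := by
  simp_rw [inner_sum]
  rw [integral_finsetSum _ fun i _ => ?_]
  · refine Finset.sum_congr rfl fun i _ => ?_
    rw [← integral_inner (integrable_of_norm_le hφ hr (P i))]
    exact integral_comp_eval (μ := P) (f := fun y => inner ℝ v (φ y))
      (by fun_prop)
  · exact (AdaptiveQueries.bddMeas_inner (f := fun _ : ι → 𝓧 => v) (h := fun x => φ (x i))
      (by fun_prop) (by fun_prop) (fun _ => le_rfl) (fun x => hr (x i))).integrable _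

/-- Independence and centring kill the off-diagonal inner products; each diagonal term is a
variance, at most r². -/
theorem integral_norm_sq_sum_sub_mean_le {φ : 𝓧 → Param d} (hφ : Measurable φ) {r : ℝ}
    (hr : ∀ y, ‖φ y‖ ≤ r) (I : Finset ι) :
    ∫ x, ‖∑ i ∈ I, φ (x i) - ∑ i ∈ I, ∫ y, φ y ∂P i‖ ^ 2 ∂Measure.pi P ≤ I.card * r ^ 2 := by
  set c : ι → Param d := fun i => ∫ y, φ y ∂P i with hc
  have hcr : ∀ i, ‖c i‖ ≤ r := fun i => norm_integral_le_of_norm_le hr (P i)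
  have hb : ∀ i (y : 𝓧), ‖φ y - c i‖ ≤ r + r := fun i y =>
    (norm_sub_le _ _).trans (add_le_add (hr y) (hcr i))
  have hB : ∀ i k, BddMeas fun x : ι → 𝓧 => (inner ℝ (φ (x i) - c i) (φ (x k) - c k) : ℝ) :=
    fun i k => AdaptiveQueries.bddMeas_inner (by fun_prop) (by fun_prop)
      (fun x => hb i (x i)) (fun x => hb k (x k))
  have h1 : ∀ x : ι → 𝓧, ‖∑ i ∈ I, φ (x i) - ∑ i ∈ I, c i‖ ^ 2 =
      ∑ i ∈ I, ∑ k ∈ I, inner ℝ (φ (x i) - c i) (φ (x k) - c k) := fun x => by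
    rw [← Finset.sum_sub_distrib, ← real_inner_self_eq_norm_sq, sum_inner]
    simp_rw [inner_sum]
  have h2 : ∀ i k, i ≠ k →
      ∫ x, inner ℝ (φ (x i) - c i) (φ (x k) - c k) ∂Measure.pi P = 0 := by
    intro i k hik
    rw [← integral_avg P (hB i k) i]
    have : ∀ x, avg P i (fun x => (inner ℝ (φ (x i) - c i) (φ (x k) - c k) : ℝ)) x = 0 := by
      intro x
      simp only [avg, Function.update_self, Function.update_of_ne hik.symm]
      simp_rw [real_inner_comm (φ (x k) - c k)]
      have e : Integrable (fun y => φ y - c i) (P i) :=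
        (integrable_of_norm_le hφ hr (P i)).sub (integrable_const _)
      rw [integral_inner e, integral_sub (integrable_of_norm_le hφ hr (P i)) (integrable_const _)]
      simp [hc]
    simp [this]
  have h3 : ∀ i, ∫ x, inner ℝ (φ (x i) - c i) (φ (x i) - c i) ∂Measure.pi P ≤ r ^ 2 := by
    intro i
    rw [integral_comp_eval (μ := P) (i := i)
      (f := fun y => (inner ℝ (φ y - c i) (φ y - c i) : ℝ)) (by fun_prop)]
    have e1 := (AdaptiveQueries.bddMeas_norm_sq hφ hr).integrable (P i)
    have e2 := (integrable_of_norm_le hφ hr (P i)).const_inner (𝕜 := ℝ) (c i)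
    have h4 : ∀ y, (inner ℝ (φ y - c i) (φ y - c i) : ℝ) =
        ‖φ y‖ ^ 2 - 2 * inner ℝ (c i) (φ y) + ‖c i‖ ^ 2 := fun y => by
      rw [real_inner_self_eq_norm_sq, norm_sub_sq_real, real_inner_comm]
    simp_rw [h4]
    have e3 : Integrable (fun y => ‖φ y‖ ^ 2 - 2 * inner ℝ (c i) (φ y)) (P i) :=
      e1.sub (e2.const_mul 2)
    rw [integral_add e3 (integrable_const _), integral_sub e1 (e2.const_mul 2), integral_const_mul,
      integral_inner (integrable_of_norm_le hφ hr (P i))]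
    have h5 : ∫ y, ‖φ y‖ ^ 2 ∂P i ≤ r ^ 2 := by
      have := integral_mono e1 (integrable_const (r ^ 2)) fun y =>
        pow_le_pow_left₀ (norm_nonneg _) (hr y) 2
      simpa using this
    simp only [integral_const, probReal_univ, one_smul]
    change _ - 2 * inner ℝ (c i) (c i) + _ ≤ _
    rw [real_inner_self_eq_norm_sq]
    nlinarith [sq_nonneg ‖c i‖]
  simp_rw [h1]
  rw [integral_finsetSum _ fun i _ => (BddMeas.sum I fun k _ => hB i k).integrable _]
  have h6 : ∀ i ∈ I, ∫ x, ∑ k ∈ I, inner ℝ (φ (x i) - c i) (φ (x k) - c k) ∂Measure.pi P ≤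
      r ^ 2 := by
    intro i hi
    rw [integral_finsetSum _ fun k _ => (hB i k).integrable _,
      Finset.sum_eq_single i (fun k _ hk => h2 i k hk.symm) (fun h => absurd hi h)]
    exact h3 i
  refine (Finset.sum_le_sum h6).trans ?_
  rw [Finset.sum_const, nsmul_eq_mul]

theorem bddMeas_norm_sum_sub {φ : 𝓧 → Param d} (hφ : Measurable φ) {r : ℝ}
    (hr : ∀ y, ‖φ y‖ ≤ r) (I : Finset ι) (c : Param d) :
    BddMeas fun x : ι → 𝓧 => ‖∑ i ∈ I, φ (x i) - c‖ := by
  refine ⟨by fun_prop, I.card * r + ‖c‖, fun x => ?_⟩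
  rw [abs_norm]
  refine (norm_sub_le _ _).trans (add_le_add_left ((norm_sum_le _ _).trans ?_) _)
  refine (Finset.sum_le_sum fun i _ => hr (x i)).trans ?_
  rw [Finset.sum_const, nsmul_eq_mul]

/-- Exponential moment of the squared deviation of a sum of bounded independent vectors. -/
theorem lintegral_eexp_norm_sq_sum_sub_mean_le {φ : 𝓧 → Param d} (hφ : Measurable φ) {r : ℝ}
    (hr : ∀ y, ‖φ y‖ ≤ r) (I : Finset ι) {ν c : ℝ} (hν : 0 < ν) (hνI : ν = I.card * r ^ 2)
    (hc : 0 ≤ c) (hlt : 2 * ν * c < 1) :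
    ∫⁻ x, eexp (c * ‖∑ i ∈ I, φ (x i) - ∑ i ∈ I, ∫ y, φ y ∂P i‖ ^ 2) ∂Measure.pi P ≤
      eexp (expoF ν c) := by
  set b := ∑ i ∈ I, ∫ y, φ y ∂P i
  have hf := bddMeas_norm_sum_sub (ι := ι) hφ hr I b
  have hsq := integral_norm_sq_sum_sub_mean_le P hφ hr I
  rw [← hνI] at hsq
  refine lintegral_eexp_sq_le_expoF hf (Measure.pi P) (a := ∫ x, ‖∑ i ∈ I, φ (x i) - b‖
    ∂Measure.pi P) hν ?_ hsq (fun s => ?_) hc hlt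
  · refine le_trans ?_ hsq
    exact (Even.convexOn_pow (n := 2) (by decide)).map_integral_le (by fun_prop) isClosed_univ
      (ae_of_all _ fun _ => Set.mem_univ _) (hf.integrable _) ((hf.pow 2).integrable _)
  · have hd : ∀ i (x : ι → 𝓧) y y', s * ‖∑ k ∈ I, φ (Function.update x i y k) - b‖ -
        s * ‖∑ k ∈ I, φ (Function.update x i y' k) - b‖ ≤
        if i ∈ I then |s| * (r + r) else 0 := by
      intro i x y y'
      split_ifs with hi
      · have h1 : ∀ y, ∑ k ∈ I, φ (Function.update x i y k) =
            ∑ k ∈ I.erase i, φ (x k) + φ y := fun y => by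
          rw [← Finset.sum_erase_add _ _ hi, Function.update_self]
          congr 1
          exact Finset.sum_congr rfl fun k hk => by
            rw [Function.update_of_ne (Finset.ne_of_mem_erase hk)]
        rw [← mul_sub]
        refine (le_abs_self _).trans ?_
        rw [abs_mul]
        refine mul_le_mul_of_nonneg_left ((abs_norm_sub_norm_le _ _).trans ?_) (abs_nonneg s)
        rw [h1, h1]
        have : ∑ k ∈ I.erase i, φ (x k) + φ y - b - (∑ k ∈ I.erase i, φ (x k) + φ y' - b) =
          φ y - φ y' := by abel
        rw [this]
        exact (norm_sub_le _ _).trans (add_le_add (hr y) (hr y'))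
      · have h1 : ∀ y, ∑ k ∈ I, φ (Function.update x i y k) = ∑ k ∈ I, φ (x k) := fun y =>
          Finset.sum_congr rfl fun k hk => by
            rw [Function.update_of_ne (fun h => hi (by rwa [← h]))]
        rw [h1, h1, sub_self]
    refine (integral_exp_le_of_bounded_differences P (hf.const_mul s) hd).trans
      (Real.exp_le_exp.2 (le_of_eq ?_))
    rw [integral_const_mul]
    have h2 : ∀ i, (if i ∈ I then |s| * (r + r) else 0) ^ 2 =
        if i ∈ I then (|s| * (r + r)) ^ 2 else 0 := fun i => by split_ifs <;> simp
    simp_rw [h2]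
    rw [Finset.sum_ite_mem, Finset.univ_inter, Finset.sum_const, nsmul_eq_mul, mul_pow, sq_abs,
      hνI]
    ring

end SumOfIndependent

/-! ### Moment bound for one epoch, and all cases combined. -/

namespace AdaptiveQueries

variable {𝓧 : Type*} [MeasurableSpace 𝓧] {d n m T E : ℕ} {r : ℝ}
variable (P : Fin n → Measure 𝓧) [∀ i, IsProbabilityMeasure (P i)]

/-- Within one epoch no sample is reused, so the likelihood of the earlier answers does not involve
the batch of step `j`. -/
theorem X_update_of_mem (M : AdaptiveQueries 𝓧 d n m T 1 r) (j : Fin (1 * T)) {i : Fin n}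
    (hi : i ∈ M.I j) (u : Fin (1 * T) → Param d) (x : Fin n → 𝓧) (y : 𝓧) :
    M.X j u (Function.update x i y) = M.X j u x := by
  refine psum_congr fun l hl => ?_
  have hil : i ∉ M.I l := fun h => by
    have h1 := M.epoch_lt l j i hl h hi
    rw [Nat.div_eq_of_lt (lt_of_lt_of_eq j.2 (one_mul T))] at h1
    exact absurd h1 (Nat.not_lt_zero _)
  rw [M.g_update_of_notMem hil]

/-- Integrating out the answer produces (l + l²)/2 · ‖g - b‖² plus l/2 times the variance of g,
where b is the mean of g. The first depends only on the new batch and so is independent of the past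
weight; the second is at most lν/2. -/
theorem lintegral_step_le_of_eq_one (M : AdaptiveQueries 𝓧 d n m T 1 r) {ν l : ℝ} (hm : 0 < m)
    (hr : 0 < r) (hν : ν = m * r ^ 2) (hl : 0 < l) (hlt : ν * (l + l ^ 2) < 1) {j : ℕ}
    (hj : j < 1 * T) (u : Fin (1 * T) → Param d) :
    ∫⁻ v, ∫⁻ x, eexp ((1 + l) * M.X (j + 1) (Function.update u ⟨j, hj⟩ v) x -
        l * ∫ x, M.X (j + 1) (Function.update u ⟨j, hj⟩ v) x ∂Measure.pi P) ∂Measure.pi P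
        ∂stdGaussian (Param d) ≤
      eexp (ν * l / 2 + expoF ν ((l + l ^ 2) / 2)) *
        ∫⁻ x, eexp ((1 + l) * M.X j u x - l * ∫ x, M.X j u x ∂Measure.pi P) ∂Measure.pi P := by
  have hm' : (0 : ℝ) < m := by exact_mod_cast hm
  have hν0 : 0 < ν := by rw [hν]; positivity
  set jj : Fin (1 * T) := ⟨j, hj⟩ with hjj
  set b := ∑ i ∈ M.I jj, ∫ y, M.φ jj u y ∂P i with hb
  have hφ : Measurable (M.φ jj u) := by fun_prop
  have hg2 := bddMeas_norm_sq (f := fun x => M.g jj u x) (by fun_prop) (M.norm_g_le jj u)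
  have hgv : ∀ v, BddMeas fun x => (inner ℝ v (M.g jj u x) : ℝ) := fun v =>
    bddMeas_inner (f := fun _ => v) (h := fun x => M.g jj u x) (by fun_prop)
      (by fun_prop) (fun _ => le_rfl) (M.norm_g_le jj u)
  have hmean : ∀ v, ∫ x, inner ℝ v (M.g jj u x) ∂Measure.pi P = inner ℝ v b := fun v =>
    integral_inner_sum_eval P hφ (M.norm_le jj u) (M.I jj) v
  set G := ∫ x, ‖M.g jj u x‖ ^ 2 ∂Measure.pi P with hG
  have hvar : G - ‖b‖ ^ 2 ≤ ν := by
    have h1 := integral_norm_sq_sum_sub_mean_le P hφ (M.norm_le jj u) (M.I jj)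
    rw [M.card, ← hν] at h1
    refine le_trans (le_of_eq ?_) h1
    have h2 : ∀ x, ‖∑ i ∈ M.I jj, M.φ jj u (x i) - b‖ ^ 2 =
        ‖M.g jj u x‖ ^ 2 - 2 * inner ℝ b (M.g jj u x) + ‖b‖ ^ 2 := fun x => by
      rw [norm_sub_sq_real, real_inner_comm]; rfl
    simp_rw [← hb, h2]
    rw [integral_add ((hg2.sub ((hgv b).const_mul 2)).integrable _) (integrable_const _),
      integral_sub (hg2.integrable _) (((hgv b).const_mul 2).integrable _), integral_const_mul,
      hmean, real_inner_self_eq_norm_sq]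
    simp
    ring
  have hX := M.bddMeas_X j u
  have hint : ∀ v, ∫ x, M.X (j + 1) (Function.update u jj v) x ∂Measure.pi P =
      ∫ x, M.X j u x ∂Measure.pi P + (inner ℝ v b - G / 2) := by
    intro v
    simp_rw [hjj, M.X_succ_update]
    have h2 : BddMeas fun x => ‖M.g jj u x‖ ^ 2 / 2 := by
      simpa only [div_eq_inv_mul] using hg2.const_mul 2⁻¹
    rw [integral_add (hX.integrable _) (((hgv v).sub h2).integrable _),
      integral_sub ((hgv v).integrable _) (h2.integrable _), integral_div, hmean]
  set A : (Fin n → 𝓧) → ℝ := fun x => (1 + l) * M.X j u x - l * ∫ x, M.X j u x ∂Measure.pi P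
    with hA
  have hAb : BddMeas A := (hX.const_mul _).sub (BddMeas.const _)
  set B : (Fin n → 𝓧) → ℝ := fun x =>
    (l + l ^ 2) / 2 * ‖∑ i ∈ M.I jj, M.φ jj u (x i) - b‖ ^ 2 with hB
  have hBb : BddMeas B := ((bddMeas_norm_sum_sub hφ (M.norm_le jj u) (M.I jj) b).pow 2).const_mul _
  have h3 : ∀ v x, (1 + l) * M.X (j + 1) (Function.update u jj v) x -
      l * ∫ x, M.X (j + 1) (Function.update u jj v) x ∂Measure.pi P =
      (A x - (1 + l) * ‖M.g jj u x‖ ^ 2 / 2 + l * G / 2) +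
        inner ℝ v ((1 + l) • M.g jj u x - l • b) := by
    intro v x
    rw [hint, hjj, M.X_succ_update, inner_sub_right, inner_smul_right, inner_smul_right, hA]
    ring
  simp_rw [h3]
  rw [lintegral_lintegral_swap (by fun_prop)]
  have h4 : ∀ x, ∫⁻ v, eexp ((A x - (1 + l) * ‖M.g jj u x‖ ^ 2 / 2 + l * G / 2) +
        inner ℝ v ((1 + l) • M.g jj u x - l • b)) ∂stdGaussian (Param d) =
      eexp (l / 2 * (G - ‖b‖ ^ 2)) * eexp (B x + A x) := by
    intro x
    simp_rw [eexp_add (A x - (1 + l) * ‖M.g jj u x‖ ^ 2 / 2 + l * G / 2)]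
    rw [lintegral_const_mul _ (by fun_prop), lintegral_stdGaussian_eexp, ← eexp_add, ← eexp_add]
    congr 1
    change _ = l / 2 * (G - ‖b‖ ^ 2) + ((l + l ^ 2) / 2 * ‖M.g jj u x - b‖ ^ 2 + A x)
    rw [norm_sub_sq_real, norm_sub_sq_real, norm_smul, norm_smul, inner_smul_left,
      inner_smul_right, mul_pow, mul_pow]
    simp only [Real.norm_eq_abs, sq_abs, conj_trivial]
    ring
  simp_rw [h4]
  rw [lintegral_const_mul _ ((hBb.add hAb).meas.eexp), lintegral_eexp_eq (hBb.add hAb)]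
  simp_rw [Real.exp_add]
  have hcB : ∀ x x' : Fin n → 𝓧, (∀ i ∈ M.I jj, x i = x' i) → Real.exp (B x) = Real.exp (B x') := by
    intro x x' h
    simp only [hB]
    rw [Finset.sum_congr rfl fun i hi => by rw [h i hi]]
  have hcA : ∀ i ∈ M.I jj, ∀ x y, Real.exp (A (Function.update x i y)) = Real.exp (A x) := by
    intro i hi x y
    simp only [hA]
    rw [M.X_update_of_mem jj hi]
  rw [integral_mul_eq_of_disjoint P hBb.exp hAb.exp (M.I jj) hcB hcA,
    Real.log_mul (hBb.posBddMeas_exp.integral_pos _).ne' (hAb.posBddMeas_exp.integral_pos _).ne',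
    eexp_add, ← lintegral_eexp_eq hBb, ← lintegral_eexp_eq hAb, ← mul_assoc, eexp_add]
  refine mul_le_mul' (mul_le_mul' (eexp_mono ?_) ?_) le_rfl
  · nlinarith
  · exact lintegral_eexp_norm_sq_sum_sub_mean_le P hφ (M.norm_le jj u) (M.I jj) hν0
      (by rw [M.card, hν]) (by positivity) (by linarith)

/-- Moment bound for a single epoch. -/
theorem lintegral_moment_le_of_eq_one (M : AdaptiveQueries 𝓧 d n m T 1 r) {ν l : ℝ} (hm : 0 < m)
    (hr : 0 < r) (hν : ν = m * r ^ 2) (hl : 0 < l) (hlt : ν * (l + l ^ 2) < 1) :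
    ∫⁻ u, ∫⁻ x, eexp ((1 + l) * M.X (1 * T) u x -
        l * Real.log (∫ x, Real.exp (M.X (1 * T) u x) ∂Measure.pi P)) ∂Measure.pi P
        ∂Measure.pi (fun _ => stdGaussian (Param d)) ≤
      eexp (T * (ν * l / 2 + expoF ν ((l + l ^ 2) / 2))) := by
  -- Jensen: replacing the log-marginal by the mean of X only increases the moment and makes the
  -- exponent additive over steps.
  have h1 : ∀ u, ∫ x, M.X (1 * T) u x ∂Measure.pi P ≤
      Real.log (∫ x, Real.exp (M.X (1 * T) u x) ∂Measure.pi P) := by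
    intro u
    have h := exp_integral_le (M.bddMeas_X (1 * T) u) (Measure.pi P)
    rw [lintegral_eexp_eq (M.bddMeas_X (1 * T) u)] at h
    exact Real.exp_le_exp.1 ((ENNReal.ofReal_le_ofReal_iff (Real.exp_pos _).le).1 h)
  refine (lintegral_mono fun u => lintegral_mono fun x => eexp_mono
    (sub_le_sub_left (mul_le_mul_of_nonneg_left (h1 u) hl.le) _)).trans ?_
  refine (lintegral_pi_le_prod (stdGaussian (Param d))
    (fun k u => ∫⁻ x, eexp ((1 + l) * M.X k u x - l * ∫ x, M.X k u x ∂Measure.pi P)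
      ∂Measure.pi P)
    (fun _ => eexp (ν * l / 2 + expoF ν ((l + l ^ 2) / 2))) (fun k => ?_)
    (fun j hj u => M.lintegral_step_le_of_eq_one P hm hr hν hl hlt hj u) (1 * T) le_rfl).trans ?_
  · have hS : Measurable fun u => ∫ x, M.X k u x ∂Measure.pi P :=
      (StronglyMeasurable.integral_prod_right' (f := fun p : (Fin (1 * T) → Param d) ×
        (Fin n → 𝓧) => M.X k p.1 p.2) (by fun_prop : Measurable _).stronglyMeasurable).measurable
    have hS' : Measurable fun p : (Fin (1 * T) → Param d) × (Fin n → 𝓧) =>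
      ∫ x, M.X k p.1 x ∂Measure.pi P := hS.comp measurable_fst
    exact Measurable.lintegral_prod_right' (f := fun p : (Fin (1 * T) → Param d) × (Fin n → 𝓧) =>
      eexp ((1 + l) * M.X k p.1 p.2 - l * ∫ x, M.X k p.1 x ∂Measure.pi P)) (by fun_prop)
  · simp [X, Finset.prod_const, ← ENNReal.rpow_natCast, eexp_rpow]

/-- Moment bound for any number of epochs. -/
theorem lintegral_moment_le (M : AdaptiveQueries 𝓧 d n m T E r) {ν l : ℝ} (hE : 0 < E)
    (hm : 0 < m) (hr : 0 < r) (hν : ν = m * r ^ 2) (hl : 0 < l) (hlt : ν * (l + l ^ 2) < 1) :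
    ∫⁻ u, ∫⁻ x, eexp ((1 + l / E) * M.X (E * T) u x -
        l / E * Real.log (∫ x, Real.exp (M.X (E * T) u x) ∂Measure.pi P)) ∂Measure.pi P
        ∂Measure.pi (fun _ => stdGaussian (Param d)) ≤
      eexp (T * (ν * l / 2 + expoF ν ((l + l ^ 2) / 2))) := by
  rcases Nat.lt_or_ge E 2 with h | h
  · obtain rfl : E = 1 := by omega
    simpa only [Nat.cast_one, div_one] using M.lintegral_moment_le_of_eq_one P hm hr hν hl hlt
  · exact M.lintegral_moment_le_of_two_le P h hm hr hν hl hlt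

end AdaptiveQueries

/-! ### The infimum over l and the explicit bound. -/

section Bounds

theorem lt_radius_iff {ν l : ℝ} (hν : 0 < ν) (hl : 0 < l) :
    l < radius ν ↔ ν * (l + l ^ 2) < 1 := by
  have h1 : l < radius ν ↔ l + 1 / 2 < Real.sqrt (1 / ν + 1 / 4) := by
    rw [radius, lt_sub_iff_add_lt]
  rw [h1, Real.lt_sqrt (by positivity), ← lt_div_iff₀' hν]
  constructor <;> intro h <;> nlinarith

theorem expoF_nonneg {ν l : ℝ} (hν : 0 < ν) (hl : 0 < l) (h : ν * (l + l ^ 2) < 1) :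
    0 ≤ expoF ν ((l + l ^ 2) / 2) := by
  rw [expoF_eq]
  have : 0 < 1 - ν * (l + l ^ 2) := by linarith
  positivity

theorem nonempty_Ioo_radius {ν : ℝ} (hν : 0 < ν) : (Set.Ioo (0 : ℝ) (radius ν)).Nonempty := by
  refine Set.nonempty_Ioo.2 (sub_pos.2 ?_)
  rw [Real.lt_sqrt (by norm_num)]
  have : 0 < 1 / ν := by positivity
  norm_num
  simpa using this

theorem one_lt_div_of_mem {E : ℕ} (hE : 1 ≤ E) {β : ℝ} (hβ : β ∈ Set.Ioo (0 : ℝ) 1) :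
    1 < (E : ℝ) / β := by
  rw [one_lt_div hβ.1]
  have : (1 : ℝ) ≤ E := by exact_mod_cast hE
  linarith [hβ.2]

theorem tightBound_le {E T : ℕ} (hE : 1 ≤ E) {ν β l : ℝ} (hν : 0 < ν)
    (hβ : β ∈ Set.Ioo (0 : ℝ) 1) (hl : 0 < l) (hlt : ν * (l + l ^ 2) < 1) :
    tightBound E T ν β ≤ 1 / 2 * E * T * ν +
      E * (1 / l * (T * expoF ν ((l + l ^ 2) / 2) + Real.log (E / β))) := by
  have hlog := (Real.log_pos (one_lt_div_of_mem hE hβ)).le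
  have hb : BddBelow (Set.range fun l : Set.Ioo (0 : ℝ) (radius ν) =>
      1 / (l : ℝ) * (T * expoF ν (((l : ℝ) + (l : ℝ) ^ 2) / 2) + Real.log (E / β))) := by
    refine ⟨0, ?_⟩
    rintro _ ⟨⟨k, hk⟩, rfl⟩
    have := expoF_nonneg hν hk.1 ((lt_radius_iff hν hk.1).1 hk.2)
    have hk0 : 0 < k := hk.1
    simp only
    positivity
  rw [tightBound]
  have := ciInf_le hb ⟨l, hl, (lt_radius_iff hν hl).2 hlt⟩
  gcongr

/-- It suffices to bound `I` at every admissible l, even if the infimum is not attained: a real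
number strictly between the infimum bound and `I` would exceed the value at some l. -/
theorem le_tightBound {E T : ℕ} (hE : 1 ≤ E) {ν β : ℝ} (hν : 0 < ν) {I : EReal}
    (h : ∀ l : ℝ, 0 < l → ν * (l + l ^ 2) < 1 → I ≤ ((1 / 2 * E * T * ν +
      E * (1 / l * (T * expoF ν ((l + l ^ 2) / 2) + Real.log (E / β))) : ℝ) : EReal)) :
    I ≤ ((tightBound E T ν β : ℝ) : EReal) := by
  by_contra hI
  obtain ⟨y, hy1, hy2⟩ := EReal.lt_iff_exists_real_btwn.1 (not_le.1 hI)
  have hE' : (0 : ℝ) < E := by exact_mod_cast hE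
  have hy1 : tightBound E T ν β < y := by exact_mod_cast hy1
  have : Nonempty (Set.Ioo (0 : ℝ) (radius ν)) := (nonempty_Ioo_radius hν).to_subtype
  rw [tightBound, ← lt_sub_iff_add_lt', ← lt_div_iff₀' hE'] at hy1
  obtain ⟨⟨l, hl⟩, hlt⟩ := exists_lt_of_ciInf_lt hy1
  rw [lt_div_iff₀' hE', lt_sub_iff_add_lt'] at hlt
  have h1 := h l hl.1 ((lt_radius_iff hν hl.1).1 hl.2)
  exact absurd (hy2.trans_le h1) (not_lt.2 (by exact_mod_cast hlt.le))

theorem explicit_numeric {w q : ℝ} (hw : 0 < w) (hq : 0 < q) :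
    ∃ l : ℝ, 0 < l ∧ w ^ 2 * (l + l ^ 2) < 1 ∧
      1 / 2 * w ^ 2 + 1 / l * (expoF (w ^ 2) ((l + l ^ 2) / 2) + q ^ 2 / 2) ≤
        w ^ 2 * (1 + 3 * q + 1 / 2 * q ^ 2) + w * (1 / 2 + 3 * q + 1 / 2 * q ^ 2) := by
  -- θ solves (3q/2 + 1/2)(1 - θ) = 4θ + 1/2, so that s ≤ θ gives (4s + 1/2)/(1 - s) ≤ 3q/2 + 1/2.
  -- The choice of l makes s ≤ θ and keeps 1/l a multiple of w² + w.
  set θ := q / (q + 3) with hθ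
  have hθ0 : 0 < θ := by positivity
  have hθ1 : θ < 1 := by rw [hθ, div_lt_one (by positivity)]; linarith
  set l := θ / (w ^ 2 + w) with hl
  have hl0 : 0 < l := by positivity
  have hwl : w ^ 2 * l ≤ w * θ := by
    have : w ^ 2 * l = w * θ / (w + 1) := by rw [hl]; field_simp
    rw [this]
    exact div_le_self (by positivity) (by linarith)
  set s := w ^ 2 * (l + l ^ 2) with hs
  have hsθ : s ≤ θ := by
    have h1 : s = θ - θ * (w + 1 - θ) / (w + 1) ^ 2 := by
      rw [hs, hl]; field_simp; ring
    rw [h1]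
    have : 0 ≤ θ * (w + 1 - θ) / (w + 1) ^ 2 := by
      have : 0 < w + 1 - θ := by linarith
      positivity
    linarith
  refine ⟨l, hl0, by linarith, ?_⟩
  have hs0 : 0 ≤ s := by positivity
  have hpos : 0 < 1 - s := by linarith
  have hθpos : 0 < 1 - θ := by linarith
  have hF : 1 / l * expoF (w ^ 2) ((l + l ^ 2) / 2) ≤ (w ^ 2 + w) * (3 / 2 * q + 1 / 2) := by
    have h1 : 1 / l * expoF (w ^ 2) ((l + l ^ 2) / 2) =
        (w ^ 2 + w ^ 2 * l) * ((4 * s + 1 / 2) / (1 - s)) := by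
      have : (1 - w ^ 2 * (l + l ^ 2)) ≠ 0 := hpos.ne'
      rw [expoF, hs, show 1 - 2 * w ^ 2 * ((l + l ^ 2) / 2) = 1 - w ^ 2 * (l + l ^ 2) by ring]
      field_simp
      ring
    have h2 : (4 * s + 1 / 2) / (1 - s) ≤ 3 / 2 * q + 1 / 2 := by
      rw [div_le_iff₀ hpos]
      have h3 : (3 / 2 * q + 1 / 2) * (1 - θ) = 4 * θ + 1 / 2 := by rw [hθ]; field_simp; ring
      have h4 : (3 / 2 * q + 1 / 2) * (1 - θ) ≤ (3 / 2 * q + 1 / 2) * (1 - s) := by gcongr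
      linarith
    have h3 : 0 ≤ (4 * s + 1 / 2) / (1 - s) := by positivity
    rw [h1]
    have h4 : w * θ ≤ w := by nlinarith
    gcongr
    linarith
  have hq2 : 1 / l * (q ^ 2 / 2) = (w ^ 2 + w) * (q ^ 2 / 2 + 3 / 2 * q) := by
    rw [hl, hθ]; field_simp
  rw [mul_add, hq2]
  linarith

theorem tightBound_le_explicitBound {E T m : ℕ} (hE : 1 ≤ E) (hT : 1 ≤ T) (hm : 1 ≤ m)
    {ζ σ β : ℝ} (hζ : 0 < ζ) (hσ : 0 < σ) (hβ : β ∈ Set.Ioo (0 : ℝ) 1) :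
    tightBound E T (m * (ζ ^ 2 / σ ^ 2)) β ≤
      explicitBound E T m ζ σ (Real.sqrt (2 / T * Real.log (E / β))) := by
  have hm' : (0 : ℝ) < m := by exact_mod_cast hm
  have hT' : (0 : ℝ) < T := by exact_mod_cast hT
  have hlog := Real.log_pos (one_lt_div_of_mem hE hβ)
  set q := Real.sqrt (2 / T * Real.log (E / β)) with hq
  have hq0 : 0 < q := Real.sqrt_pos.2 (by positivity)
  have hq2 : q ^ 2 = 2 / T * Real.log (E / β) := Real.sq_sqrt (by positivity)
  have hlogq : Real.log (E / β) = T * (q ^ 2 / 2) := by rw [hq2]; field_simp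
  set w := Real.sqrt m * (ζ / σ) with hw
  have hw0 : 0 < w := by positivity
  have hw2 : (m : ℝ) * (ζ ^ 2 / σ ^ 2) = w ^ 2 := by
    rw [hw, mul_pow, Real.sq_sqrt hm'.le, div_pow]
  obtain ⟨l, hl, hlt, hle⟩ := explicit_numeric hw0 hq0
  rw [hw2]
  refine (tightBound_le hE (by positivity) hβ hl hlt).trans ?_
  have h1 : explicitBound E T m ζ σ q = E * T *
      (w ^ 2 * (1 + 3 * q + 1 / 2 * q ^ 2) + w * (1 / 2 + 3 * q + 1 / 2 * q ^ 2)) := by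
    rw [← hw2, hw, explicitBound]; ring
  rw [h1, hlogq]
  refine le_trans (le_of_eq ?_) (mul_le_mul_of_nonneg_left hle (by positivity))
  ring

end Bounds

/-! ### Law of the answers and comparison with the product of the marginals. -/

namespace AdaptiveQueries

variable {𝓧 : Type*} [MeasurableSpace 𝓧] {d n m T E : ℕ} {r : ℝ}
variable (M : AdaptiveQueries 𝓧 d n m T E r)

/-- The path whose first `k` entries are the noisy answers on the dataset `x` with noise `z`, the
other entries being those of `z`. -/
noncomputable def answers (x : Fin n → 𝓧) (z : Fin (E * T) → Param d) :
    ℕ → Fin (E * T) → Param d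
  | 0 => z
  | k + 1 => if hk : k < E * T then
      Function.update (answers x z k) ⟨k, hk⟩
        (answers x z k ⟨k, hk⟩ + M.g ⟨k, hk⟩ (answers x z k) x)
    else answers x z k

variable (x : Fin n → 𝓧) (z : Fin (E * T) → Param d)

theorem answers_succ {k : ℕ} (hk : k < E * T) : M.answers x z (k + 1) =
    Function.update (M.answers x z k) ⟨k, hk⟩
      (M.answers x z k ⟨k, hk⟩ + M.g ⟨k, hk⟩ (M.answers x z k) x) := by
  rw [answers, dif_pos hk]

theorem answers_of_le {k : ℕ} {j : Fin (E * T)} (h : k ≤ j.1) : M.answers x z k j = z j := by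
  induction k with
  | zero => rfl
  | succ k ih =>
    have hk : k < E * T := lt_trans (Nat.lt_of_succ_le h) j.2
    rw [M.answers_succ x z hk, Function.update_of_ne (fun h' => by
      have := congrArg Fin.val h'; simp at this; omega), ih (by omega)]

/-- An answer is never changed after its own step, and later answers do not affect earlier queries.
The final path therefore satisfies the defining equations of all steps at once. -/
theorem answers_apply {k : ℕ} (hk : k ≤ E * T) {j : Fin (E * T)} (h : j.1 < k) :
    M.answers x z k j = M.g j (M.answers x z k) x + z j := by
  induction k with
  | zero => exact absurd h (Nat.not_lt_zero _)
  | succ k ih =>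
    rw [M.answers_succ x z hk]
    rcases Nat.lt_succ_iff_lt_or_eq.1 h with h | h
    · rw [Function.update_of_ne (fun h' => by
        have := congrArg Fin.val h'; simp at this; omega), M.g_adapted _ _ _
          (Fin.le_def.2 h.le : j ≤ ⟨k, hk⟩)]
      exact ih (Nat.le_of_succ_le hk) h
    · obtain rfl : j = ⟨k, hk⟩ := Fin.ext h
      rw [Function.update_self, M.g_adapted _ _ _ le_rfl,
        M.answers_of_le x z (j := ⟨k, hk⟩) (le_refl k), add_comm]

/-- The law of the noisy answers has density `exp X` relative to the noise. -/
theorem lintegral_answers {F : (Fin (E * T) → Param d) → ℝ≥0∞} (hF : Measurable F) {k : ℕ}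
    (hk : k ≤ E * T) :
    ∫⁻ z, F (M.answers x z k) ∂Measure.pi (fun _ => stdGaussian (Param d)) =
      ∫⁻ u, eexp (M.X k u x) * F u ∂Measure.pi (fun _ => stdGaussian (Param d)) := by
  induction k generalizing F with
  | zero => simp [answers, X]
  | succ k ih =>
    set jj : Fin (E * T) := ⟨k, hk⟩ with hjj
    set τ : (Fin (E * T) → Param d) → Fin (E * T) → Param d := fun u =>
      -- Coordinate k is still pure noise under the density e^{X_k}. Shifting it by g creates the
      -- next likelihood factor by Cameron-Martin.
      Function.update u jj (u jj + M.g jj u x) with hτ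
    have hτm : Measurable τ := by
      refine measurable_update'.comp (measurable_id.prodMk ?_)
      fun_prop
    have h1 : ∀ z, F (M.answers x z (k + 1)) = (F ∘ τ) (M.answers x z k) := fun z => by
      rw [M.answers_succ x z hk]; rfl
    simp_rw [h1]
    rw [ih (hF.comp hτm) (Nat.le_of_succ_le hk),
      ← lintegral_update (fun _ => stdGaussian (Param d)) jj
        (F := fun u => eexp (M.X k u x) * (F ∘ τ) u)
        (Measurable.mul (by fun_prop) (hF.comp hτm)),
      ← lintegral_update (fun _ => stdGaussian (Param d)) jj
        (F := fun u => eexp (M.X (k + 1) u x) * F u) (Measurable.mul (by fun_prop) hF)]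
    congr 1
    ext u
    have h2 : ∀ v, eexp (M.X k (Function.update u jj v) x) * (F ∘ τ) (Function.update u jj v) =
        eexp (M.X k u x) * F (Function.update u jj (v + M.g jj u x)) := by
      intro v
      rw [M.X_adapted u x v (le_refl k : k ≤ jj.1)]
      simp only [Function.comp, hτ, Function.update_self, Function.update_idem,
        M.g_adapted u x v le_rfl]
    have h3 : ∀ v, eexp (M.X (k + 1) (Function.update u jj v) x) * F (Function.update u jj v) =
        eexp (M.X k u x) * (eexp (inner ℝ v (M.g jj u x) - ‖M.g jj u x‖ ^ 2 / 2) *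
          F (Function.update u jj v)) := by
      intro v
      rw [hjj, M.X_succ_update, eexp_add, mul_assoc]
    have hFu : Measurable fun v => F (Function.update u jj v) := hF.comp (measurable_update u)
    simp_rw [h2, h3]
    rw [lintegral_const_mul' _ _ (eexp_ne_top _), lintegral_const_mul' _ _ (eexp_ne_top _),
      lintegral_stdGaussian_add hFu]

variable (P : Fin n → Measure 𝓧) [∀ i, IsProbabilityMeasure (P i)]

/-- A moment bound for the likelihood ratio bounds the joint law of answers and dataset by the
product of the marginals. -/
theorem lintegral_answers_le {α Q K : ℝ} (hα : 0 < α)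
    (hQ : ∫⁻ u, ∫⁻ x, eexp ((1 + α) * M.X (E * T) u x -
        α * Real.log (∫ x, Real.exp (M.X (E * T) u x) ∂Measure.pi P)) ∂Measure.pi P
        ∂Measure.pi (fun _ => stdGaussian (Param d)) ≤ eexp Q)
    {F : (Fin (E * T) → Param d) → (Fin n → 𝓧) → ℝ≥0∞}
    (hF : Measurable fun p : (Fin (E * T) → Param d) × (Fin n → 𝓧) => F p.1 p.2)
    (hF1 : ∀ u x, F u x ≤ 1) :
    ∫⁻ x, ∫⁻ z, F (M.answers x z (E * T)) x ∂Measure.pi (fun _ => stdGaussian (Param d))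
        ∂Measure.pi P ≤
      eexp K * ∫⁻ x, ∫⁻ x', ∫⁻ z, F (M.answers x' z (E * T)) x
        ∂Measure.pi (fun _ => stdGaussian (Param d)) ∂Measure.pi P ∂Measure.pi P +
        eexp (Q - α * K) := by
  set γ := Measure.pi (fun _ : Fin (E * T) => stdGaussian (Param d))
  set L : (Fin (E * T) → Param d) → ℝ := fun u =>
    Real.log (∫ x, Real.exp (M.X (E * T) u x) ∂Measure.pi P) with hL
  have hLm : Measurable L := by
    refine Real.measurable_log.comp ?_
    exact (StronglyMeasurable.integral_prod_right' (f := fun p : (Fin (E * T) → Param d) ×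
      (Fin n → 𝓧) => Real.exp (M.X (E * T) p.1 p.2))
        (by fun_prop : Measurable _).stronglyMeasurable).measurable
  have hFx : ∀ x, Measurable fun u => F u x := fun x => hF.comp (measurable_id.prodMk measurable_const)
  have hFu : ∀ u, Measurable fun x => F u x := fun u => hF.comp (measurable_const.prodMk measurable_id)
  have hLe : ∀ u, eexp (L u) = ∫⁻ x, eexp (M.X (E * T) u x) ∂Measure.pi P := fun u =>
    (lintegral_eexp_eq (M.bddMeas_X (E * T) u) _).symm
  have hpt : ∀ u x, eexp (M.X (E * T) u x) * F u x ≤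
      eexp K * (eexp (L u) * F u x) + eexp (-(α * K)) *
        eexp ((1 + α) * M.X (E * T) u x - α * L u) := by
    intro u x
    -- Chernoff: where X exceeds K + L, the test function is bounded by 1 and e^X by e^X e^{α(X - L
    -- - K)}.
    rcases le_total (M.X (E * T) u x) (K + L u) with h | h
    · refine le_add_right ?_
      rw [← mul_assoc, ← eexp_add]
      exact mul_le_mul_left (eexp_mono h) _
    · refine le_add_left ?_
      refine (mul_le_of_le_one_right' (hF1 u x)).trans ?_
      rw [← eexp_add]
      refine eexp_mono ?_
      have := mul_le_mul_of_nonneg_left h hα.le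
      linarith
  have hgirsanov : ∀ x x', ∫⁻ z, F (M.answers x' z (E * T)) x ∂γ =
      ∫⁻ u, eexp (M.X (E * T) u x') * F u x ∂γ := fun x x' =>
    M.lintegral_answers x' (hFx x) le_rfl
  simp_rw [hgirsanov]
  have hmain : Measurable fun p : (Fin n → 𝓧) × (Fin (E * T) → Param d) => F p.2 p.1 :=
    hF.comp measurable_swap
  have hLm1 : Measurable fun p : (Fin n → 𝓧) × (Fin (E * T) → Param d) => L p.2 :=
    hLm.comp measurable_snd
  have hA : Measurable fun p : (Fin n → 𝓧) × (Fin (E * T) → Param d) =>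
      eexp (L p.2) * F p.2 p.1 := hLm1.eexp.mul hmain
  have hB : Measurable fun p : (Fin n → 𝓧) × (Fin (E * T) → Param d) =>
      eexp ((1 + α) * M.X (E * T) p.2 p.1 - α * L p.2) := by fun_prop
  calc ∫⁻ x, ∫⁻ u, eexp (M.X (E * T) u x) * F u x ∂γ ∂Measure.pi P
      ≤ ∫⁻ x, ∫⁻ u, (eexp K * (eexp (L u) * F u x) + eexp (-(α * K)) *
        eexp ((1 + α) * M.X (E * T) u x - α * L u)) ∂γ ∂Measure.pi P :=
        lintegral_mono fun x => lintegral_mono fun u => hpt u x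
    _ = eexp K * (∫⁻ x, ∫⁻ u, eexp (L u) * F u x ∂γ ∂Measure.pi P) +
        eexp (-(α * K)) * ∫⁻ x, ∫⁻ u, eexp ((1 + α) * M.X (E * T) u x - α * L u)
          ∂γ ∂Measure.pi P := by
        have h1 : ∀ x, Measurable fun u => eexp (L u) * F u x := fun x =>
          hLm.eexp.mul (hFx x)
        simp_rw [fun x => lintegral_add_left ((h1 x).const_mul (eexp K)) (μ := γ)]
        simp_rw [lintegral_const_mul' _ _ (eexp_ne_top _)]
        rw [lintegral_add_left ((Measurable.lintegral_prod_right' (ν := γ) hA).const_mul _)]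
        rw [lintegral_const_mul' _ _ (eexp_ne_top _), lintegral_const_mul' _ _ (eexp_ne_top _)]
    _ ≤ _ := by
        refine add_le_add (mul_le_mul_right (le_of_eq ?_) _) ?_
        · congr 1
          ext x
          simp_rw [hLe]
          rw [lintegral_lintegral_swap]
          · refine lintegral_congr fun u => ?_
            exact (lintegral_mul_const _ (by fun_prop)).symm
          · exact (Measurable.mul (by fun_prop)
              ((hFx x).comp measurable_snd)).aemeasurable
        · rw [lintegral_lintegral_swap hB.aemeasurable, sub_eq_add_neg, add_comm Q, eexp_add]
          exact mul_le_mul_right hQ _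

end AdaptiveQueries

/-! ### DP-SGD as adaptive queries. -/

section Run

theorem measurable_clip {d : ℕ} (ζ : ℝ) : Measurable fun v : Param d => clip v ζ := by
  unfold clip
  fun_prop

theorem norm_clip_le {d : ℕ} (v : Param d) {ζ : ℝ} (hζ : 0 < ζ) : ‖clip v ζ‖ ≤ ζ := by
  rw [clip, norm_smul, Real.norm_eq_abs, abs_of_nonneg (by positivity)]
  refine (mul_le_mul_of_nonneg_right (min_le_right _ _) (norm_nonneg _)).trans ?_
  rcases eq_or_ne ‖v‖ 0 with h | h
  · rw [h, mul_zero]; exact hζ.le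
  · rw [div_mul_cancel₀ _ h]

theorem measurable_snoc {α β : Type*} [MeasurableSpace α] [MeasurableSpace β] {k : ℕ}
    {f : α → Fin k → β} {g : α → β} (hf : Measurable f) (hg : Measurable g) :
    Measurable fun a => (Fin.snoc (f a) (g a) : Fin (k + 1) → β) := by
  refine measurable_pi_iff.2 fun i => ?_
  refine Fin.lastCases ?_ (fun i => ?_) i
  · simpa using hg
  · simp only [Fin.snoc_castSucc]
    exact (measurable_pi_apply i).comp hf

variable {𝓧 : Type*} [MeasurableSpace 𝓧] {d n m T E : ℕ}

/-- The parameters `θ_0, …, θ_k` as a function of the update vectors divided by `σ`. -/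
noncomputable def paramPath (upd : UpdateRule d) (η : Fin T → ℝ) (σ : ℝ) (θ₀ : Param d)
    (u : Fin (E * T) → Param d) : (k : ℕ) → k ≤ E * T → Fin (k + 1) → Param d
  | 0, _ => fun _ => θ₀
  | k + 1, hk =>
    let past := paramPath upd η σ θ₀ u k (Nat.le_of_succ_le hk)
    Fin.snoc past (upd (η (⟨k, hk⟩ : Fin (E * T)).modNat) k past
      fun i => σ • u ⟨i, lt_of_lt_of_le i.2 hk⟩)

theorem measurable_paramPath {upd : UpdateRule d} (hupd : ∀ (a : ℝ) (k : ℕ), Measurable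
      fun p : (Fin (k + 1) → Param d) × (Fin (k + 1) → Param d) => upd a k p.1 p.2)
    (η : Fin T → ℝ) (σ : ℝ) (θ₀ : Param d) (k : ℕ) (hk : k ≤ E * T) :
    Measurable fun u => paramPath upd η σ θ₀ u k hk := by
  induction k with
  | zero => exact measurable_const
  | succ k ih =>
    have h := ih (Nat.le_of_succ_le hk)
    refine measurable_snoc h ((hupd _ k).comp (h.prodMk ?_))
    fun_prop

theorem paramPath_update (upd : UpdateRule d) (η : Fin T → ℝ) (σ : ℝ) (θ₀ : Param d)
    (u : Fin (E * T) → Param d) (j : Fin (E * T)) (v : Param d) {k : ℕ} (hk : k ≤ E * T)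
    (h : k ≤ j.1) :
    paramPath upd η σ θ₀ (Function.update u j v) k hk = paramPath upd η σ θ₀ u k hk := by
  induction k with
  | zero => rfl
  | succ k ih =>
    simp only [paramPath]
    rw [ih _ (Nat.le_of_succ_le h)]
    congr 2
    ext1 i
    rw [Function.update_of_ne]
    intro h'
    have h1 := congrArg Fin.val h'
    have h2 := i.2
    simp only at h1
    omega

/-- The queries made by DP-SGD, in units of the noise level. -/
noncomputable def dpsgdQueries {loss : 𝓧 → Param d → ℝ}
    (hloss : Measurable fun p : 𝓧 × Param d => gradient (loss p.1) p.2)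
    {upd : UpdateRule d} (hupd : ∀ (a : ℝ) (k : ℕ), Measurable
      fun p : (Fin (k + 1) → Param d) × (Fin (k + 1) → Param d) => upd a k p.1 p.2)
    (η : Fin T → ℝ) {ζ σ : ℝ} (hζ : 0 < ζ) (hσ : 0 < σ) (θ₀ : Param d)
    (B : Fin E → EpochBatches n m T) : AdaptiveQueries 𝓧 d n m T E (ζ / σ) where
  φ j u y := σ⁻¹ • clip (gradient (loss y) (paramPath upd η σ θ₀ u j j.2.le (Fin.last j))) ζ
  I j := (B j.divNat).1 j.modNat
  meas j := by
    have hθ : Measurable fun p : (Fin (E * T) → Param d) × 𝓧 =>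
        paramPath upd η σ θ₀ p.1 j j.2.le (Fin.last j) :=
      (measurable_pi_apply _).comp
        ((measurable_paramPath hupd η σ θ₀ j j.2.le).comp measurable_fst)
    exact ((measurable_clip ζ).comp (hloss.comp (measurable_snd.prodMk hθ))).const_smul σ⁻¹
  norm_le j u y := by
    rw [norm_smul, norm_inv, Real.norm_eq_abs, abs_of_pos hσ, div_eq_inv_mul]
    exact mul_le_mul_of_nonneg_left (norm_clip_le _ hζ) (by positivity)
  adapted l j u v h := by
    ext1 y
    rw [paramPath_update _ _ _ _ _ _ _ _ h]
  card j := (B j.divNat).2.1 j.modNat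
  epoch_lt l j i hlj hl hj := by
    refine lt_of_le_of_ne (Nat.div_le_div_right hlj.le) fun h => ?_
    have h1 : l.divNat = j.divNat := Fin.ext h
    have h2 : l.modNat ≠ j.modNat := fun h' => by
      have h3 : l.1 % T = j.1 % T := congrArg Fin.val h'
      have h4 := Nat.div_add_mod l.1 T
      rw [h, h3, Nat.div_add_mod] at h4
      exact hlj.ne (Fin.ext h4.symm)
    rw [h1] at hl
    exact Finset.disjoint_left.1 ((B j.divNat).2.2 _ _ h2) hl hj

/-- All parameters are functions of the noisy answers alone once initialization and batches are
fixed, so bounds on the answers pass to every output. -/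
theorem dpsgdRun_eq {loss : 𝓧 → Param d → ℝ}
    (hloss : Measurable fun p : 𝓧 × Param d => gradient (loss p.1) p.2)
    {upd : UpdateRule d} (hupd : ∀ (a : ℝ) (k : ℕ), Measurable
      fun p : (Fin (k + 1) → Param d) × (Fin (k + 1) → Param d) => upd a k p.1 p.2)
    (η : Fin T → ℝ) {ζ σ : ℝ} (hζ : 0 < ζ) (hσ : 0 < σ) (θ₀ : Param d)
    (B : Fin E → EpochBatches n m T) (x : Fin n → 𝓧) (z : Fin (E * T) → Param d) (k : ℕ)
    (hk : k ≤ E * T) :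
    dpsgdRun loss upd η ζ σ x θ₀ B z k hk =
      (paramPath upd η σ θ₀ ((dpsgdQueries hloss hupd η hζ hσ θ₀ B).answers x z (E * T)) k hk,
        fun i : Fin k => σ • (dpsgdQueries hloss hupd η hζ hσ θ₀ B).answers x z (E * T)
          ⟨i, lt_of_lt_of_le i.2 hk⟩) := by
  set M := dpsgdQueries hloss hupd η hζ hσ θ₀ B with hM
  set u := M.answers x z (E * T) with hu
  induction k with
  | zero =>
    simp only [dpsgdRun, paramPath]
    congr 1
    ext1 i
    exact i.elim0
  | succ k ih =>
    have hrun := ih (Nat.le_of_succ_le hk)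
    have hanswer : ∑ i ∈ (B (⟨k, hk⟩ : Fin (E * T)).divNat).1 (⟨k, hk⟩ : Fin (E * T)).modNat,
        clip (gradient (loss (x i))
          (paramPath upd η σ θ₀ u k (Nat.le_of_succ_le hk) (Fin.last k))) ζ + σ • z ⟨k, hk⟩ =
        σ • u ⟨k, hk⟩ := by
      rw [hu, M.answers_apply x z le_rfl (j := ⟨k, hk⟩) hk, ← hu, smul_add, AdaptiveQueries.g, Finset.smul_sum]
      congr 1
      refine Finset.sum_congr rfl fun i _ => ?_
      exact (smul_inv_smul₀ hσ.ne' _).symm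
    have hsnoc : (Fin.snoc (fun i : Fin k => σ • u ⟨i, lt_of_lt_of_le i.2 (Nat.le_of_succ_le hk)⟩)
        (σ • u ⟨k, hk⟩) : Fin (k + 1) → Param d) =
        fun i : Fin (k + 1) => σ • u ⟨i, lt_of_lt_of_le i.2 hk⟩ := by
      ext1 i
      refine Fin.lastCases ?_ (fun i => ?_) i
      · simp
      · simp
    simp only [dpsgdRun, hrun, hanswer, hsnoc, paramPath]

theorem measurable_dpsgdRun {loss : 𝓧 → Param d → ℝ}
    (hloss : Measurable fun p : 𝓧 × Param d => gradient (loss p.1) p.2)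
    {upd : UpdateRule d} (hupd : ∀ (a : ℝ) (k : ℕ), Measurable
      fun p : (Fin (k + 1) → Param d) × (Fin (k + 1) → Param d) => upd a k p.1 p.2)
    (η : Fin T → ℝ) (ζ σ : ℝ) (k : ℕ) (hk : k ≤ E * T) :
    Measurable fun w : (Fin n → 𝓧) × (Param d × (Fin E → EpochBatches n m T)) ×
      (Fin (E * T) → Param d) => dpsgdRun loss upd η ζ σ w.1 w.2.1.1 w.2.1.2 w.2.2 k hk := by
  have h : Measurable fun p : ((Fin n → 𝓧) × Param d × (Fin (E * T) → Param d)) ×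
      (Fin E → EpochBatches n m T) =>
      dpsgdRun loss upd η ζ σ p.1.1 p.1.2.1 p.2 p.1.2.2 k hk := by
    -- The batches range over a finite set, so joint measurability is checked for each fixed choice.
    refine measurable_from_prod_countable_left fun B => ?_
    simp only
    induction k with
    | zero =>
      refine Measurable.prodMk (measurable_pi_iff.2 fun _ => ?_) measurable_const
      exact measurable_fst.comp measurable_snd
    | succ k ih =>
      have hpast := ih (Nat.le_of_succ_le hk)
      have hθ : Measurable fun p : (Fin n → 𝓧) × Param d × (Fin (E * T) → Param d) =>
          (dpsgdRun loss upd η ζ σ p.1 p.2.1 B p.2.2 k (Nat.le_of_succ_le hk)).1 (Fin.last k) :=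
        (measurable_pi_apply _).comp (measurable_fst.comp hpast)
      have hus := measurable_snoc (measurable_snd.comp hpast)
        ((Finset.measurable_sum ((B (⟨k, hk⟩ : Fin (E * T)).divNat).1
            (⟨k, hk⟩ : Fin (E * T)).modNat) fun i _ =>
          (measurable_clip ζ).comp (hloss.comp
            (((measurable_pi_apply i).comp measurable_fst).prodMk hθ))).add
          (((measurable_pi_apply (⟨k, hk⟩ : Fin (E * T))).comp
            (measurable_snd.comp measurable_snd)).const_smul σ))
      exact (measurable_snoc (measurable_fst.comp hpast)
        ((hupd _ k).comp ((measurable_fst.comp hpast).prodMk hus))).prodMk hus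
  exact h.comp (by fun_prop : Measurable fun w : (Fin n → 𝓧) ×
    (Param d × (Fin E → EpochBatches n m T)) × (Fin (E * T) → Param d) =>
      ((w.1, w.2.1.1, w.2.2), w.2.1.2))

end Run

/-! ### From moments to max-information. -/

section MaxInformation

theorem log_eexp (K : ℝ) : ENNReal.log (eexp K) = (K : EReal) := by
  rw [eexp, ENNReal.log_ofReal_of_pos (Real.exp_pos _), Real.log_exp]

theorem approxMaxDivergence_le {α : Type*} [MeasurableSpace α] {β K : ℝ} {P Q : Measure α}
    (h : ∀ O, MeasurableSet O → P O ≤ eexp K * Q O + ENNReal.ofReal β) :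
    approxMaxDivergence β P Q ≤ (K : EReal) := by
  refine iSup_le fun O => iSup_le fun hO => iSup_le fun _ => ?_
  rw [← log_eexp K, ENNReal.log_le_log_iff]
  exact ENNReal.div_le_of_le_mul (tsub_le_iff_right.2 (h O hO))

variable {𝓧 : Type*} [MeasurableSpace 𝓧] {d n m T E : ℕ}
variable {P : Fin n → Measure 𝓧} [∀ i, IsProbabilityMeasure (P i)]
variable {init : Measure (Param d × (Fin E → EpochBatches n m T))} [IsProbabilityMeasure init]

theorem lintegral_dpsgdInputLaw {H : (Fin n → 𝓧) × (Param d × (Fin E → EpochBatches n m T)) ×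
      (Fin (E * T) → Param d) → ℝ≥0∞} (hH : Measurable H) :
    ∫⁻ w, H w ∂dpsgdInputLaw P init = ∫⁻ ω, ∫⁻ x, ∫⁻ z, H (x, ω, z)
      ∂Measure.pi (fun _ => stdGaussian (Param d)) ∂Measure.pi P ∂init := by
  rw [dpsgdInputLaw, lintegral_prod _ hH.aemeasurable]
  have h1 : ∀ x, ∫⁻ y, H (x, y) ∂(init.prod (Measure.pi fun _ => stdGaussian (Param d))) =
      ∫⁻ ω, ∫⁻ z, H (x, ω, z) ∂Measure.pi (fun _ => stdGaussian (Param d)) ∂init := fun x =>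
    lintegral_prod _ (hH.comp measurable_prodMk_left).aemeasurable
  simp_rw [h1]
  refine lintegral_lintegral_swap (Measurable.aemeasurable ?_)
  exact Measurable.lintegral_prod_right' (f := fun p : ((Fin n → 𝓧) × (Param d ×
    (Fin E → EpochBatches n m T))) × (Fin (E * T) → Param d) => H (p.1.1, p.1.2, p.2))
    (hH.comp (by fun_prop))

instance : IsProbabilityMeasure (dpsgdInputLaw P init) := by
  unfold dpsgdInputLaw
  infer_instance

/-- Conditioning on the data-independent randomness reduces a bound on the joint law of output and
dataset to bounds for fixed initialization and batches. -/
theorem map_dpsgdInputLaw_le {α : Type*} [MeasurableSpace α]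
    {A : (Fin n → 𝓧) × (Param d × (Fin E → EpochBatches n m T)) × (Fin (E * T) → Param d) → α}
    (hA : Measurable A) {a b : ℝ≥0∞} (ha : a ≠ ∞)
    (h : ∀ (ω : Param d × (Fin E → EpochBatches n m T)) (G : α → (Fin n → 𝓧) → ℝ≥0∞),
      Measurable (Function.uncurry G) → (∀ y x, G y x ≤ 1) →
      ∫⁻ x, ∫⁻ z, G (A (x, ω, z)) x ∂Measure.pi (fun _ => stdGaussian (Param d)) ∂Measure.pi P ≤
        a * ∫⁻ x, ∫⁻ x', ∫⁻ z, G (A (x', ω, z)) x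
          ∂Measure.pi (fun _ => stdGaussian (Param d)) ∂Measure.pi P ∂Measure.pi P + b)
    {O : Set (α × (Fin n → 𝓧))} (hO : MeasurableSet O) :
    (dpsgdInputLaw P init).map (fun w => (A w, w.1)) O ≤
      a * (((dpsgdInputLaw P init).map fun w => (A w, w.1)).fst.prod
        ((dpsgdInputLaw P init).map fun w => (A w, w.1)).snd) O + b := by
  set γ := Measure.pi (fun _ : Fin (E * T) => stdGaussian (Param d)) with hγ
  set G : α → (Fin n → 𝓧) → ℝ≥0∞ := fun y x => O.indicator 1 (y, x) with hG
  have hGm : Measurable (Function.uncurry G) := measurable_one.indicator hO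
  have hG1 : ∀ y x, G y x ≤ 1 := fun y x => Set.indicator_le_self' (by simp) _
  have hAw : Measurable fun w => (A w, w.1) := hA.prodMk measurable_fst
  have hfst : ((dpsgdInputLaw P init).map fun w => (A w, w.1)).fst =
      (dpsgdInputLaw P init).map A := by
    rw [Measure.fst, Measure.map_map measurable_fst hAw]; rfl
  have hsnd : ((dpsgdInputLaw P init).map fun w => (A w, w.1)).snd = Measure.pi P := by
    rw [Measure.snd, Measure.map_map measurable_snd hAw]
    exact Measure.fst_prod
  have h1 : (dpsgdInputLaw P init).map (fun w => (A w, w.1)) O =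
      ∫⁻ ω, ∫⁻ x, ∫⁻ z, G (A (x, ω, z)) x ∂γ ∂Measure.pi P ∂init := by
    rw [← lintegral_indicator_one hO, lintegral_map (measurable_one.indicator hO) hAw]
    exact lintegral_dpsgdInputLaw ((measurable_one.indicator hO).comp hAw)
  -- The dataset is independent of initialization and batches, so the product of the marginals is
  -- the mixture over ω of the conditional products. This is why bounds for fixed ω can be
  -- integrated.
  have h2 : (((dpsgdInputLaw P init).map fun w => (A w, w.1)).fst.prod
        ((dpsgdInputLaw P init).map fun w => (A w, w.1)).snd) O =
      ∫⁻ ω, ∫⁻ x, ∫⁻ x', ∫⁻ z, G (A (x', ω, z)) x ∂γ ∂Measure.pi P ∂Measure.pi P ∂init := by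
    have : IsProbabilityMeasure ((dpsgdInputLaw P init).map A) :=
      Measure.isProbabilityMeasure_map hA.aemeasurable
    rw [hfst, hsnd, ← lintegral_indicator_one hO,
      lintegral_prod_symm _ (measurable_one.indicator hO).aemeasurable]
    have h3 : ∀ x, ∫⁻ y, O.indicator 1 (y, x) ∂(dpsgdInputLaw P init).map A =
        ∫⁻ ω, ∫⁻ x', ∫⁻ z, G (A (x', ω, z)) x ∂γ ∂Measure.pi P ∂init := by
      intro x
      have hGx : Measurable fun y => G y x := hGm.comp measurable_prodMk_right
      exact (lintegral_map hGx hA).trans (lintegral_dpsgdInputLaw (hGx.comp hA))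
    simp_rw [h3]
    refine lintegral_lintegral_swap (Measurable.aemeasurable ?_)
    refine Measurable.lintegral_prod_right' (f := fun p : ((Fin n → 𝓧) × (Param d ×
      (Fin E → EpochBatches n m T))) × (Fin n → 𝓧) => ∫⁻ z, G (A (p.2, p.1.2, z)) p.1.1 ∂γ) ?_
    exact Measurable.lintegral_prod_right' (f := fun p : (((Fin n → 𝓧) × (Param d ×
      (Fin E → EpochBatches n m T))) × (Fin n → 𝓧)) × (Fin (E * T) → Param d) =>
        G (A (p.1.2, p.1.1.2, p.2)) p.1.1.1)
      (hGm.comp ((hA.comp (by fun_prop)).prodMk (by fun_prop)))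
  rw [h1, h2, ← lintegral_const_mul' _ _ ha]
  refine (lintegral_mono fun ω => h ω G hGm hG1).trans (le_of_eq ?_)
  rw [lintegral_add_right _ measurable_const]
  simp

/-- Max-information bound for any function of the parameters computed by DP-SGD. -/
theorem approxMaxInformation_dpsgd_le (hm : 1 ≤ m) (hE : 1 ≤ E) {ζ σ : ℝ}
    (hζ : 0 < ζ) (hσ : 0 < σ) {loss : 𝓧 → Param d → ℝ}
    (hloss : Measurable fun p : 𝓧 × Param d => gradient (loss p.1) p.2)
    (η : Fin T → ℝ) {upd : UpdateRule d} (hupd : ∀ (a : ℝ) (k : ℕ), Measurable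
      fun p : (Fin (k + 1) → Param d) × (Fin (k + 1) → Param d) => upd a k p.1 p.2)
    {β : ℝ} (hβ : β ∈ Set.Ioo (0 : ℝ) 1) {α : Type*} [MeasurableSpace α]
    {out : (Fin (E * T + 1) → Param d) → α} (hout : Measurable out) :
    approxMaxInformation β ((dpsgdInputLaw P init).map fun w =>
        (out (dpsgdRun loss upd η ζ σ w.1 w.2.1.1 w.2.1.2 w.2.2 (E * T) le_rfl).1, w.1)) ≤
      ((tightBound E T (m * (ζ ^ 2 / σ ^ 2)) β : ℝ) : EReal) := by
  have hm' : (0 : ℝ) < m := by exact_mod_cast hm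
  have hE' : (0 : ℝ) < E := by exact_mod_cast hE
  set ν : ℝ := m * (ζ ^ 2 / σ ^ 2) with hν
  have hν' : ν = m * (ζ / σ) ^ 2 := by rw [hν, div_pow]
  refine le_tightBound hE (by positivity) fun l hl hlt => ?_
  set K := 1 / 2 * E * T * ν +
    E * (1 / l * (T * expoF ν ((l + l ^ 2) / 2) + Real.log (E / β))) with hK
  refine approxMaxDivergence_le fun O hO => ?_
  refine map_dpsgdInputLaw_le (A := fun w =>
    out (dpsgdRun loss upd η ζ σ w.1 w.2.1.1 w.2.1.2 w.2.2 (E * T) le_rfl).1)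
    (hout.comp (measurable_fst.comp (measurable_dpsgdRun hloss hupd η ζ σ _ _)))
    (eexp_ne_top K) (fun ω G hG hG1 => ?_) hO
  set M := dpsgdQueries hloss hupd η hζ hσ ω.1 ω.2
  simp only [dpsgdRun_eq hloss hupd η hζ hσ]
  have hF : Measurable fun p : (Fin (E * T) → Param d) × (Fin n → 𝓧) =>
      G (out (paramPath upd η σ ω.1 p.1 (E * T) le_rfl)) p.2 :=
    hG.comp ((hout.comp ((measurable_paramPath hupd η σ ω.1 _ _).comp measurable_fst)).prodMk
      measurable_snd)
  refine (M.lintegral_answers_le P (K := K) (by positivity)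
    (M.lintegral_moment_le P hE hm (by positivity) hν' hl hlt)
    (F := fun u x => G (out (paramPath upd η σ ω.1 u (E * T) le_rfl)) x) hF
    (fun u x => hG1 _ _)).trans (add_le_add le_rfl ?_)
  rw [← Real.exp_log hβ.1]
  refine eexp_mono ?_
  -- With α = l/E, αK exceeds the moment exponent by exactly log(E/β). The exceptional mass is
  -- therefore at most β/E ≤ β.
  have h1 : l / E * K = 1 / 2 * T * ν * l + (T * expoF ν ((l + l ^ 2) / 2) + Real.log (E / β)) := by
    rw [hK]; field_simp
  have h2 : 0 ≤ Real.log E := Real.log_nonneg (by exact_mod_cast hE)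
  rw [h1, Real.log_div hE'.ne' hβ.1.ne']
  linarith

end MaxInformation

theorem theorem1 {𝓧 : Type*} [MeasurableSpace 𝓧] {d n m T E : ℕ}
    (hm : 1 ≤ m) (hT : 1 ≤ T) (hE : 1 ≤ E) (hn : T * m ≤ n)
    (ζ σ : ℝ) (hζ : 0 < ζ) (hσ : 0 < σ)
    (loss : 𝓧 → Param d → ℝ)
    (hloss : Measurable fun p : 𝓧 × Param d => gradient (loss p.1) p.2)
    (η : Fin T → ℝ) (upd : UpdateRule d)
    (hupd : ∀ (a : ℝ) (k : ℕ), Measurable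
      fun p : (Fin (k + 1) → Param d) × (Fin (k + 1) → Param d) => upd a k p.1 p.2)
    (P : Fin n → Measure 𝓧) [∀ i, IsProbabilityMeasure (P i)]
    (init : Measure (Param d × (Fin E → EpochBatches n m T))) [IsProbabilityMeasure init]
    (β : ℝ) (hβ : β ∈ Set.Ioo (0 : ℝ) 1) :
    approxMaxInformation β (streamJointLaw loss upd η ζ σ P init)
        ≤ ((tightBound E T (m * (ζ ^ 2 / σ ^ 2)) β : ℝ) : EReal) ∧
      approxMaxInformation β (batchJointLaw loss upd η ζ σ P init)
        ≤ ((tightBound E T (m * (ζ ^ 2 / σ ^ 2)) β : ℝ) : EReal) ∧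
      tightBound E T (m * (ζ ^ 2 / σ ^ 2)) β
        ≤ explicitBound E T m ζ σ (Real.sqrt (2 / T * Real.log (E / β))) :=
  ⟨approxMaxInformation_dpsgd_le hm hE hζ hσ hloss η hupd hβ (out := Fin.tail)
      (measurable_pi_iff.2 fun i => measurable_pi_apply i.succ),
    approxMaxInformation_dpsgd_le hm hE hζ hσ hloss η hupd hβ
      (out := fun θ => θ (Fin.last (E * T))) (measurable_pi_apply _),
    tightBound_le_explicitBound hE hT hm hζ hσ hβ⟩
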